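/- Let $2\le k\le l$, and let $\mathcal E=\mathbb R^{1+k+l}$ with coordinates $(x,y_0,\dots,y_{k-1},z_0,\dots,z_{l-1})$ be the equation manifold $y_k=z_l=0$ of the system $y^{(k)}(x)=z^{(l)}(x)=0$ in the mixed jet space $J^{k,l}(\mathbb R,\mathbb R^2)$. Put $D=\partial_x+\sum_{i=0}^{k-2}y_{i+1}\partial_{y_i}+\sum_{j=0}^{l-2}z_{j+1}\partial_{z_j}$. For $\delta\in\mathbb Z$ the EDS of shift $\delta$ is the pair of distributions $E=\langle D\rangle$ and $F=\langle \partial_{y_i},\partial_{z_j} : i>\max(0,-\delta),\ j>\max(0,\delta)\rangle$ on $\mathcal E$. Its symmetry algebra is the Lie algebra of all smooth vector fields $S$ on $\mathcal E$ with $[S,E]\subset E$ and $[S,F]\subset F$. A symbol $a\,\partial_x+b\,\partial_{y_0}+c\,\partial_{z_0}$ stands below for its prolongation to $\mathcal E$, the vector field $a\,\partial_x+\sum_i b_i\partial_{y_i}+\sum_j c_j\partial_{z_j}$ with $b_0=b$, $b_{i+1}=D b_i-y_{i+1}Da$, $c_0=c$, $c_{j+1}=Dc_j-z_{j+1}Da$.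 For $u=y$ or $u=z$ let $g_{i,j}[u]=\frac{x^{i+j}}{(i+j)!}D^i(u_0/x^j)$ (a polynomial in $x,u_0,\dots,u_i$) and $g^{(s)}_{i,j}[u]=\partial^s g_{i,j}[u]/\partial x^s$. Let $$C_{k,l}=\{\partial_x,\ x\partial_x,\ x^2\partial_x+(k-1)xy_0\partial_{y_0}+(l-1)xz_0\partial_{z_0},\ y_0\partial_{y_0},\ z_0\partial_{z_0}\}.$$ Then the symmetry algebra of the EDS of shift $\delta$ is the real span of the prolongations of the following symbols. 1. If $0<\delta<l-k$: $C_{k,l}$; $x^i\partial_{y_0}$ ($0\le i\le k-1$); $x^j\partial_{z_0}$ ($0\le j\le l-1$). 1a. If $\delta=0$ and $2=k<l$: $\partial_x,\partial_{y_0},x\partial_x,x\partial_{y_0},y_0\partial_x,y_0\partial_{y_0},z_0\partial_{z_0}$, $x^2\partial_x+xy_0\partial_{y_0}+(l-1)xz_0\partial_{z_0}$, $xy_0\partial_x+y_0^2\partial_{y_0}+(l-1)y_0z_0\partial_{z_0}$; $x^iy_0^j\partial_{z_0}$ ($i+j\le l-1$). If $\delta=0$ and $2<k<l$: $C_{k,l}$;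 $x^i\partial_{y_0}$ ($0\le i\le k-1$); $x^iy_0^j\partial_{z_0}$ ($i+(k-1)j\le l-1$). 1b. If $\delta=l-k>0$ and $(k,l)\ne(2,3)$: $C_{k,l}$; $x^j\partial_{z_0}$ ($0\le j\le l-1$); $x^i\partial_{y_0}$ ($0\le i\le k-1$); $g^{(s)}_{l-k,k}[z]\,\partial_{y_0}$ ($0\le s\le l-k$). 2. If $k=3\le l$ and $\delta=-1$: $x(2y_0-xy_1)\partial_x+(2y_0^2-\tfrac12x^2y_1^2)\partial_{y_0}+(l-1)z_0(2y_0-xy_1)\partial_{z_0}$, $2(y_0-xy_1)\partial_x-xy_1^2\partial_{y_0}-(l-1)z_0y_1\partial_{z_0}$, $x^2\partial_x+2xy_0\partial_{y_0}+(l-1)xz_0\partial_{z_0}$, $x\partial_x,\ y_0\partial_{y_0},\ z_0\partial_{z_0},\ y_1\partial_x+\tfrac12y_1^2\partial_{y_0},\ \partial_x,\ \partial_{y_0},\ x\partial_{y_0},\ x^2\partial_{y_0}$, $x^i(xy_1-2y_0)^{j_0}y_1^{j_1}\partial_{z_0}$ ($i+j_0+j_1\le l-1$). This symmetry algebra is isomorphic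 to $\mathfrak{csp}(4,\mathbb R)\ltimes S^{l-1}(\mathbb R^4)$. 3. If $l=3$ and $\delta=1$ (so $k\in\{2,3\}$), the same with $y$ and $z$, and $k$ and $l$, exchanged; this symmetry algebra is isomorphic to $\mathfrak{csp}(4,\mathbb R)\ltimes S^{k-1}(\mathbb R^4)$. 4. If $3\le k\le l$, $(k,l)\ne(3,3)$ and $l-k<\delta\le l-2$: $C_{k,l}$; $x^i\partial_{z_0}$ ($0\le i\le l-1$); $x^i g^{(s_1)}_{\delta,l-\delta}[z]\cdots g^{(s_j)}_{\delta,l-\delta}[z]\,\partial_{y_0}$ ($j\ge0$, $0\le s_t\le\delta$, $i+(l-\delta-1)j\le k-1$). 5. If $4\le k\le l$ and $-k+2\le\delta<0$: the symbols of item 4 with $y$ and $z$, and $k$ and $l$, exchanged and $\delta$ replaced by $-\delta$, that is, $C_{k,l}$; $x^i\partial_{y_0}$ ($0\le i\le k-1$); $x^i g^{(s_1)}_{-\delta,k+\delta}[y]\cdots g^{(s_j)}_{-\delta,k+\delta}[y]\,\partial_{z_0}$ ($j\ge0$, $0\le s_t\le-\delta$, $i+(k+\delta-1)j\le l-1$).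 -/

import Mathlib

open scoped ContDiff

noncomputable section

/-! ### The equation manifold and its vector fields -/

/-- The equation manifold `y_k = z_l = 0` in the mixed jet space `J^{k,l}(ℝ, ℝ²)`, in the
coordinates `(x, (y_0, …, y_{k-1}), (z_0, …, z_{l-1}))`. -/
abbrev EqMan (k l : ℕ) : Type := ℝ × (Fin k → ℝ) × (Fin l → ℝ)

namespace EqMan

variable {k l : ℕ}

/-- The coordinate function `x`. -/
def X : EqMan k l → ℝ := fun p => p.1

/-- The function `y_i` on the equation manifold (so it is `0` for `i ≥ k`). -/
def Y (i : ℕ) : EqMan k l → ℝ := fun p => if h : i < k then p.2.1 ⟨i, h⟩ else 0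

/-- The function `z_j` on the equation manifold (so it is `0` for `j ≥ l`). -/
def Z (j : ℕ) : EqMan k l → ℝ := fun p => if h : j < l then p.2.2 ⟨j, h⟩ else 0

/-- The coordinate vector `∂/∂x`. -/
def dX : EqMan k l := (1, 0, 0)

/-- The coordinate vector `∂/∂y_i`. -/
def dY (i : Fin k) : EqMan k l := (0, Pi.single i 1, 0)

/-- The coordinate vector `∂/∂z_j`. -/
def dZ (j : Fin l) : EqMan k l := (0, 0, Pi.single j 1)

/-- The vector field
`∂/∂x + y_1 ∂/∂y_0 + … + y_{k-1} ∂/∂y_{k-2} + z_1 ∂/∂z_0 + … + z_{l-1} ∂/∂z_{l-2}`. -/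
def total (p : EqMan k l) : EqMan k l :=
  (1, fun i => Y ((i : ℕ) + 1) p, fun j => Z ((j : ℕ) + 1) p)

/-- The derivative of a function along the vector field `total` (the total derivative `D`). -/
def D (f : EqMan k l → ℝ) : EqMan k l → ℝ := fun p => fderiv ℝ f p (total p)

/-- The partial derivative `∂/∂x` of a function on the equation manifold. -/
def partialX (f : EqMan k l → ℝ) : EqMan k l → ℝ := fun p => fderiv ℝ f p dX

/-- The smooth vector fields on the equation manifold, as maps. -/
def smoothMaps (k l : ℕ) : Submodule ℝ (EqMan k l → EqMan k l) where
  carrier := {V | ContDiff ℝ ∞ V}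
  add_mem' hV hW := by
    rw [Set.mem_ofPred_eq] at hV hW ⊢
    exact hV.add hW
  zero_mem' := by
    rw [Set.mem_ofPred_eq]
    exact contDiff_const
  smul_mem' c V hV := by
    rw [Set.mem_ofPred_eq] at hV ⊢
    exact hV.const_smul c

/-- The type of smooth vector fields on the equation manifold. -/
def VField (k l : ℕ) : Type := smoothMaps k l

instance : AddCommGroup (VField k l) := inferInstanceAs (AddCommGroup (smoothMaps k l))

instance : Module ℝ (VField k l) := inferInstanceAs (Module ℝ (smoothMaps k l))

namespace VField

/-- The underlying map of a smooth vector field. -/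
def toFun : VField k l →ₗ[ℝ] (EqMan k l → EqMan k l) := (smoothMaps k l).subtype

theorem smooth (V : VField k l) : ContDiff ℝ ∞ (toFun V) := V.2

theorem toFun_injective : Function.Injective (toFun : VField k l → _) := Subtype.val_injective

theorem differentiableAt (V : VField k l) (p : EqMan k l) : DifferentiableAt ℝ (toFun V) p :=
  (V.smooth.differentiable (by simp)) p

/-- The Lie bracket of vector fields. -/
instance : Bracket (VField k l) (VField k l) where
  bracket V W := ⟨VectorField.lieBracket ℝ (toFun V) (toFun W),
    ContDiff.lieBracket_vectorField (m := ∞) (n := ∞) V.smooth W.smooth (by simp)⟩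

theorem toFun_lie (V W : VField k l) :
    toFun ⁅V, W⁆ = VectorField.lieBracket ℝ (toFun V) (toFun W) := rfl

instance : LieRing (VField k l) where
  add_lie U V W := toFun_injective <| funext fun p => by
    simp only [toFun_lie, map_add, Pi.add_apply]
    exact VectorField.lieBracket_add_left (U.differentiableAt p) (V.differentiableAt p)
  lie_add U V W := toFun_injective <| funext fun p => by
    simp only [toFun_lie, map_add, Pi.add_apply]
    exact VectorField.lieBracket_add_right (V.differentiableAt p) (W.differentiableAt p)
  lie_self V := toFun_injective <| by
    simp only [toFun_lie, map_zero, VectorField.lieBracket_self]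
  leibniz_lie U V W := toFun_injective <| funext fun p => by
    simp only [toFun_lie, map_add, Pi.add_apply]
    exact VectorField.leibniz_identity_lieBracket (n := ∞)
      (by simp only [minSmoothness_of_isRCLikeNormedField]; exact WithTop.coe_le_coe.2 le_top)
      U.smooth.contDiffAt V.smooth.contDiffAt W.smooth.contDiffAt

instance : LieAlgebra ℝ (VField k l) where
  lie_smul c V W := toFun_injective <| funext fun p => by
    simp only [toFun_lie, map_smul, Pi.smul_apply]
    exact VectorField.lieBracket_const_smul_right (W.differentiableAt p)

end VField

/-! ### The exterior differential system of shift `δ` and its symmetries -/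

/-- The line distribution tangent to the lifts of the solutions. -/
def distE (k l : ℕ) (p : EqMan k l) : Submodule ℝ (EqMan k l) := Submodule.span ℝ {total p}

/-- The second distribution of the system of shift `δ`: it is spanned by the `∂/∂y_i`, `i ≥ 1`,
and the `∂/∂z_j`, `j ≥ δ + 1`, if `δ ≥ 0`, and by the `∂/∂y_i`, `i ≥ -δ + 1`, and the `∂/∂z_j`,
`j ≥ 1`, if `δ < 0`. -/
def distF (k l : ℕ) (δ : ℤ) (_ : EqMan k l) : Submodule ℝ (EqMan k l) :=
  Submodule.span ℝ
    ({v | ∃ i : Fin k, max 0 (-δ) < (i : ℤ) ∧ v = dY i} ∪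
      {v | ∃ j : Fin l, max 0 δ < (j : ℤ) ∧ v = dZ j})

/-- The smooth vector field `V` is a section of the distribution `Δ`. -/
def IsSection (Δ : EqMan k l → Submodule ℝ (EqMan k l)) (V : VField k l) : Prop :=
  ∀ p, VField.toFun V p ∈ Δ p

/-- `[S, Δ] ⊆ Δ`. -/
def Preserves (S : VField k l) (Δ : EqMan k l → Submodule ℝ (EqMan k l)) : Prop :=
  ∀ V : VField k l, IsSection Δ V → IsSection Δ ⁅S, V⁆

/-- The Lie algebra of all smooth vector fields that preserve the distribution `Δ`. -/
def stab (Δ : EqMan k l → Submodule ℝ (EqMan k l)) : LieSubalgebra ℝ (VField k l) where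
  carrier := {S | Preserves S Δ}
  add_mem' {S T} hS hT V hV p := by
    rw [add_lie, map_add]
    exact (Δ p).add_mem (hS V hV p) (hT V hV p)
  zero_mem' V _ p := by
    rw [zero_lie, map_zero]
    exact (Δ p).zero_mem
  smul_mem' c S hS V hV p := by
    rw [smul_lie, map_smul]
    exact (Δ p).smul_mem c (hS V hV p)
  lie_mem' {S T} hS hT V hV p := by
    rw [lie_lie, map_sub]
    exact (Δ p).sub_mem (hS _ (hT V hV) p) (hT _ (hS V hV) p)

/-- The symmetry algebra of the exterior differential system of shift `δ` associated with
`y^{(k)} = z^{(l)} = 0`. -/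
def symmetryAlgebra (k l : ℕ) (δ : ℤ) : LieSubalgebra ℝ (VField k l) :=
  stab (distE k l) ⊓ stab (distF k l δ)

/-- The space of the (underlying maps of the) vector fields in the symmetry algebra. -/
def symmetrySpace (k l : ℕ) (δ : ℤ) : Submodule ℝ (EqMan k l → EqMan k l) :=
  (symmetryAlgebra k l δ).toSubmodule.map VField.toFun

/-! ### Prolongation -/

/-- The coefficients of a prolonged field at `∂/∂u_0, ∂/∂u_1, …`, where `a` is the coefficient at
`∂/∂x`, `b` the coefficient at `∂/∂u_0`, and `u` is the sequence `Y` or `Z`: the standard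
prolongation formula `b_{i+1} = D b_i - u_{i+1} D a`, restricted to the equation manifold. -/
def prolongCoeff (u : ℕ → EqMan k l → ℝ) (a b : EqMan k l → ℝ) : ℕ → EqMan k l → ℝ
  | 0 => b
  | i + 1 => D (prolongCoeff u a b i) - u (i + 1) * D a

/-- A symbol `a ∂/∂x + b ∂/∂y_0 + c ∂/∂z_0`. The coefficients are functions of the jet variables,
so that it stands for a vector field on some `J^{r,s}(ℝ, ℝ²)` that is compatible with the contact
forms: its components at the derivatives `y_i`, `z_j` are determined by `a`, `b`, `c` through the
prolongation formula. -/
@[ext] structure Symb (k l : ℕ) where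
  /-- The coefficient at `∂/∂x`. -/
  a : EqMan k l → ℝ
  /-- The coefficient at `∂/∂y_0`. -/
  b : EqMan k l → ℝ
  /-- The coefficient at `∂/∂z_0`. -/
  c : EqMan k l → ℝ

/-- The prolongation to the equation manifold. -/
def Symb.prolong (v : Symb k l) : EqMan k l → EqMan k l := fun p =>
  (v.a p, fun i => prolongCoeff Y v.a v.b i p, fun j => prolongCoeff Z v.a v.c j p)

/-- The real span of the prolongations of the elements of `S`. -/
def prolongSpan (S : Set (Symb k l)) : Submodule ℝ (EqMan k l → EqMan k l) :=
  Submodule.span ℝ (Symb.prolong '' S)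

/-! ### The functions `g_{i,j}^{(s)}` -/

/-- The polynomial `g_{i,j} = x^{i+j} / (i+j)! * D^i (u_0 / x^j)`, where `u` is `Y` or `Z`, written
out by the Leibniz rule; see `gBase_Y` and `gBase_Z` below. -/
def gBase (u : ℕ → EqMan k l → ℝ) (i j : ℕ) : EqMan k l → ℝ := fun p =>
  (∑ m ∈ Finset.range (i + 1),
    (-1) ^ m * (i.choose m : ℝ) * (j.ascFactorial m : ℝ) * X p ^ (i - m) * u (i - m) p) /
    ((i + j).factorial : ℝ)

/-- `g_{i,j}^{(s)}`, the `s`-th partial derivative of `g_{i,j}` with respect to `x`. -/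
def g (u : ℕ → EqMan k l → ℝ) (i j s : ℕ) : EqMan k l → ℝ := partialX^[s] (gBase u i j)

theorem D_Y (m : ℕ) : D (Y m : EqMan k l → ℝ) = Y (m + 1) := by
  funext p
  by_cases h : m < k
  · have : (Y m : EqMan k l → ℝ) =
        ((ContinuousLinearMap.proj (R := ℝ) (φ := fun _ : Fin k => ℝ) ⟨m, h⟩).comp
          ((ContinuousLinearMap.fst ℝ (Fin k → ℝ) (Fin l → ℝ)).comp
            (ContinuousLinearMap.snd ℝ ℝ ((Fin k → ℝ) × (Fin l → ℝ))))) := by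
      funext q; simp [Y, h]
    simp only [D, this, ContinuousLinearMap.fderiv]
    simp [total]
  · have : (Y m : EqMan k l → ℝ) = fun _ => 0 := by funext q; simp [Y, h]
    have h' : ¬ m + 1 < k := by omega
    simp [D, this, Y, h']

theorem D_Z (m : ℕ) : D (Z m : EqMan k l → ℝ) = Z (m + 1) := by
  funext p
  by_cases h : m < l
  · have : (Z m : EqMan k l → ℝ) =
        ((ContinuousLinearMap.proj (R := ℝ) (φ := fun _ : Fin l => ℝ) ⟨m, h⟩).comp
          ((ContinuousLinearMap.snd ℝ (Fin k → ℝ) (Fin l → ℝ)).comp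
            (ContinuousLinearMap.snd ℝ ℝ ((Fin k → ℝ) × (Fin l → ℝ))))) := by
      funext q; simp [Z, h]
    simp only [D, this, ContinuousLinearMap.fderiv]
    simp [total]
  · have : (Z m : EqMan k l → ℝ) = fun _ => 0 := by funext q; simp [Z, h]
    have h' : ¬ m + 1 < l := by omega
    simp [D, this, Z, h']

theorem differentiable_Y (m : ℕ) : Differentiable ℝ (Y m : EqMan k l → ℝ) := by
  by_cases h : m < k
  · unfold Y; simp only [h, dite_true]; fun_prop
  · have : (Y m : EqMan k l → ℝ) = fun _ => 0 := by funext q; simp [Y, h]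
    rw [this]; fun_prop

theorem differentiable_Z (m : ℕ) : Differentiable ℝ (Z m : EqMan k l → ℝ) := by
  by_cases h : m < l
  · unfold Z; simp only [h, dite_true]; fun_prop
  · have : (Z m : EqMan k l → ℝ) = fun _ => 0 := by funext q; simp [Z, h]
    rw [this]; fun_prop

theorem D_iterate_div (u : ℕ → EqMan k l → ℝ) (hu : ∀ m, Differentiable ℝ (u m))
    (hD : ∀ m, D (u m) = u (m + 1)) (j i : ℕ) (p : EqMan k l) (hp : X p ≠ 0) :
    (D^[i] (fun q => u 0 q / X q ^ j)) p =
      ∑ m ∈ Finset.range (i + 1),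
        ((-1) ^ m * (i.choose m : ℝ) * (j.ascFactorial m : ℝ)) *
          ((X p ^ (j + m))⁻¹ * u (i - m) p) := by
  induction i generalizing p with
  | zero => simp [div_eq_mul_inv, mul_comm]
  | succ i ih =>
    have hX : HasFDerivAt (X : EqMan k l → ℝ) (ContinuousLinearMap.fst ℝ ℝ _) p :=
      (ContinuousLinearMap.fst ℝ ℝ ((Fin k → ℝ) × (Fin l → ℝ))).hasFDerivAt
    have hne : ∀ᶠ q in nhds p, X q ≠ 0 := hX.continuousAt.eventually_ne hp
    have hterm : ∀ n r : ℕ, ∃ L : EqMan k l →L[ℝ] ℝ,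
        HasFDerivAt (fun q => (X q ^ n)⁻¹ * u r q) L p ∧
          L (total p) = -(n : ℝ) * (X p ^ (n + 1))⁻¹ * u r p + (X p ^ n)⁻¹ * u (r + 1) p := by
      intro n r
      have h1 : HasFDerivAt (u r) (fderiv ℝ (u r) p) p := (hu r p).hasFDerivAt
      have h2 : HasDerivAt (fun t : ℝ => (t ^ n)⁻¹) (-(n : ℝ) * (X p ^ (n + 1))⁻¹) (X p) := by
        have h := (hasDerivAt_pow n (X p)).fun_inv (pow_ne_zero n hp)
        refine h.congr_deriv ?_
        rcases n with _ | n
        · simp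
        · simp only [Nat.add_sub_cancel]
          field_simp
          ring
      refine ⟨_, (h2.comp_hasFDerivAt p hX).mul h1, ?_⟩
      have h3 : fderiv ℝ (u r) p (total p) = u (r + 1) p := congrFun (hD r) p
      have h4 : (total p).1 = 1 := rfl
      simp only [add_apply, smul_apply, smul_eq_mul, Function.comp_apply,
        ContinuousLinearMap.coe_fst', h3, h4]
      ring
    choose L hL hL' using hterm
    rw [Function.iterate_succ_apply']
    have hev : (D^[i] (fun q => u 0 q / X q ^ j)) =ᶠ[nhds p] fun q =>
        ∑ m ∈ Finset.range (i + 1), ((-1) ^ m * (i.choose m : ℝ) * (j.ascFactorial m : ℝ)) *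
          ((X q ^ (j + m))⁻¹ * u (i - m) q) := by
      filter_upwards [hne] with q hq using ih q hq
    have hsum := HasFDerivAt.fun_sum (u := Finset.range (i + 1)) fun m _ =>
      (hL (j + m) (i - m)).const_mul ((-1) ^ m * (i.choose m : ℝ) * (j.ascFactorial m : ℝ))
    have hval : D (D^[i] (fun q => u 0 q / X q ^ j)) p =
        (∑ m ∈ Finset.range (i + 1), ((-1) ^ m * (i.choose m : ℝ) * (j.ascFactorial m : ℝ)) •
          L (j + m) (i - m)) (total p) := by
      rw [D, hev.fderiv_eq, hsum.fderiv]
    rw [hval]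
    simp only [sum_apply, smul_apply, hL', smul_eq_mul]
    rw [Finset.sum_range_succ' _ (i + 1)]
    have hlast : ∑ m ∈ Finset.range (i + 1),
          ((-1) ^ m * (i.choose m : ℝ) * (j.ascFactorial m : ℝ)) *
            ((X p ^ (j + m))⁻¹ * u (i - m + 1) p) =
        ∑ m ∈ Finset.range (i + 1),
          ((-1) ^ (m + 1) * (i.choose (m + 1) : ℝ) * (j.ascFactorial (m + 1) : ℝ)) *
            ((X p ^ (j + (m + 1)))⁻¹ * u (i - m) p) + (X p ^ j)⁻¹ * u (i + 1) p := by
      have h := Finset.sum_range_succ' (fun m => ((-1) ^ m * (i.choose m : ℝ) *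
        (j.ascFactorial m : ℝ)) * ((X p ^ (j + m))⁻¹ * u (i + 1 - m) p)) (i + 1)
      rw [Finset.sum_range_succ] at h
      simp only [Nat.choose_succ_self, Nat.add_sub_add_right] at h
      simp only [Nat.cast_zero, mul_zero, zero_mul, add_zero, pow_zero, Nat.choose_zero_right,
        Nat.cast_one, Nat.ascFactorial_zero, mul_one, one_mul, Nat.sub_zero] at h
      rw [← h]
      refine Finset.sum_congr rfl fun m hm => ?_
      have : i + 1 - m = i - m + 1 := by
        have := Finset.mem_range.1 hm
        omega
      rw [this]
    simp only [mul_add, Finset.sum_add_distrib]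
    rw [hlast, ← add_assoc, ← Finset.sum_add_distrib]
    congr 1
    · refine Finset.sum_congr rfl fun m _ => ?_
      rw [Nat.choose_succ_succ, Nat.ascFactorial_succ, Nat.add_sub_add_right]
      push_cast
      ring
    · simp

theorem gBase_eq (u : ℕ → EqMan k l → ℝ) (hu : ∀ m, Differentiable ℝ (u m))
    (hD : ∀ m, D (u m) = u (m + 1)) (i j : ℕ) (p : EqMan k l) (hp : X p ≠ 0) :
    gBase u i j p =
      X p ^ (i + j) / ((i + j).factorial : ℝ) * (D^[i] (fun q => u 0 q / X q ^ j)) p := by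
  rw [D_iterate_div u hu hD j i p hp, gBase, div_mul_eq_mul_div, Finset.mul_sum]
  congr 1
  refine Finset.sum_congr rfl fun m hm => ?_
  have hm' : i + j = (i - m) + (j + m) := by
    have := Finset.mem_range.1 hm
    omega
  have h0 : X p ^ (j + m) ≠ 0 := pow_ne_zero _ hp
  rw [hm', pow_add]
  field_simp

theorem gBase_Y (i j : ℕ) (p : EqMan k l) (hp : X p ≠ 0) :
    gBase Y i j p =
      X p ^ (i + j) / ((i + j).factorial : ℝ) * (D^[i] (fun q => Y 0 q / X q ^ j)) p :=
  gBase_eq Y differentiable_Y D_Y i j p hp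

theorem gBase_Z (i j : ℕ) (p : EqMan k l) (hp : X p ≠ 0) :
    gBase Z i j p =
      X p ^ (i + j) / ((i + j).factorial : ℝ) * (D^[i] (fun q => Z 0 q / X q ^ j)) p :=
  gBase_eq Z differentiable_Z D_Z i j p hp

/-! ### The generators of the symmetry algebras -/

/-- `∂/∂x`, `x ∂/∂x`, `x² ∂/∂x + (k-1) x y_0 ∂/∂y_0 + (l-1) x z_0 ∂/∂z_0`, `y_0 ∂/∂y_0`,
`z_0 ∂/∂z_0`. -/
def commonGens (k l : ℕ) : Set (Symb k l) :=
  {⟨1, 0, 0⟩, ⟨X, 0, 0⟩, ⟨X ^ 2, ((k : ℝ) - 1) • (X * Y 0), ((l : ℝ) - 1) • (X * Z 0)⟩,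
    ⟨0, Y 0, 0⟩, ⟨0, 0, Z 0⟩}

/-- `x^i ∂/∂y_0`, `0 ≤ i ≤ k - 1`. -/
def powYGens (k l : ℕ) : Set (Symb k l) := {v | ∃ i : ℕ, i < k ∧ v = ⟨0, X ^ i, 0⟩}

/-- `x^j ∂/∂z_0`, `0 ≤ j ≤ l - 1`. -/
def powZGens (k l : ℕ) : Set (Symb k l) := {v | ∃ j : ℕ, j < l ∧ v = ⟨0, 0, X ^ j⟩}

/-- Generators for `δ = 0`, `2 = k < l`. -/
def firstKindTwoGens (l : ℕ) : Set (Symb 2 l) :=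
  {⟨1, 0, 0⟩, ⟨0, 1, 0⟩, ⟨X, 0, 0⟩, ⟨0, X, 0⟩, ⟨Y 0, 0, 0⟩, ⟨0, Y 0, 0⟩, ⟨0, 0, Z 0⟩,
    ⟨X ^ 2, X * Y 0, ((l : ℝ) - 1) • (X * Z 0)⟩,
    ⟨X * Y 0, Y 0 ^ 2, ((l : ℝ) - 1) • (Y 0 * Z 0)⟩} ∪
  {v | ∃ i j : ℕ, i + j ≤ l - 1 ∧ v = ⟨0, 0, X ^ i * Y 0 ^ j⟩}

/-- Generators for `δ = 0`, `2 < k < l`. -/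
def firstKindGens (k l : ℕ) : Set (Symb k l) :=
  commonGens k l ∪ powYGens k l ∪
    {v | ∃ i j : ℕ, i + (k - 1) * j ≤ l - 1 ∧ v = ⟨0, 0, X ^ i * Y 0 ^ j⟩}

/-- Generators for `δ = l - k`, `2 ≤ k < l`, `(k, l) ≠ (2, 3)`. -/
def secondKindGens (k l : ℕ) : Set (Symb k l) :=
  commonGens k l ∪ powZGens k l ∪ powYGens k l ∪
    {v | ∃ s : ℕ, s ≤ l - k ∧ v = ⟨0, g Z (l - k) k s, 0⟩}

/-- Generators for `0 < δ < l - k`. -/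
def innerGens (k l : ℕ) : Set (Symb k l) := commonGens k l ∪ powYGens k l ∪ powZGens k l

/-- Generators for `δ = -1`, `k = 3`. -/
def contactYGens (l : ℕ) : Set (Symb 3 l) :=
  {⟨X * (2 * Y 0 - X * Y 1), 2 * Y 0 ^ 2 - (1 / 2 : ℝ) • (X ^ 2 * Y 1 ^ 2),
      ((l : ℝ) - 1) • (Z 0 * (2 * Y 0 - X * Y 1))⟩,
    ⟨2 * (Y 0 - X * Y 1), -(X * Y 1 ^ 2), -(((l : ℝ) - 1) • (Z 0 * Y 1))⟩,
    ⟨X ^ 2, 2 * X * Y 0, ((l : ℝ) - 1) • (X * Z 0)⟩,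
    ⟨X, 0, 0⟩, ⟨0, Y 0, 0⟩, ⟨0, 0, Z 0⟩,
    ⟨Y 1, (1 / 2 : ℝ) • Y 1 ^ 2, 0⟩, ⟨1, 0, 0⟩, ⟨0, 1, 0⟩, ⟨0, X, 0⟩, ⟨0, X ^ 2, 0⟩} ∪
  {v | ∃ i j₀ j₁ : ℕ, i + j₀ + j₁ ≤ l - 1 ∧
    v = ⟨0, 0, X ^ i * (X * Y 1 - 2 * Y 0) ^ j₀ * Y 1 ^ j₁⟩}

/-- Generators for `δ = 1`, `l = 3`, `k ≤ 3`: those of `contactYGens` with `y` and `z`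
exchanged. -/
def contactZGens (k : ℕ) : Set (Symb k 3) :=
  {⟨X * (2 * Z 0 - X * Z 1), ((k : ℝ) - 1) • (Y 0 * (2 * Z 0 - X * Z 1)),
      2 * Z 0 ^ 2 - (1 / 2 : ℝ) • (X ^ 2 * Z 1 ^ 2)⟩,
    ⟨2 * (Z 0 - X * Z 1), -(((k : ℝ) - 1) • (Y 0 * Z 1)), -(X * Z 1 ^ 2)⟩,
    ⟨X ^ 2, ((k : ℝ) - 1) • (X * Y 0), 2 * X * Z 0⟩,
    ⟨X, 0, 0⟩, ⟨0, 0, Z 0⟩, ⟨0, Y 0, 0⟩,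
    ⟨Z 1, 0, (1 / 2 : ℝ) • Z 1 ^ 2⟩, ⟨1, 0, 0⟩, ⟨0, 0, 1⟩, ⟨0, 0, X⟩, ⟨0, 0, X ^ 2⟩} ∪
  {v | ∃ i j₀ j₁ : ℕ, i + j₀ + j₁ ≤ k - 1 ∧
    v = ⟨0, X ^ i * (X * Z 1 - 2 * Z 0) ^ j₀ * Z 1 ^ j₁, 0⟩}

/-- Generators for `δ = d > l - k`. -/
def outerZGens (k l d : ℕ) : Set (Symb k l) :=
  commonGens k l ∪ powZGens k l ∪
    {v | ∃ (i j : ℕ) (s : Fin j → ℕ), (∀ t, s t ≤ d) ∧ i + (l - d - 1) * j ≤ k - 1 ∧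
      v = ⟨0, X ^ i * ∏ t, g Z d (l - d) (s t), 0⟩}

/-- Generators for `δ = -d < 0`, `k ≥ 4`: those of `outerZGens` with `y` and `z`, and `k` and `l`,
exchanged. -/
def outerYGens (k l d : ℕ) : Set (Symb k l) :=
  commonGens k l ∪ powYGens k l ∪
    {v | ∃ (i j : ℕ) (s : Fin j → ℕ), (∀ t, s t ≤ d) ∧ i + (k - d - 1) * j ≤ l - 1 ∧
      v = ⟨0, 0, X ^ i * ∏ t, g Y d (k - d) (s t)⟩}

end EqMan

/-! ### The Lie algebra `csp(4, ℝ) ⋉ S^n(ℝ^4)` -/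

attribute [local instance 100] LieRing.ofAssociativeRing

/-- The conformal symplectic Lie algebra `csp(4, ℝ)`: the matrices `A` with `Aᵀ J + J A = c J` for
some real `c`, where `J` is the matrix of the standard symplectic form on `ℝ^4`. -/
def csp4 : LieSubalgebra ℝ (Matrix (Fin 2 ⊕ Fin 2) (Fin 2 ⊕ Fin 2) ℝ) where
  carrier := {A | ∃ c : ℝ, A.transpose * Matrix.J (Fin 2) ℝ + Matrix.J (Fin 2) ℝ * A =
    c • Matrix.J (Fin 2) ℝ}
  add_mem' := by
    rintro A B ⟨c, hc⟩ ⟨d, hd⟩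
    refine ⟨c + d, ?_⟩
    rw [add_smul, ← hc, ← hd, Matrix.transpose_add]
    noncomm_ring
  zero_mem' := ⟨0, by simp⟩
  smul_mem' := by
    rintro t A ⟨c, hc⟩
    refine ⟨t * c, ?_⟩
    rw [mul_smul, ← hc, Matrix.transpose_smul]
    simp
  lie_mem' := by
    rintro A B ⟨c, hc⟩ ⟨d, hd⟩
    refine ⟨0, ?_⟩
    have hA := eq_sub_of_add_eq hc
    have hB := eq_sub_of_add_eq hd
    rw [Ring.lie_def, Matrix.transpose_sub, Matrix.transpose_mul, Matrix.transpose_mul,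
      Matrix.sub_mul, Matrix.mul_assoc, Matrix.mul_assoc, hA, hB, Matrix.mul_sub, Matrix.mul_sub,
      ← Matrix.mul_assoc, ← Matrix.mul_assoc, Matrix.mul_smul, Matrix.mul_smul, hA, hB]
    simp only [Matrix.sub_mul, Matrix.mul_sub, smul_sub, Matrix.smul_mul, zero_smul,
      Matrix.mul_assoc, smul_comm c d]
    abel

/-- The symmetric power `S^n(ℝ^4)`, realized as the space of homogeneous polynomials of degree `n`
in the four vectors of the standard basis, and regarded as an abelian Lie algebra. -/
def SymPow (n : ℕ) : Type := MvPolynomial.homogeneousSubmodule (Fin 2 ⊕ Fin 2) ℝ n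

namespace SymPow

variable {n : ℕ}

instance : AddCommGroup (SymPow n) :=
  inferInstanceAs (AddCommGroup (MvPolynomial.homogeneousSubmodule (Fin 2 ⊕ Fin 2) ℝ n))

instance : Module ℝ (SymPow n) :=
  inferInstanceAs (Module ℝ (MvPolynomial.homogeneousSubmodule (Fin 2 ⊕ Fin 2) ℝ n))

instance : LieRing (SymPow n) where
  bracket _ _ := 0
  add_lie _ _ _ := (add_zero 0).symm
  lie_add _ _ _ := (add_zero 0).symm
  lie_self _ := rfl
  leibniz_lie _ _ _ := (add_zero 0).symm

instance : LieAlgebra ℝ (SymPow n) where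
  lie_smul t _ _ := (smul_zero t).symm

theorem lie_eq_zero (u v : SymPow n) : ⁅u, v⁆ = 0 := rfl

/-- The underlying polynomial. -/
def toPoly : SymPow n →ₗ[ℝ] MvPolynomial (Fin 2 ⊕ Fin 2) ℝ :=
  (MvPolynomial.homogeneousSubmodule (Fin 2 ⊕ Fin 2) ℝ n).subtype

theorem toPoly_injective : Function.Injective (toPoly : SymPow n → _) := Subtype.val_injective

/-- The derivation of the symmetric algebra of `ℝ^4` that extends the matrix `A`, that is, with
`e_i ↦ A e_i = ∑ j, A j i • e_j`. -/
def matDer (A : Matrix (Fin 2 ⊕ Fin 2) (Fin 2 ⊕ Fin 2) ℝ) :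
    Derivation ℝ (MvPolynomial (Fin 2 ⊕ Fin 2) ℝ) (MvPolynomial (Fin 2 ⊕ Fin 2) ℝ) :=
  MvPolynomial.mkDerivation ℝ fun i => ∑ j, A j i • MvPolynomial.X j

theorem matDer_eq (A : Matrix (Fin 2 ⊕ Fin 2) (Fin 2 ⊕ Fin 2) ℝ)
    (p : MvPolynomial (Fin 2 ⊕ Fin 2) ℝ) :
    matDer A p = ∑ i, MvPolynomial.pderiv i p * ∑ j, A j i • MvPolynomial.X j := by
  have h : matDer A = ∑ i, (∑ j, A j i • (MvPolynomial.X j : MvPolynomial (Fin 2 ⊕ Fin 2) ℝ)) •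
      MvPolynomial.pderiv i := by
    refine MvPolynomial.derivation_ext fun i => ?_
    rw [matDer, MvPolynomial.mkDerivation_X, ← Derivation.coeFnAddMonoidHom_apply, map_sum,
      Finset.sum_apply]
    symm
    rw [Finset.sum_eq_single i]
    · rw [Derivation.coeFnAddMonoidHom_apply, Derivation.smul_apply, MvPolynomial.pderiv_X_self,
        smul_eq_mul, mul_one]
    · intro b _ hb
      rw [Derivation.coeFnAddMonoidHom_apply, Derivation.smul_apply,
        MvPolynomial.pderiv_X_of_ne hb.symm, smul_zero]
    · exact fun h => absurd (Finset.mem_univ i) h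
  rw [h, ← Derivation.coeFnAddMonoidHom_apply, map_sum, Finset.sum_apply]
  refine Finset.sum_congr rfl fun i _ => ?_
  rw [Derivation.coeFnAddMonoidHom_apply, Derivation.smul_apply, smul_eq_mul, mul_comm]

theorem matDer_mem (A : Matrix (Fin 2 ⊕ Fin 2) (Fin 2 ⊕ Fin 2) ℝ)
    {p : MvPolynomial (Fin 2 ⊕ Fin 2) ℝ} (hp : p.IsHomogeneous n) :
    (matDer A p).IsHomogeneous n := by
  rw [matDer_eq]
  refine MvPolynomial.IsHomogeneous.sum _ _ _ fun i _ => ?_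
  rcases n with _ | n
  · rw [← MvPolynomial.totalDegree_zero_iff_isHomogeneous,
      MvPolynomial.totalDegree_eq_zero_iff_eq_C] at hp
    rw [hp, MvPolynomial.pderiv_C, zero_mul]
    exact MvPolynomial.isHomogeneous_zero _ _ _
  · refine (hp.pderiv (i := i)).mul (MvPolynomial.IsHomogeneous.sum _ _ 1 fun j _ => ?_)
    rw [MvPolynomial.smul_eq_C_mul]
    exact (MvPolynomial.isHomogeneous_X ℝ j).C_mul _

theorem matDer_lie (A B : Matrix (Fin 2 ⊕ Fin 2) (Fin 2 ⊕ Fin 2) ℝ) :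
    matDer ⁅A, B⁆ = ⁅matDer A, matDer B⁆ := by
  refine MvPolynomial.derivation_ext fun i => ?_
  rw [Derivation.commutator_apply]
  simp only [matDer, MvPolynomial.mkDerivation_X, map_sum, Derivation.map_smul, Ring.lie_def,
    Matrix.sub_apply, Matrix.mul_apply, sub_smul, Finset.sum_sub_distrib, Finset.sum_smul,
    Finset.smul_sum, smul_smul]
  congr 1
  · rw [Finset.sum_comm]
    simp only [mul_comm]
  · rw [Finset.sum_comm]
    simp only [mul_comm]

theorem matDer_add (A B : Matrix (Fin 2 ⊕ Fin 2) (Fin 2 ⊕ Fin 2) ℝ) :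
    matDer (A + B) = matDer A + matDer B := by
  refine MvPolynomial.derivation_ext fun i => ?_
  simp only [matDer, MvPolynomial.mkDerivation_X, Derivation.add_apply, Matrix.add_apply, add_smul,
    Finset.sum_add_distrib]

theorem matDer_smul (t : ℝ) (A : Matrix (Fin 2 ⊕ Fin 2) (Fin 2 ⊕ Fin 2) ℝ) :
    matDer (t • A) = t • matDer A := by
  refine MvPolynomial.derivation_ext fun i => ?_
  simp only [matDer, MvPolynomial.mkDerivation_X, Derivation.smul_apply, Matrix.smul_apply,
    smul_assoc, Finset.smul_sum]

/-- The endomorphism of `S^n(ℝ^4)` induced by the matrix `A`. -/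
def matEnd (n : ℕ) (A : Matrix (Fin 2 ⊕ Fin 2) (Fin 2 ⊕ Fin 2) ℝ) : SymPow n →ₗ[ℝ] SymPow n where
  toFun u := ⟨matDer A (toPoly u), matDer_mem A u.2⟩
  map_add' u v := toPoly_injective (map_add (matDer A) (toPoly u) (toPoly v))
  map_smul' t u := toPoly_injective ((matDer A).map_smul t (toPoly u))

theorem toPoly_matEnd (A : Matrix (Fin 2 ⊕ Fin 2) (Fin 2 ⊕ Fin 2) ℝ) (u : SymPow n) :
    toPoly (matEnd n A u) = matDer A (toPoly u) := rfl

/-- The action of `csp(4, ℝ)` on `S^n(ℝ^4)` induced by its standard action on `ℝ^4`. -/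
def action (n : ℕ) : csp4 →ₗ⁅ℝ⁆ LieDerivation ℝ (SymPow n) (SymPow n) where
  toFun A :=
    { matEnd n (A : Matrix (Fin 2 ⊕ Fin 2) (Fin 2 ⊕ Fin 2) ℝ) with
      leibniz' := fun u v => by
        simp only [lie_eq_zero, sub_zero]
        exact map_zero (matEnd n (A : Matrix (Fin 2 ⊕ Fin 2) (Fin 2 ⊕ Fin 2) ℝ)) }
  map_add' A B := LieDerivation.ext fun u => toPoly_injective
    (DFunLike.congr_fun (matDer_add A.1 B.1) (toPoly u))
  map_smul' t A := LieDerivation.ext fun u => toPoly_injective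
    (DFunLike.congr_fun (matDer_smul t A.1) (toPoly u))
  map_lie' {A B} := LieDerivation.ext fun u => toPoly_injective <| by
    rw [LieDerivation.commutator_apply, map_sub]
    exact (DFunLike.congr_fun (matDer_lie A.1 B.1) (toPoly u)).trans
      (Derivation.commutator_apply _)

end SymPow

/-- The semidirect product `csp(4, ℝ) ⋉ S^n(ℝ^4)`. -/
abbrev CspSym (n : ℕ) : Type :=
  LieAlgebra.SemiDirectSum (SymPow n) csp4 (SymPow.action n)

end

open scoped ContDiff

noncomputable section

attribute [local instance 100] LieRing.ofAssociativeRing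

namespace EqMan

variable {k l : ℕ}

/-! ### Smooth functions and derivations -/

/-! A field preserves E exactly when its components obey the prolongation formula. So a symmetry is
determined by its symbol (a, b, c), and at the top orders the formula says that the characteristics
satisfy D^k(b - y_1 a) = 0 and D^l(c - z_1 a) = 0. Preserving F bounds the jet order of a, b and the
first prolonged coefficients of c (`mem_symTrip_iff`). Exchanging y and z turns δ into -δ
(`symmetrySpace_swap`), so δ ≥ 0 suffices, provided either order may be the larger one.

The engine is `mem_span_mon`: for p < k and q < l, the smooth solutions of D^n f = 0 that depend on
x, the y_i with i < p and the z_j with j < q are spanned by monomials of bounded weight in x and the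
functions g^{(s)}. Translation along the solution (x - t)^(N-1) of u_N = 0 commutes with D. On
functions of u_0, ..., u_{q-1} it is divisible by (x - t)^(N-q), and the quotient lowers the degree
along D by N - q (`transl_mem_Pn`). Its coefficients in t are, up to constants, the partial
derivatives dual to the g^{(s)} (`dual_gs`). Hence the Euler field applied to f is a sum of terms
g^{(s)} ∂f/∂g^{(s)} whose second factors have lower degree, and induction applies. The Euler field
is invertible on monomials containing some g^{(s)}, and what it kills is a function of x, hence a
polynomial.

For δ ≥ 1 the condition on F makes the Hamiltonian c - z_1 a a function of x, z_0, z_1 with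
z_1-derivative -a (`hamil_mem_Fn`, `pZ_hamil`). The linear functions `lu` and z_1 have weight l - 2.
For l ≥ 4 at most one such factor fits, which leaves the projective symmetries of z_l = 0. For l = 3
products of two also fit, which gives the ten-dimensional space of contact Hamiltonians. For δ = 0,
with the equation of smaller order named z, weights exclude y from the Hamiltonian if that order is
at least 3; for order 2 the determining equations of point symmetries are solved directly
(`point_identities`). Once a and c are known, the remaining freedom is (0, b, 0) with D^k b = 0, and
`mem_span_mon` applies again.

In the contact case (1 : x : `lu` : -z_1) are homogeneous coordinates on projective 3-space in which
the contact structure is the standard symplectic one. Symmetries act through matrices in csp(4),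
with y_0 as a fibre coordinate of degree k - 1. Scalar matrices act on y_0 alone, and homogeneous
polynomials of degree k - 1 act by adding to y_0. The relation `Rel` records this and is the graph
of the isomorphism. -/

/-- The algebra of smooth functions on the equation manifold, as a subalgebra. -/
def smoothFns (k l : ℕ) : Subalgebra ℝ (EqMan k l → ℝ) where
  carrier := {f | ContDiff ℝ ∞ f}
  mul_mem' hf hg := by
    rw [Set.mem_ofPred_eq] at hf hg ⊢
    exact hf.mul hg
  add_mem' hf hg := by
    rw [Set.mem_ofPred_eq] at hf hg ⊢
    exact hf.add hg
  algebraMap_mem' r := by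
    rw [Set.mem_ofPred_eq]
    exact contDiff_const

/-- The algebra of smooth functions on the equation manifold. -/
def Sm (k l : ℕ) : Type := smoothFns k l

instance : CommRing (Sm k l) := inferInstanceAs (CommRing (smoothFns k l))

instance : Algebra ℝ (Sm k l) := inferInstanceAs (Algebra ℝ (smoothFns k l))

theorem Sm.smooth (f : Sm k l) : ContDiff ℝ ∞ (f.1 : EqMan k l → ℝ) := f.2

theorem Sm.diff (f : Sm k l) : Differentiable ℝ (f.1 : EqMan k l → ℝ) :=
  f.smooth.differentiable (by simp)

theorem Sm.ext {f g : Sm k l} (h : ∀ p, f.1 p = g.1 p) : f = g := Subtype.ext (funext h)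

@[simp] theorem Sm.add_val (f g : Sm k l) (p : EqMan k l) : (f + g).1 p = f.1 p + g.1 p := rfl
@[simp] theorem Sm.sub_val (f g : Sm k l) (p : EqMan k l) : (f - g).1 p = f.1 p - g.1 p := rfl
@[simp] theorem Sm.neg_val (f : Sm k l) (p : EqMan k l) : (-f).1 p = -f.1 p := rfl
@[simp] theorem Sm.mul_val (f g : Sm k l) (p : EqMan k l) : (f * g).1 p = f.1 p * g.1 p := rfl
@[simp] theorem Sm.pow_val (f : Sm k l) (n : ℕ) (p : EqMan k l) : (f ^ n).1 p = f.1 p ^ n := rfl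
@[simp] theorem Sm.smul_val (c : ℝ) (f : Sm k l) (p : EqMan k l) : (c • f).1 p = c * f.1 p := rfl
@[simp] theorem Sm.zero_val (p : EqMan k l) : (0 : Sm k l).1 p = 0 := rfl
@[simp] theorem Sm.one_val (p : EqMan k l) : (1 : Sm k l).1 p = 1 := rfl
@[simp] theorem Sm.sum_val {ι : Type*} (s : Finset ι) (f : ι → Sm k l) (p : EqMan k l) :
    (∑ i ∈ s, f i).1 p = ∑ i ∈ s, (f i).1 p :=
  map_sum ((Pi.evalAddMonoidHom (fun _ : EqMan k l => ℝ) p).comp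
    (smoothFns k l).subtype.toAddMonoidHom) f s

/-- The derivation of the algebra of smooth functions given by a vector field. -/
def der (V : VField k l) : Derivation ℝ (Sm k l) (Sm k l) :=
  Derivation.mk'
    { toFun := fun f => ⟨fun p => fderiv ℝ f.1 p (VField.toFun V p), by
        change ContDiff ℝ ∞ _
        exact (f.smooth.fderiv_right (m := ∞) (by simp)).clm_apply V.smooth⟩
      map_add' := fun f g => Sm.ext fun p => by
        change fderiv ℝ (f.1 + g.1) p _ = fderiv ℝ f.1 p _ + fderiv ℝ g.1 p _
        rw [fderiv_add (f.diff p) (g.diff p)]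
        rfl
      map_smul' := fun c f => Sm.ext fun p => by
        change fderiv ℝ (c • f.1) p _ = c • fderiv ℝ f.1 p _
        rw [fderiv_const_smul (f.diff p)]
        rfl }
    fun f g => Sm.ext fun p => by
      change fderiv ℝ (f.1 * g.1) p _ = f.1 p * fderiv ℝ g.1 p _ + g.1 p * fderiv ℝ f.1 p _
      rw [fderiv_mul (f.diff p) (g.diff p)]
      rfl

theorem der_val (V : VField k l) (f : Sm k l) (p : EqMan k l) :
    (der V f).1 p = fderiv ℝ f.1 p (VField.toFun V p) := rfl

theorem der_add (V W : VField k l) (f : Sm k l) : der (V + W) f = der V f + der W f :=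
  Sm.ext fun p => by rw [Sm.add_val, der_val, der_val, der_val, map_add, Pi.add_apply, map_add]

theorem der_smul (c : ℝ) (V : VField k l) (f : Sm k l) : der (c • V) f = c • der V f :=
  Sm.ext fun p => by
    rw [Sm.smul_val, der_val, der_val, map_smul, Pi.smul_apply, map_smul, smul_eq_mul]

theorem der_zero (f : Sm k l) : der (0 : VField k l) f = 0 :=
  Sm.ext fun p => by rw [Sm.zero_val, der_val, map_zero, Pi.zero_apply, map_zero]

theorem der_lie (V W : VField k l) (f : Sm k l) :
    der ⁅V, W⁆ f = der V (der W f) - der W (der V f) :=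
  Sm.ext fun p => by
    rw [Sm.sub_val, der_val, VField.toFun_lie]
    rw [VectorField.fderiv_apply_lieBracket (n := ∞) f.smooth.contDiffAt _
      (W.differentiableAt p) (V.differentiableAt p)]
    · rfl
    · simp only [minSmoothness_of_isRCLikeNormedField]
      exact WithTop.coe_le_coe.2 le_top

/-! ### Coordinate functions, coordinate derivations and their commutators with D. -/

/-- The coordinate `x` as a smooth function. -/
def cx : Sm k l := ⟨X, by
  change ContDiff ℝ ∞ _
  exact contDiff_fst⟩

/-- The coordinate `y_i` as a smooth function. -/
def cy (i : ℕ) : Sm k l := ⟨Y i, by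
  change ContDiff ℝ ∞ _
  unfold Y
  split_ifs <;> fun_prop⟩

/-- The coordinate `z_j` as a smooth function. -/
def cz (j : ℕ) : Sm k l := ⟨Z j, by
  change ContDiff ℝ ∞ _
  unfold Z
  split_ifs <;> fun_prop⟩

@[simp] theorem cx_val (p : EqMan k l) : (cx : Sm k l).1 p = p.1 := rfl

theorem cy_val (i : ℕ) (p : EqMan k l) : (cy i : Sm k l).1 p = Y i p := rfl

theorem cz_val (i : ℕ) (p : EqMan k l) : (cz i : Sm k l).1 p = Z i p := rfl

theorem cy_of_le {i : ℕ} (h : k ≤ i) : (cy i : Sm k l) = 0 :=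
  Sm.ext fun p => by simp [cy_val, Y, Nat.not_lt.2 h]

theorem cz_of_le {i : ℕ} (h : l ≤ i) : (cz i : Sm k l) = 0 :=
  Sm.ext fun p => by simp [cz_val, Z, Nat.not_lt.2 h]

theorem fderiv_X (p v : EqMan k l) : fderiv ℝ (X : EqMan k l → ℝ) p v = v.1 := by
  have : (X : EqMan k l → ℝ) = ContinuousLinearMap.fst ℝ ℝ _ := rfl
  rw [this, ContinuousLinearMap.fderiv]
  rfl

theorem fderiv_Y (i : ℕ) (p v : EqMan k l) : fderiv ℝ (Y i : EqMan k l → ℝ) p v = Y i v := by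
  by_cases h : i < k
  · have : (Y i : EqMan k l → ℝ) =
        ((ContinuousLinearMap.proj (R := ℝ) (φ := fun _ : Fin k => ℝ) ⟨i, h⟩).comp
          ((ContinuousLinearMap.fst ℝ (Fin k → ℝ) (Fin l → ℝ)).comp
            (ContinuousLinearMap.snd ℝ ℝ ((Fin k → ℝ) × (Fin l → ℝ))))) := by
      funext q; simp [Y, h]
    rw [this, ContinuousLinearMap.fderiv]
  · have : (Y i : EqMan k l → ℝ) = fun _ => 0 := by funext q; simp [Y, h]
    simp [this]

theorem fderiv_Z (i : ℕ) (p v : EqMan k l) : fderiv ℝ (Z i : EqMan k l → ℝ) p v = Z i v := by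
  by_cases h : i < l
  · have : (Z i : EqMan k l → ℝ) =
        ((ContinuousLinearMap.proj (R := ℝ) (φ := fun _ : Fin l => ℝ) ⟨i, h⟩).comp
          ((ContinuousLinearMap.snd ℝ (Fin k → ℝ) (Fin l → ℝ)).comp
            (ContinuousLinearMap.snd ℝ ℝ ((Fin k → ℝ) × (Fin l → ℝ))))) := by
      funext q; simp [Z, h]
    rw [this, ContinuousLinearMap.fderiv]
  · have : (Z i : EqMan k l → ℝ) = fun _ => 0 := by funext q; simp [Z, h]
    simp [this]

theorem der_cx_val (V : VField k l) (p : EqMan k l) :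
    (der V cx).1 p = (VField.toFun V p).1 := fderiv_X _ _

theorem der_cy_val (V : VField k l) (i : ℕ) (p : EqMan k l) :
    (der V (cy i)).1 p = Y i (VField.toFun V p) := fderiv_Y _ _ _

theorem der_cz_val (V : VField k l) (i : ℕ) (p : EqMan k l) :
    (der V (cz i)).1 p = Z i (VField.toFun V p) := fderiv_Z _ _ _

theorem ext_of_coords {v w : EqMan k l} (hx : v.1 = w.1) (hy : ∀ i, Y i v = Y i w)
    (hz : ∀ i, Z i v = Z i w) : v = w := by
  refine Prod.ext hx (Prod.ext (funext fun i => ?_) (funext fun i => ?_))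
  · simpa [Y] using hy i
  · simpa [Z] using hz i

theorem vField_ext {V W : VField k l} (hx : der V cx = der W cx)
    (hy : ∀ i, der V (cy i) = der W (cy i)) (hz : ∀ i, der V (cz i) = der W (cz i)) : V = W := by
  refine VField.toFun_injective (funext fun p => ext_of_coords ?_ (fun i => ?_) fun i => ?_)
  · rw [← der_cx_val, hx, der_cx_val]
  · rw [← der_cy_val, hy, der_cy_val]
  · rw [← der_cz_val, hz, der_cz_val]

/-- The constant vector fields. -/
def cst (v : EqMan k l) : VField k l := ⟨fun _ => v, by
  change ContDiff ℝ ∞ _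
  exact contDiff_const⟩

theorem contDiff_total : ContDiff ℝ ∞ (total : EqMan k l → EqMan k l) := by
  refine contDiff_const.prodMk (ContDiff.prodMk ?_ ?_)
  · exact contDiff_pi.2 fun i => (cy (i + 1 : ℕ)).smooth
  · exact contDiff_pi.2 fun i => (cz (i + 1 : ℕ)).smooth

/-- The vector field `D`. -/
def tot : VField k l := ⟨total, by
  change ContDiff ℝ ∞ _
  exact contDiff_total⟩

/-- The total derivative. -/
def dD : Derivation ℝ (Sm k l) (Sm k l) := der tot

/-- The derivative in the direction of a constant vector. -/
def dc (v : EqMan k l) : Derivation ℝ (Sm k l) (Sm k l) := der (cst v)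

@[simp] theorem toFun_cst (v p : EqMan k l) : VField.toFun (cst v) p = v := rfl
@[simp] theorem toFun_tot (p : EqMan k l) : VField.toFun tot p = total p := rfl

@[simp] theorem Y_zero (i : ℕ) : Y i (0 : EqMan k l) = 0 := by simp [Y]
@[simp] theorem Z_zero (i : ℕ) : Z i (0 : EqMan k l) = 0 := by simp [Z]
theorem Y_total (i : ℕ) (p : EqMan k l) : Y i (total p) = Y (i + 1) p := by
  by_cases h : i < k
  · simp [Y, total, h]
  · have : ¬ i + 1 < k := by omega
    simp [Y, h, this]

theorem Z_total (i : ℕ) (p : EqMan k l) : Z i (total p) = Z (i + 1) p := by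
  by_cases h : i < l
  · simp [Z, total, h]
  · have : ¬ i + 1 < l := by omega
    simp [Z, h, this]

@[simp] theorem dD_cx : dD (cx : Sm k l) = 1 := Sm.ext fun _ => der_cx_val _ _
@[simp] theorem dD_cy (i : ℕ) : dD (cy i : Sm k l) = cy (i + 1) :=
  Sm.ext fun p => (der_cy_val _ _ _).trans (Y_total i p)
@[simp] theorem dD_cz (i : ℕ) : dD (cz i : Sm k l) = cz (i + 1) :=
  Sm.ext fun p => (der_cz_val _ _ _).trans (Z_total i p)

/-- The vector `∂/∂y_i`, which is `0` for `i ≥ k`. -/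
def vY (i : ℕ) : EqMan k l := if h : i < k then dY ⟨i, h⟩ else 0

/-- The vector `∂/∂z_i`, which is `0` for `i ≥ l`. -/
def vZ (i : ℕ) : EqMan k l := if h : i < l then dZ ⟨i, h⟩ else 0

/-- The derivation `∂/∂x`. -/
def px : Derivation ℝ (Sm k l) (Sm k l) := dc dX
/-- The derivation `∂/∂y_i`. -/
def pY (i : ℕ) : Derivation ℝ (Sm k l) (Sm k l) := dc (vY i)
/-- The derivation `∂/∂z_i`. -/
def pZ (i : ℕ) : Derivation ℝ (Sm k l) (Sm k l) := dc (vZ i)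

theorem vY_of_lt {i : ℕ} (h : i < k) : (vY i : EqMan k l) = dY ⟨i, h⟩ := dif_pos h

theorem vZ_of_lt {i : ℕ} (h : i < l) : (vZ i : EqMan k l) = dZ ⟨i, h⟩ := dif_pos h

theorem vY_of_le {i : ℕ} (h : k ≤ i) : (vY i : EqMan k l) = 0 := dif_neg (Nat.not_lt.2 h)

theorem vZ_of_le {i : ℕ} (h : l ≤ i) : (vZ i : EqMan k l) = 0 := dif_neg (Nat.not_lt.2 h)

theorem dc_zero (f : Sm k l) : dc (0 : EqMan k l) f = 0 := Sm.ext fun p => by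
  rw [dc, der_val, toFun_cst, map_zero]; rfl

theorem pY_of_le {i : ℕ} (h : k ≤ i) (f : Sm k l) : pY i f = 0 := by
  rw [pY, vY_of_le h, dc_zero]

theorem pZ_of_le {i : ℕ} (h : l ≤ i) (f : Sm k l) : pZ i f = 0 := by
  rw [pZ, vZ_of_le h, dc_zero]

@[simp] theorem vY_fst (i : ℕ) : (vY i : EqMan k l).1 = 0 := by
  unfold vY; split_ifs <;> rfl
@[simp] theorem vZ_fst (i : ℕ) : (vZ i : EqMan k l).1 = 0 := by
  unfold vZ; split_ifs <;> rfl
@[simp] theorem Z_vY (i j : ℕ) : Z j (vY i : EqMan k l) = 0 := by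
  unfold vY Z; split_ifs <;> rfl
@[simp] theorem Y_vZ (i j : ℕ) : Y j (vZ i : EqMan k l) = 0 := by
  unfold vZ Y; split_ifs <;> rfl

theorem Y_vY (i j : ℕ) : Y j (vY i : EqMan k l) = if i = j ∧ i < k then 1 else 0 := by
  unfold vY Y
  split_ifs with h1 h2 h3 h3 <;> simp_all [dY] ; omega

theorem Z_vZ (i j : ℕ) : Z j (vZ i : EqMan k l) = if i = j ∧ i < l then 1 else 0 := by
  unfold vZ Z
  split_ifs with h1 h2 h3 h3 <;> simp_all [dZ] ; omega

theorem dc_cx (v : EqMan k l) : dc v cx = algebraMap ℝ _ v.1 := Sm.ext fun _ => der_cx_val _ _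

theorem dc_cy (v : EqMan k l) (i : ℕ) : dc v (cy i) = algebraMap ℝ _ (Y i v) :=
  Sm.ext fun _ => der_cy_val _ _ _

theorem dc_cz (v : EqMan k l) (i : ℕ) : dc v (cz i) = algebraMap ℝ _ (Z i v) :=
  Sm.ext fun _ => der_cz_val _ _ _

@[simp] theorem px_cx : px (cx : Sm k l) = 1 := by
  rw [px, dc_cx]; exact map_one _
@[simp] theorem px_cy (i : ℕ) : px (cy i : Sm k l) = 0 := by
  rw [px, dc_cy]; simp [Y, dX]
@[simp] theorem px_cz (i : ℕ) : px (cz i : Sm k l) = 0 := by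
  rw [px, dc_cz]; simp [Z, dX]
@[simp] theorem pY_cx (i : ℕ) : pY i (cx : Sm k l) = 0 := by
  rw [pY, dc_cx, vY_fst, map_zero]
@[simp] theorem pZ_cx (i : ℕ) : pZ i (cx : Sm k l) = 0 := by
  rw [pZ, dc_cx, vZ_fst, map_zero]
@[simp] theorem pY_cz (i j : ℕ) : pY i (cz j : Sm k l) = 0 := by
  rw [pY, dc_cz, Z_vY, map_zero]
@[simp] theorem pZ_cy (i j : ℕ) : pZ i (cy j : Sm k l) = 0 := by
  rw [pZ, dc_cy, Y_vZ, map_zero]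

theorem pY_cy (i j : ℕ) : pY i (cy j : Sm k l) = if i = j ∧ i < k then 1 else 0 := by
  rw [pY, dc_cy, Y_vY]; split_ifs <;> simp

theorem pZ_cz (i j : ℕ) : pZ i (cz j : Sm k l) = if i = j ∧ i < l then 1 else 0 := by
  rw [pZ, dc_cz, Z_vZ]; split_ifs <;> simp

/-- D is an affine field, so its bracket with a constant field is constant. The hypotheses say that
w is v shifted down by one jet order, whence [∂_{u_{i+1}}, D] = ∂_{u_i} and [∂_{u_0}, D] = 0. -/
theorem tot_lie_cst_eq (v w : EqMan k l) (hy : ∀ i, Y (i + 1) v = Y i w)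
    (hz : ∀ i, Z (i + 1) v = Z i w) (hw : w.1 = 0) : ⁅(cst v : VField k l), tot⁆ = cst w := by
  refine vField_ext ?_ (fun i => ?_) fun i => ?_
  · rw [der_lie]
    change dc v (dD cx) - dD (dc v cx) = dc w cx
    rw [dD_cx, dc_cx, dc_cx, hw, Derivation.map_algebraMap, Derivation.map_one_eq_zero, map_zero,
      sub_zero]
  · rw [der_lie]
    change dc v (dD (cy i)) - dD (dc v (cy i)) = dc w (cy i)
    rw [dD_cy, dc_cy, dc_cy, dc_cy, Derivation.map_algebraMap, hy, sub_zero]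
  · rw [der_lie]
    change dc v (dD (cz i)) - dD (dc v (cz i)) = dc w (cz i)
    rw [dD_cz, dc_cz, dc_cz, dc_cz, Derivation.map_algebraMap, hz, sub_zero]

theorem dc_dD (v w : EqMan k l) (hy : ∀ i, Y (i + 1) v = Y i w)
    (hz : ∀ i, Z (i + 1) v = Z i w) (hw : w.1 = 0) (f : Sm k l) :
    dc v (dD f) = dD (dc v f) + dc w f := by
  have h : dc w f = dc v (dD f) - dD (dc v f) := by
    rw [dc, ← tot_lie_cst_eq v w hy hz hw, der_lie]
    rfl
  rw [h, add_sub_cancel]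

theorem pY_zero_dD (f : Sm k l) : pY 0 (dD f) = dD (pY 0 f) := by
  rw [pY, dc_dD _ 0 (by simp [Y_vY]) (by simp) rfl, dc_zero, add_zero]

theorem pZ_zero_dD (f : Sm k l) : pZ 0 (dD f) = dD (pZ 0 f) := by
  rw [pZ, dc_dD _ 0 (by simp) (by simp [Z_vZ]) rfl, dc_zero, add_zero]

theorem pY_succ_dD {i : ℕ} (h : i + 1 < k) (f : Sm k l) :
    pY (i + 1) (dD f) = dD (pY (i + 1) f) + pY i f := by
  refine dc_dD _ _ (fun j => ?_) (by simp) (by simp) f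
  have : i < k := by omega
  simp [Y_vY, h, this]

theorem pZ_succ_dD {i : ℕ} (h : i + 1 < l) (f : Sm k l) :
    pZ (i + 1) (dD f) = dD (pZ (i + 1) f) + pZ i f := by
  refine dc_dD _ _ (by simp) (fun j => ?_) (by simp) f
  have : i < l := by omega
  simp [Z_vZ, h, this]

theorem cst_lie_cst (v w : EqMan k l) : ⁅(cst v : VField k l), cst w⁆ = 0 := by
  refine vField_ext ?_ (fun i => ?_) fun i => ?_ <;> rw [der_lie, der_zero]
  · change dc v (dc w cx) - dc w (dc v cx) = 0
    simp [dc_cx]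
  · change dc v (dc w (cy i)) - dc w (dc v (cy i)) = 0
    simp [dc_cy]
  · change dc v (dc w (cz i)) - dc w (dc v (cz i)) = 0
    simp [dc_cz]

theorem dc_comm (v w : EqMan k l) (f : Sm k l) : dc v (dc w f) = dc w (dc v f) := by
  rw [← sub_eq_zero]
  have := der_lie (cst v) (cst w) f
  rw [cst_lie_cst, der_zero] at this
  exact this.symm

theorem pY_pZ (i j : ℕ) (f : Sm k l) : pY i (pZ j f) = pZ j (pY i f) := dc_comm _ _ _

theorem pZ_pZ (i j : ℕ) (f : Sm k l) : pZ i (pZ j f) = pZ j (pZ i f) := dc_comm _ _ _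

/-! ### Functions of the jet variables of bounded order -/

/-- The smooth functions of `x`, the `y_i` with `i < p` and the `z_j` with `j < q`. -/
def Fn (p q : ℕ) : Subalgebra ℝ (Sm k l) where
  carrier := {f | (∀ i, p ≤ i → pY i f = 0) ∧ ∀ j, q ≤ j → pZ j f = 0}
  mul_mem' := by
    rintro f g ⟨hf, hf'⟩ ⟨hg, hg'⟩
    exact ⟨fun i hi => by rw [Derivation.leibniz, hf i hi, hg i hi, smul_zero, smul_zero, add_zero],
      fun i hi => by rw [Derivation.leibniz, hf' i hi, hg' i hi, smul_zero, smul_zero, add_zero]⟩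
  add_mem' := by
    rintro f g ⟨hf, hf'⟩ ⟨hg, hg'⟩
    exact ⟨fun i hi => by rw [map_add, hf i hi, hg i hi, add_zero],
      fun i hi => by rw [map_add, hf' i hi, hg' i hi, add_zero]⟩
  algebraMap_mem' r :=
    ⟨fun i _ => Derivation.map_algebraMap _ _, fun i _ => Derivation.map_algebraMap _ _⟩

theorem Fn_mono {p q p' q' : ℕ} (hp : p ≤ p') (hq : q ≤ q') {f : Sm k l} (hf : f ∈ Fn p q) :
    f ∈ Fn p' q' :=
  ⟨fun i hi => hf.1 i (hp.trans hi), fun i hi => hf.2 i (hq.trans hi)⟩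

theorem cx_mem_Fn (p q : ℕ) : (cx : Sm k l) ∈ Fn p q := ⟨fun i _ => pY_cx i, fun i _ => pZ_cx i⟩

theorem cy_mem_Fn {i p : ℕ} (h : i < p) (q : ℕ) : (cy i : Sm k l) ∈ Fn p q :=
  ⟨fun j hj => by rw [pY_cy, if_neg]; omega, fun j _ => pZ_cy _ _⟩

theorem cz_mem_Fn {i q : ℕ} (p : ℕ) (h : i < q) : (cz i : Sm k l) ∈ Fn p q :=
  ⟨fun j _ => pY_cz _ _, fun j hj => by rw [pZ_cz, if_neg]; omega⟩

/-- D raises the jet order by one, except that a function without any y (or any z) stays so. This is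
the reason for the alternative with 0. -/
theorem dD_mem_Fn {p q p' q' : ℕ} (hp : p = 0 ∨ p + 1 ≤ p') (hq : q = 0 ∨ q + 1 ≤ q')
    {f : Sm k l} (hf : f ∈ Fn p q) : dD f ∈ Fn p' q' := by
  refine ⟨fun i hi => ?_, fun i hi => ?_⟩
  · rcases i with _ | i
    · rw [pY_zero_dD, hf.1 0 (by omega), map_zero]
    · by_cases h : i + 1 < k
      · rw [pY_succ_dD h, hf.1 _ (by omega), hf.1 _ (by omega), map_zero, add_zero]
      · exact pY_of_le (by omega) _
  · rcases i with _ | i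
    · rw [pZ_zero_dD, hf.2 0 (by omega), map_zero]
    · by_cases h : i + 1 < l
      · rw [pZ_succ_dD h, hf.2 _ (by omega), hf.2 _ (by omega), map_zero, add_zero]
      · exact pZ_of_le (by omega) _

theorem dc_mem_Fn {p q : ℕ} (v : EqMan k l) {f : Sm k l} (hf : f ∈ Fn p q) : dc v f ∈ Fn p q :=
  ⟨fun i hi => by rw [pY, dc_comm, ← pY, hf.1 i hi, map_zero],
    fun i hi => by rw [pZ, dc_comm, ← pZ, hf.2 i hi, map_zero]⟩

/-! ### Infinitesimal symmetries in terms of the associated derivations -/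

@[simp] theorem Y_add (v w : EqMan k l) (i : ℕ) : Y i (v + w) = Y i v + Y i w := by
  unfold Y; split_ifs <;> simp

theorem Y_smul (c : ℝ) (v : EqMan k l) (i : ℕ) : Y i (c • v) = c * Y i v := by
  unfold Y; split_ifs <;> simp

theorem Z_add (v w : EqMan k l) (i : ℕ) : Z i (v + w) = Z i v + Z i w := by
  unfold Z; split_ifs <;> simp

theorem Z_smul (c : ℝ) (v : EqMan k l) (i : ℕ) : Z i (c • v) = c * Z i v := by
  unfold Z; split_ifs <;> simp

/-- Preservation of the line field means that [V, D] is a multiple of D. Comparing the components at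
y_i and z_i gives the prolongation formula, including at the top order, where the next coordinate is
0. -/
theorem preserves_distE_iff (V : VField k l) :
    Preserves V (distE k l) ↔
      (∀ i, der V (cy (i + 1)) = dD (der V (cy i)) - cy (i + 1) * dD (der V cx)) ∧
        ∀ i, der V (cz (i + 1)) = dD (der V (cz i)) - cz (i + 1) * dD (der V cx) := by
  constructor
  · intro h
    have h1 := h tot fun p => Submodule.mem_span_singleton_self _
    have key : ∀ p : EqMan k l, ∃ a : ℝ, a • total p = VField.toFun ⁅V, tot⁆ p := fun p =>
      Submodule.mem_span_singleton.1 (h1 p)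
    choose a ha using key
    -- Since D x = 1, the x-component of [V, D] identifies the factor.
    have h0 : ∀ p, a p = -(dD (der V cx)).1 p := fun p => by
      have h2 := der_cx_val ⁅V, tot⁆ p
      rw [← ha p, der_lie] at h2
      change (der V (dD cx) - dD (der V cx)).1 p = a p * 1 at h2
      rw [dD_cx, Derivation.map_one_eq_zero, zero_sub, mul_one] at h2
      exact h2.symm
    constructor
    · intro i
      refine Sm.ext fun p => ?_
      have h2 := der_cy_val ⁅V, tot⁆ i p
      rw [← ha p, der_lie, Y_smul, Y_total, h0] at h2
      change (der V (dD (cy i)) - dD (der V (cy i))).1 p = _ at h2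
      rw [dD_cy, Sm.sub_val] at h2
      rw [Sm.sub_val, Sm.mul_val, cy_val]
      linarith
    · intro i
      refine Sm.ext fun p => ?_
      have h2 := der_cz_val ⁅V, tot⁆ i p
      rw [← ha p, der_lie, Z_smul, Z_total, h0] at h2
      change (der V (dD (cz i)) - dD (der V (cz i))).1 p = _ at h2
      rw [dD_cz, Sm.sub_val] at h2
      rw [Sm.sub_val, Sm.mul_val, cz_val]
      linarith
  · rintro ⟨hy, hz⟩ W hW p
    have hW' : ∀ q, VField.toFun W q = (der W cx).1 q • total q := fun q => by
      obtain ⟨a, ha⟩ := Submodule.mem_span_singleton.1 (hW q)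
      rw [der_cx_val, ← ha]
      simp [total]
    have hder : ∀ f : Sm k l, der W f = der W cx * dD f := fun f => Sm.ext fun q => by
      rw [der_val, hW', map_smul]
      rfl
    set f := der W cx with hf
    refine Submodule.mem_span_singleton.2 ⟨(der V f - f * dD (der V cx)).1 p, ?_⟩
    refine ext_of_coords ?_ (fun i => ?_) fun i => ?_
    · rw [← der_cx_val, der_lie, hder (der V cx), ← hf]
      simp [total]
    · rw [← der_cy_val, der_lie, hder (cy i), hder (der V _), dD_cy, Derivation.leibniz, hy,
        Y_smul, Y_total, ← cy_val, ← Sm.mul_val]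
      refine congrArg (fun g : Sm k l => g.1 p) ?_
      simp only [smul_eq_mul]
      ring
    · rw [← der_cz_val, der_lie, hder (cz i), hder (der V _), dD_cz, Derivation.leibniz, hz,
        Z_smul, Z_total, ← cz_val, ← Sm.mul_val]
      refine congrArg (fun g : Sm k l => g.1 p) ?_
      simp only [smul_eq_mul]
      ring

theorem mem_distF_iff (d : ℕ) (p v : EqMan k l) :
    v ∈ distF k l d p ↔ v.1 = 0 ∧ Y 0 v = 0 ∧ ∀ j ≤ d, Z j v = 0 := by
  have h1 : max 0 (-(d : ℤ)) = 0 := max_eq_left (by omega)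
  have h2 : max 0 (d : ℤ) = d := max_eq_right (by omega)
  unfold distF
  rw [h1, h2]
  constructor
  · intro h
    induction h using Submodule.span_induction with
    | mem v hv =>
      rcases hv with ⟨i, hi, rfl⟩ | ⟨j, hj, rfl⟩
      · rw [show dY i = vY (k := k) (l := l) i from (vY_of_lt i.2).symm]
        refine ⟨vY_fst _, ?_, fun _ _ => Z_vY _ _⟩
        rw [Y_vY, if_neg]
        omega
      · rw [show dZ j = vZ (k := k) (l := l) j from (vZ_of_lt j.2).symm]
        refine ⟨vZ_fst _, Y_vZ _ _, fun m hm => ?_⟩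
        rw [Z_vZ, if_neg]
        omega
    | zero => exact ⟨rfl, Y_zero _, fun _ _ => Z_zero _⟩
    | add v w _ _ hv hw =>
      refine ⟨by simp [hv.1, hw.1], by simp [hv.2.1, hw.2.1], fun j hj => ?_⟩
      rw [Z_add, hv.2.2 j hj, hw.2.2 j hj, add_zero]
    | smul c v _ hv =>
      refine ⟨by simp [hv.1], by rw [Y_smul, hv.2.1, mul_zero], fun j hj => ?_⟩
      rw [Z_smul, hv.2.2 j hj, mul_zero]
  · rintro ⟨hx, hy, hz⟩
    have hv : v = ∑ i : Fin k, v.2.1 i • dY i + ∑ j : Fin l, v.2.2 j • dZ j := by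
      refine Prod.ext ?_ (Prod.ext ?_ ?_)
      · simp [Prod.fst_sum, dY, dZ, hx]
      · funext m
        simp [Prod.fst_sum, Prod.snd_sum, dY, dZ, Finset.sum_apply, Pi.single_apply]
      · funext m
        simp [Prod.snd_sum, dY, dZ, Finset.sum_apply, Pi.single_apply]
    rw [hv]
    refine add_mem (sum_mem fun i _ => ?_) (sum_mem fun j _ => ?_)
    · by_cases h : (i : ℕ) = 0
      · have : v.2.1 i = 0 := by
          have h3 : 0 < k := by omega
          rw [← hy, Y, dif_pos h3]
          exact congrArg v.2.1 (Fin.ext h)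
        rw [this, zero_smul]
        exact zero_mem _
      · exact Submodule.smul_mem _ _ (Submodule.subset_span (Or.inl ⟨i, by omega, rfl⟩))
    · by_cases h : (j : ℕ) ≤ d
      · have : v.2.2 j = 0 := by
          rw [← hz j h, Z, dif_pos j.2]
        rw [this, zero_smul]
        exact zero_mem _
      · exact Submodule.smul_mem _ _ (Submodule.subset_span (Or.inr ⟨j, by omega, rfl⟩))

/-- Pointwise W is a combination of the very coordinate vectors that annihilate such f. -/
theorem der_eq_zero_of_isSection {d : ℕ} {W : VField k l} (hW : IsSection (distF k l d) W)
    {f : Sm k l} (hf : f ∈ Fn 1 (d + 1)) : der W f = 0 := by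
  refine Sm.ext fun p => ?_
  rw [der_val]
  have h1 : max 0 (-(d : ℤ)) = 0 := max_eq_left (by omega)
  have h2 : max 0 (d : ℤ) = d := max_eq_right (by omega)
  have h := hW p
  generalize VField.toFun W p = w at h
  unfold distF at h
  rw [h1, h2] at h
  induction h using Submodule.span_induction with
  | mem v hv =>
    rcases hv with ⟨i, hi, rfl⟩ | ⟨j, hj, rfl⟩
    · rw [← vY_of_lt i.2]
      exact congrArg (fun g : Sm k l => g.1 p) (hf.1 i (by omega))
    · rw [← vZ_of_lt j.2]
      exact congrArg (fun g : Sm k l => g.1 p) (hf.2 j (by omega))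
  | zero => rw [map_zero, Sm.zero_val]
  | add v w _ _ hv hw => rw [map_add, hv, hw, Sm.zero_val, add_zero]
  | smul c v _ hv => rw [map_smul, hv, Sm.zero_val, smul_zero]

theorem cst_isSection_vY (d : ℕ) {i : ℕ} (hi : 1 ≤ i) :
    IsSection (distF k l d) (cst (vY i)) := fun p => by
  rw [mem_distF_iff, toFun_cst]
  refine ⟨vY_fst _, ?_, fun _ _ => Z_vY _ _⟩
  rw [Y_vY, if_neg]
  omega

theorem cst_isSection_vZ {d i : ℕ} (hi : d + 1 ≤ i) :
    IsSection (distF k l d) (cst (vZ i)) := fun p => by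
  rw [mem_distF_iff, toFun_cst]
  refine ⟨vZ_fst _, Y_vZ _ _, fun j hj => ?_⟩
  rw [Z_vZ, if_neg]
  omega

/-- F is cut out by dx, dy_0 and dz_j for j ≤ d. For a constant section v of F and one of these
coordinates w, [V, v] w = -v(V w), so testing on constant fields gives necessity. Sufficiency
follows because sections of F kill both w and V w. -/
theorem preserves_distF_iff (d : ℕ) (V : VField k l) :
    Preserves V (distF k l d) ↔
      der V cx ∈ Fn 1 (d + 1) ∧ der V (cy 0) ∈ Fn 1 (d + 1) ∧
        ∀ j ≤ d, der V (cz j) ∈ Fn 1 (d + 1) := by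
  constructor
  · intro h
    have key : ∀ v : EqMan k l, IsSection (distF k l d) (cst v) →
        dc v (der V cx) = 0 ∧ dc v (der V (cy 0)) = 0 ∧ ∀ j ≤ d, dc v (der V (cz j)) = 0 := by
      intro v hv
      have h1 := h _ hv
      have h2 := fun p => (mem_distF_iff d p _).1 (h1 p)
      refine ⟨Sm.ext fun p => ?_, Sm.ext fun p => ?_, fun j hj => Sm.ext fun p => ?_⟩
      · have h3 := (h2 p).1
        rw [← der_cx_val, der_lie] at h3
        change (der V (dc v cx) - dc v (der V cx)).1 p = 0 at h3
        rw [dc_cx, Derivation.map_algebraMap, zero_sub, Sm.neg_val, neg_eq_zero] at h3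
        exact h3
      · have h3 := (h2 p).2.1
        rw [← der_cy_val, der_lie] at h3
        change (der V (dc v (cy 0)) - dc v (der V (cy 0))).1 p = 0 at h3
        rw [dc_cy, Derivation.map_algebraMap, zero_sub, Sm.neg_val, neg_eq_zero] at h3
        exact h3
      · have h3 := (h2 p).2.2 j hj
        rw [← der_cz_val, der_lie] at h3
        change (der V (dc v (cz j)) - dc v (der V (cz j))).1 p = 0 at h3
        rw [dc_cz, Derivation.map_algebraMap, zero_sub, Sm.neg_val, neg_eq_zero] at h3
        exact h3
    have hY := fun i hi => key _ (cst_isSection_vY (k := k) (l := l) d (i := i) hi)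
    have hZ := fun i hi => key _ (cst_isSection_vZ (k := k) (l := l) (d := d) (i := i) hi)
    exact ⟨⟨fun i hi => (hY i hi).1, fun i hi => (hZ i hi).1⟩,
      ⟨fun i hi => (hY i hi).2.1, fun i hi => (hZ i hi).2.1⟩,
      fun j hj => ⟨fun i hi => (hY i hi).2.2 j hj, fun i hi => (hZ i hi).2.2 j hj⟩⟩
  · rintro ⟨hx, hy, hz⟩ W hW p
    have hp := (mem_distF_iff d p _).1 (hW p)
    have hWx : der W cx = 0 := Sm.ext fun q => by
      rw [der_cx_val]; exact ((mem_distF_iff d q _).1 (hW q)).1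
    have hWy : der W (cy 0) = 0 := Sm.ext fun q => by
      rw [der_cy_val]; exact ((mem_distF_iff d q _).1 (hW q)).2.1
    have hWz : ∀ j ≤ d, der W (cz j) = 0 := fun j hj => Sm.ext fun q => by
      rw [der_cz_val]; exact ((mem_distF_iff d q _).1 (hW q)).2.2 j hj
    refine (mem_distF_iff d p _).2 ⟨?_, ?_, fun j hj => ?_⟩
    · rw [← der_cx_val, der_lie, hWx, der_eq_zero_of_isSection hW hx, map_zero, sub_zero]; rfl
    · rw [← der_cy_val, der_lie, hWy, der_eq_zero_of_isSection hW hy, map_zero, sub_zero]; rfl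
    · rw [← der_cz_val, der_lie, hWz j hj, der_eq_zero_of_isSection hW (hz j hj), map_zero,
        sub_zero]; rfl

/-! ### Prolongation of smooth symbols -/

/-- The triples of smooth coefficients `(a, b, c)` of the symbols `a ∂_x + b ∂_{y_0} + c ∂_{z_0}`. -/
abbrev Trip (k l : ℕ) : Type := Sm k l × Sm k l × Sm k l

/-- The symbol with given smooth coefficients. -/
def Trip.symb (v : Trip k l) : Symb k l := ⟨v.1.1, v.2.1.1, v.2.2.1⟩

/-- The coefficients of a prolonged symbol, as smooth functions. -/
def pcoeff (u : ℕ → Sm k l) (a b : Sm k l) : ℕ → Sm k l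
  | 0 => b
  | i + 1 => dD (pcoeff u a b i) - u (i + 1) * dD a

theorem pcoeff_val (u : ℕ → Sm k l) (a b : Sm k l) (i : ℕ) :
    (pcoeff u a b i).1 = prolongCoeff (fun j => (u j).1) a.1 b.1 i := by
  induction i with
  | zero => rfl
  | succ i ih =>
    rw [prolongCoeff, ← ih]
    rfl

theorem pcoeff_add (u : ℕ → Sm k l) (a b a' b' : Sm k l) (i : ℕ) :
    pcoeff u (a + a') (b + b') i = pcoeff u a b i + pcoeff u a' b' i := by
  induction i with
  | zero => rfl
  | succ i ih => simp only [pcoeff, ih, map_add]; ring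

theorem pcoeff_smul (u : ℕ → Sm k l) (r : ℝ) (a b : Sm k l) (i : ℕ) :
    pcoeff u (r • a) (r • b) i = r • pcoeff u a b i := by
  induction i with
  | zero => rfl
  | succ i ih => simp only [pcoeff, ih, Derivation.map_smul, mul_smul_comm, smul_sub]

/-- This is the characteristic form of prolongation: a ∂_x + b ∂_{u_0} differs from a D by the
evolutionary field with characteristic b - u_1 a, whose coefficients are plain iterated total
derivatives. -/
theorem pcoeff_eq {u : ℕ → Sm k l} (hu : ∀ i, dD (u i) = u (i + 1)) (a b : Sm k l) (i : ℕ) :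
    pcoeff u a b i = (dD^[i]) (b - u 1 * a) + u (i + 1) * a := by
  induction i with
  | zero => simp [pcoeff]
  | succ i ih =>
    rw [pcoeff, ih, Function.iterate_succ_apply', map_add, Derivation.leibniz, hu]
    simp only [smul_eq_mul]
    ring

/-- The prolongation of a symbol with smooth coefficients. -/
def prolongV : Trip k l →ₗ[ℝ] VField k l where
  toFun v := ⟨v.symb.prolong, by
    change ContDiff ℝ ∞ _
    refine v.1.smooth.prodMk ((contDiff_pi.2 fun i => ?_).prodMk (contDiff_pi.2 fun i => ?_))
    · have := (pcoeff cy v.1 v.2.1 i).smooth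
      rwa [pcoeff_val] at this
    · have := (pcoeff cz v.1 v.2.2 i).smooth
      rwa [pcoeff_val] at this⟩
  map_add' v w := by
    refine VField.toFun_injective (funext fun p => Prod.ext rfl (Prod.ext (funext fun i => ?_)
      (funext fun i => ?_)))
    · have := congrFun (congrArg Subtype.val (pcoeff_add cy v.1 v.2.1 w.1 w.2.1 i)) p
      rw [pcoeff_val] at this
      refine this.trans ?_
      rw [Sm.add_val, pcoeff_val, pcoeff_val]
      rfl
    · have := congrFun (congrArg Subtype.val (pcoeff_add cz v.1 v.2.2 w.1 w.2.2 i)) p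
      rw [pcoeff_val] at this
      refine this.trans ?_
      rw [Sm.add_val, pcoeff_val, pcoeff_val]
      rfl
  map_smul' r v := by
    refine VField.toFun_injective (funext fun p => Prod.ext rfl (Prod.ext (funext fun i => ?_)
      (funext fun i => ?_)))
    · have := congrFun (congrArg Subtype.val (pcoeff_smul cy r v.1 v.2.1 i)) p
      rw [pcoeff_val] at this
      refine this.trans ?_
      rw [Sm.smul_val, pcoeff_val]
      rfl
    · have := congrFun (congrArg Subtype.val (pcoeff_smul cz r v.1 v.2.2 i)) p
      rw [pcoeff_val] at this
      refine this.trans ?_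
      rw [Sm.smul_val, pcoeff_val]
      rfl

theorem toFun_prolongV (v : Trip k l) : VField.toFun (prolongV v) = v.symb.prolong := rfl

theorem der_prolongV_cx (v : Trip k l) : der (prolongV v) cx = v.1 :=
  Sm.ext fun _ => der_cx_val _ _

theorem der_prolongV_cy (v : Trip k l) {i : ℕ} (hi : i < k) :
    der (prolongV v) (cy i) = pcoeff cy v.1 v.2.1 i := Sm.ext fun p => by
  rw [der_cy_val, pcoeff_val, toFun_prolongV, Y, dif_pos hi]
  rfl

theorem der_prolongV_cz (v : Trip k l) {i : ℕ} (hi : i < l) :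
    der (prolongV v) (cz i) = pcoeff cz v.1 v.2.2 i := Sm.ext fun p => by
  rw [der_cz_val, pcoeff_val, toFun_prolongV, Z, dif_pos hi]
  rfl

/-- The symbols whose prolongations are symmetries of the system of shift `d`. -/
def symTrip (k l d : ℕ) : Submodule ℝ (Trip k l) :=
  (symmetryAlgebra k l d).toSubmodule.comap prolongV

theorem pcoeff_zero_of_le {u : ℕ → Sm k l} {n : ℕ} (hu : ∀ i, n ≤ i → u i = 0) {a b : Sm k l}
    (h : pcoeff u a b n = 0) {i : ℕ} (hi : n ≤ i) : pcoeff u a b i = 0 := by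
  induction i, hi using Nat.le_induction with
  | base => exact h
  | succ i hi ih => rw [pcoeff, ih, hu _ (by omega), map_zero, zero_mul, sub_zero]

/-- At the order N of an equation u_N = 0 both u_N and u_{N+1} vanish, so consistency of the
prolongation says that D^N kills the characteristic. All later work starts from these conditions. -/
theorem mem_symTrip_iff (hk : 0 < k) (hl : 0 < l) (d : ℕ) (v : Trip k l) :
    v ∈ symTrip k l d ↔ dD^[k] (v.2.1 - cy 1 * v.1) = 0 ∧ dD^[l] (v.2.2 - cz 1 * v.1) = 0 ∧
      v.1 ∈ Fn 1 (d + 1) ∧ v.2.1 ∈ Fn 1 (d + 1) ∧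
        ∀ j ≤ d, j < l → pcoeff cz v.1 v.2.2 j ∈ Fn 1 (d + 1) := by
  have hpy : pcoeff cy v.1 v.2.1 k = dD^[k] (v.2.1 - cy 1 * v.1) := by
    rw [pcoeff_eq dD_cy, cy_of_le (Nat.le_succ k), zero_mul, add_zero]
  have hpz : pcoeff cz v.1 v.2.2 l = dD^[l] (v.2.2 - cz 1 * v.1) := by
    rw [pcoeff_eq dD_cz, cz_of_le (Nat.le_succ l), zero_mul, add_zero]
  change Preserves _ _ ∧ Preserves _ _ ↔ _
  rw [preserves_distE_iff, preserves_distF_iff, der_prolongV_cx, ← hpy, ← hpz,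
    der_prolongV_cy v hk, pcoeff]
  constructor
  · rintro ⟨⟨hy, hz⟩, hx, hy0, hzj⟩
    refine ⟨?_, ?_, hx, hy0, fun j hj hjl => der_prolongV_cz v hjl ▸ hzj j hj⟩
    · obtain ⟨k, rfl⟩ : ∃ m, k = m + 1 := ⟨k - 1, by omega⟩
      rw [pcoeff, ← der_prolongV_cy v (Nat.lt_succ_self k), ← hy, cy_of_le le_rfl, map_zero]
    · obtain ⟨l, rfl⟩ : ∃ m, l = m + 1 := ⟨l - 1, by omega⟩
      rw [pcoeff, ← der_prolongV_cz v (Nat.lt_succ_self l), ← hz, cz_of_le le_rfl, map_zero]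
  · rintro ⟨hy, hz, hx, hy0, hzj⟩
    have hY : ∀ i, der (prolongV v) (cy i) = pcoeff cy v.1 v.2.1 i := fun i => by
      by_cases h : i < k
      · exact der_prolongV_cy v h
      · rw [cy_of_le (by omega), map_zero, pcoeff_zero_of_le (fun i => cy_of_le) hy (by omega)]
    have hZ : ∀ i, der (prolongV v) (cz i) = pcoeff cz v.1 v.2.2 i := fun i => by
      by_cases h : i < l
      · exact der_prolongV_cz v h
      · rw [cz_of_le (by omega), map_zero, pcoeff_zero_of_le (fun i => cz_of_le) hz (by omega)]
    refine ⟨⟨fun i => ?_, fun i => ?_⟩, hx, hy0, fun j hj => ?_⟩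
    · rw [hY, hY, pcoeff]
    · rw [hZ, hZ, pcoeff]
    · by_cases h : j < l
      · rw [hZ]; exact hzj j hj h
      · rw [cz_of_le (by omega), map_zero]; exact zero_mem _

theorem eq_prolongV {d : ℕ} {V : VField k l} (hV : V ∈ symmetryAlgebra k l d) :
    V = prolongV (der V cx, der V (cy 0), der V (cz 0)) := by
  obtain ⟨hy, hz⟩ := (preserves_distE_iff V).1 hV.1
  have hY : ∀ i, der V (cy i) = pcoeff cy (der V cx) (der V (cy 0)) i := fun i => by
    induction i with
    | zero => rfl
    | succ i ih => rw [pcoeff, ← ih, hy]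
  have hZ : ∀ i, der V (cz i) = pcoeff cz (der V cx) (der V (cz 0)) i := fun i => by
    induction i with
    | zero => rfl
    | succ i ih => rw [pcoeff, ← ih, hz]
  refine vField_ext ?_ (fun i => ?_) fun i => ?_
  · rw [der_prolongV_cx]
  · by_cases h : i < k
    · rw [der_prolongV_cy _ h, hY]
    · rw [cy_of_le (by omega), map_zero, map_zero]
  · by_cases h : i < l
    · rw [der_prolongV_cz _ h, hZ]
    · rw [cz_of_le (by omega), map_zero, map_zero]

theorem map_prolongV_symTrip (d : ℕ) :
    (symTrip k l d).map prolongV = (symmetryAlgebra k l d).toSubmodule := by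
  refine le_antisymm (Submodule.map_comap_le _ _) fun V hV => ?_
  refine ⟨_, ?_, (eq_prolongV hV).symm⟩
  change prolongV _ ∈ symmetryAlgebra k l d
  rwa [← eq_prolongV hV]

/-- Reduces each classification to an equality of spaces of coefficient triples. -/
theorem symmetrySpace_eq_prolongSpan {d : ℕ} {S : Set (Symb k l)} {T : Set (Trip k l)}
    (hS : S = Trip.symb '' T) (hT : symTrip k l d = Submodule.span ℝ T) :
    symmetrySpace k l d = prolongSpan S := by
  rw [symmetrySpace, ← map_prolongV_symTrip, hT, prolongSpan, hS, Submodule.map_span,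
    Submodule.map_span, Set.image_image, Set.image_image]
  rfl

/-! ### Functions that are polynomial along the integral curves of `D` -/

/-- The functions `f` with `D^n f = 0`. -/
def Pn (n : ℕ) : Submodule ℝ (Sm k l) := LinearMap.ker ((dD : Derivation ℝ (Sm k l) (Sm k l)) ^ n : Module.End ℝ (Sm k l))

theorem mem_Pn {n : ℕ} {f : Sm k l} : f ∈ Pn n ↔ dD^[n] f = 0 := by
  rw [Pn, LinearMap.mem_ker, Module.End.pow_apply]
  rfl

theorem dD_mem_Pn {n : ℕ} {f : Sm k l} : dD f ∈ Pn n ↔ f ∈ Pn (n + 1) := by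
  rw [mem_Pn, mem_Pn, Function.iterate_succ_apply]

theorem mem_Pn_zero {f : Sm k l} : f ∈ Pn 0 ↔ f = 0 := by
  rw [mem_Pn, Function.iterate_zero, id]

theorem mem_Pn_one {f : Sm k l} : f ∈ Pn 1 ↔ dD f = 0 := by
  rw [← dD_mem_Pn, mem_Pn_zero]

theorem Pn_mono {m n : ℕ} (h : m ≤ n) {f : Sm k l} (hf : f ∈ Pn m) : f ∈ Pn n := by
  induction n, h using Nat.le_induction generalizing f with
  | base => exact hf
  | succ n h ih =>
    rw [mem_Pn] at hf ⊢
    rw [Function.iterate_succ_apply']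
    have := ih (mem_Pn.2 hf)
    rw [mem_Pn] at this
    rw [this, map_zero]

/-- Membership in `Pn (a + 1)` means degree at most a along the curves of D, and degrees add by the
Leibniz rule. -/
theorem mul_mem_Pn {a b : ℕ} {f g : Sm k l} (hf : f ∈ Pn (a + 1)) (hg : g ∈ Pn (b + 1)) :
    f * g ∈ Pn (a + b + 1) := by
  induction h : a + b generalizing a b f g with
  | zero =>
    obtain ⟨rfl, rfl⟩ : a = 0 ∧ b = 0 := by omega
    rw [mem_Pn_one] at *
    rw [Derivation.leibniz, hf, hg, smul_zero, smul_zero, add_zero]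
  | succ n ih =>
    rw [← dD_mem_Pn, Derivation.leibniz, smul_eq_mul, smul_eq_mul]
    refine add_mem ?_ ?_
    · rcases b with _ | b
      · rw [mem_Pn_one.1 hg, mul_zero]; exact zero_mem _
      · exact ih hf (dD_mem_Pn.2 hg) (by omega)
    · rcases a with _ | a
      · rw [mem_Pn_one.1 hf, mul_zero]; exact zero_mem _
      · exact ih hg (dD_mem_Pn.2 hf) (by omega)

theorem algebraMap_mem_Pn (r : ℝ) : algebraMap ℝ (Sm k l) r ∈ Pn 1 :=
  mem_Pn_one.2 (Derivation.map_algebraMap _ _)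

theorem one_mem_Pn : (1 : Sm k l) ∈ Pn 1 := mem_Pn_one.2 (Derivation.map_one_eq_zero _)

theorem cx_mem_Pn : (cx : Sm k l) ∈ Pn 2 :=
  dD_mem_Pn.1 (by rw [dD_cx]; exact one_mem_Pn)

theorem pow_mem_Pn {a : ℕ} {f : Sm k l} (hf : f ∈ Pn (a + 1)) (n : ℕ) :
    f ^ n ∈ Pn (n * a + 1) := by
  induction n with
  | zero => rw [pow_zero, zero_mul]; exact one_mem_Pn
  | succ n ih =>
    rw [pow_succ, Nat.succ_mul]
    exact mul_mem_Pn ih hf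

theorem cx_pow_mem_Pn (n : ℕ) : (cx : Sm k l) ^ n ∈ Pn (n + 1) := by
  have := pow_mem_Pn (a := 1) (cx_mem_Pn (k := k) (l := l)) n
  rwa [mul_one] at this

theorem cy_mem_Pn {i n : ℕ} (h : k ≤ i + n) : (cy i : Sm k l) ∈ Pn n := by
  induction n generalizing i with
  | zero => rw [mem_Pn_zero]; exact cy_of_le h
  | succ n ih => rw [← dD_mem_Pn, dD_cy]; exact ih (by omega)

theorem cz_mem_Pn {i n : ℕ} (h : l ≤ i + n) : (cz i : Sm k l) ∈ Pn n := by
  induction n generalizing i with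
  | zero => rw [mem_Pn_zero]; exact cz_of_le h
  | succ n ih => rw [← dD_mem_Pn, dD_cz]; exact ih (by omega)

/-! ### The flow of D and division by x - t. -/

/-- The linear part of the vector field `D`. -/
def totLin : EqMan k l →L[ℝ] EqMan k l :=
  LinearMap.toContinuousLinearMap
    { toFun := fun p => (0, fun i => Y (i + 1 : ℕ) p, fun j => Z (j + 1 : ℕ) p)
      map_add' := fun p q => by
        refine Prod.ext (add_zero 0).symm (Prod.ext (funext fun i => ?_) (funext fun i => ?_))
        · exact Y_add _ _ _
        · exact Z_add _ _ _
      map_smul' := fun c p => by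
        refine Prod.ext (mul_zero c).symm (Prod.ext (funext fun i => ?_) (funext fun i => ?_))
        · exact Y_smul _ _ _
        · exact Z_smul _ _ _ }

theorem total_eq (p : EqMan k l) : total p = totLin p + dX := by
  refine Prod.ext (zero_add 1).symm (Prod.ext (funext fun i => ?_) (funext fun i => ?_))
  · exact (add_zero _).symm
  · exact (add_zero _).symm

theorem totLin_dX : totLin (dX : EqMan k l) = 0 := by
  refine Prod.ext rfl (Prod.ext (funext fun i => ?_) (funext fun i => ?_))
  · change Y _ dX = 0
    simp [Y, dX]
  · change Z _ dX = 0
    simp [Z, dX]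

/-- With D = L + ∂_x and L ∂_x = 0, the curve is exp(sL) p + s ∂_x. It exists for all times, so
every hyperplane x = t is reached. -/
theorem exists_integralCurve (p : EqMan k l) :
    ∃ γ : ℝ → EqMan k l, γ 0 = p ∧ ∀ s, HasDerivAt γ (total (γ s)) s := by
  refine ⟨fun s => NormedSpace.exp (s • (totLin : EqMan k l →L[ℝ] EqMan k l)) p + s • dX,
    by simp, fun s => ?_⟩
  have h1 := (hasDerivAt_exp_smul_const' (𝕂 := ℝ) (totLin : EqMan k l →L[ℝ] EqMan k l) s).clm_apply
    (hasDerivAt_const s p)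
  have h2 := (hasDerivAt_id s).smul_const (dX : EqMan k l)
  refine (h1.add h2).congr_deriv ?_
  rw [total_eq, map_add, map_smul, totLin_dX]
  simp

/-- The function is constant along the curves of D, on which x = x(p) + s, and every such curve
meets the hyperplane x = t. -/
theorem eq_zero_of_dD_eq_zero {f : Sm k l} (hf : dD f = 0) (t : ℝ)
    (h : ∀ p : EqMan k l, p.1 = t → f.1 p = 0) : f = 0 := by
  refine Sm.ext fun p => ?_
  obtain ⟨γ, h0, hγ⟩ := exists_integralCurve p
  have hconst : ∀ g : Sm k l, ∀ s, HasDerivAt (fun s => g.1 (γ s)) ((dD g).1 (γ s)) s :=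
    fun g s => (g.diff (γ s)).hasFDerivAt.comp_hasDerivAt s (hγ s)
  have h1 : ∀ s, f.1 (γ s) = f.1 (γ 0) := fun s => by
    refine is_const_of_deriv_eq_zero (fun s => (hconst f s).differentiableAt) (fun s => ?_) s 0
    rw [(hconst f s).deriv, hf, Sm.zero_val]
  have h2 : ∀ s, (γ s).1 = p.1 + s := fun s => by
    have h3 := hconst (cx : Sm k l)
    have h4 : ∀ s, HasDerivAt (fun s => (cx : Sm k l).1 (γ s) - s) (0 : ℝ) s := fun s => by
      refine ((h3 s).sub (hasDerivAt_id s)).congr_deriv ?_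
      rw [dD_cx, Sm.one_val, sub_self]
    have h5 := is_const_of_deriv_eq_zero (fun s => (h4 s).differentiableAt)
      (fun s => (h4 s).deriv) s 0
    simp only [cx_val, h0, sub_zero] at h5
    linarith
  rw [← h0, ← h1 (t - p.1), Sm.zero_val]
  exact h _ (by rw [h2]; ring)

/-- The set x ≠ t is dense and f is continuous. -/
theorem eq_zero_of_pow_mul_eq_zero {f : Sm k l} (t : ℝ) (n : ℕ)
    (h : (cx - algebraMap ℝ _ t) ^ n * f = 0) : f = 0 := by
  refine Subtype.ext ?_
  have hd : Dense ((Prod.fst : EqMan k l → ℝ) ⁻¹' {t}ᶜ) :=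
    (dense_compl_singleton t).preimage isOpenMap_fst
  refine Continuous.ext_on hd f.smooth.continuous continuous_const fun p hp => ?_
  have h1 : (p.1 - t) ^ n * f.1 p = 0 := congrArg (fun g : Sm k l => g.1 p) h
  rcases mul_eq_zero.1 h1 with h2 | h2
  · exact absurd (sub_eq_zero.1 (by by_contra h3; exact pow_ne_zero n h3 h2)) hp
  · exact h2

theorem dD_iterate_mul_sub (t : ℝ) (n : ℕ) (f : Sm k l) :
    dD^[n + 1] ((cx - algebraMap ℝ _ t) * f) =
      (cx - algebraMap ℝ _ t) * dD^[n + 1] f + ((n + 1 : ℕ) : Sm k l) * dD^[n] f := by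
  induction n with
  | zero => simp
  | succ n ih =>
    rw [Function.iterate_succ_apply', ih, map_add, Derivation.leibniz, Derivation.leibniz,
      Derivation.map_natCast, map_sub, dD_cx, Derivation.map_algebraMap,
      Function.iterate_succ_apply' _ (n + 1), Function.iterate_succ_apply' _ n]
    simp only [smul_eq_mul]
    push_cast
    ring

/-- With w = x - t, the hypothesis for n + 1 reads w D^{n+1} f + (n + 1) D^n f = 0. Times w^n it
says that w^{n+1} D^n f is constant along D; it vanishes on w = 0, hence everywhere. -/
theorem mem_Pn_of_sub_mul_mem {n : ℕ} {f : Sm k l} (t : ℝ)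
    (h : (cx - algebraMap ℝ _ t) * f ∈ Pn n) : f ∈ Pn (n - 1) := by
  rcases n with _ | n
  · rw [mem_Pn_zero] at h ⊢
    exact eq_zero_of_pow_mul_eq_zero t 1 (by rwa [pow_one])
  · rw [mem_Pn, dD_iterate_mul_sub] at h
    rw [Nat.add_sub_cancel, mem_Pn]
    refine eq_zero_of_pow_mul_eq_zero t (n + 1) (eq_zero_of_dD_eq_zero ?_ t fun p hp => ?_)
    · rw [Derivation.leibniz, Derivation.leibniz_pow, map_sub, dD_cx, Derivation.map_algebraMap,
        ← Function.iterate_succ_apply' dD, Nat.add_sub_cancel]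
      simp only [smul_eq_mul, sub_zero, nsmul_eq_mul, mul_one]
      linear_combination (cx - algebraMap ℝ _ t) ^ n * h
    · have : (cx - algebraMap ℝ (Sm k l) t).1 p = p.1 - t := rfl
      rw [Sm.mul_val, Sm.pow_val, this, hp, sub_self, zero_pow (Nat.succ_ne_zero n), zero_mul]

theorem mem_Pn_of_sub_pow_mul_mem {n : ℕ} (m : ℕ) {f : Sm k l} (t : ℝ)
    (h : (cx - algebraMap ℝ _ t) ^ m * f ∈ Pn n) : f ∈ Pn (n - m) := by
  induction m generalizing n with
  | zero => simpa using h
  | succ m ih =>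
    rw [pow_succ', mul_assoc] at h
    have := ih (mem_Pn_of_sub_mul_mem t h)
    rwa [Nat.sub_sub, add_comm] at this

/-- Coefficients of a polynomial in a real parameter with values in the smooth functions. -/
theorem eq_zero_of_forall_sum_pow_smul {q : ℕ} {F : ℕ → Sm k l}
    (h : ∀ t : ℝ, ∑ e ∈ Finset.range q, t ^ e • F e = 0) {e : ℕ} (he : e < q) : F e = 0 := by
  refine Sm.ext fun p => ?_
  have h1 : (∑ e ∈ Finset.range q, Polynomial.monomial e ((F e).1 p)) = 0 := by
    refine Polynomial.funext fun t => ?_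
    rw [Polynomial.eval_finsetSum, Polynomial.eval_zero]
    have := congrArg (fun g : Sm k l => g.1 p) (h t)
    simp only [Sm.sum_val, Sm.smul_val, Sm.zero_val] at this
    rw [← this]
    refine Finset.sum_congr rfl fun e _ => ?_
    rw [Polynomial.eval_monomial, mul_comm]
  have h2 := congrArg (fun P => Polynomial.coeff P e) h1
  simp only [Polynomial.finsetSum_coeff, Polynomial.coeff_monomial, Polynomial.coeff_zero,
    Finset.sum_ite_eq', Finset.mem_range, he, if_true] at h2
  exact h2

/-! ### Functions of `x` -/

theorem fderiv_val_eq (f : Sm k l) (p v : EqMan k l) :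
    fderiv ℝ f.1 p v = v.1 * (px f).1 p + (∑ i ∈ Finset.range k, Y i v * (pY i f).1 p +
      ∑ j ∈ Finset.range l, Z j v * (pZ j f).1 p) := by
  have hv : v = v.1 • dX + (∑ i : Fin k, v.2.1 i • dY i + ∑ j : Fin l, v.2.2 j • dZ j) := by
    refine Prod.ext ?_ (Prod.ext ?_ ?_)
    · simp [Prod.fst_sum, dX, dY, dZ]
    · funext m
      simp [Prod.fst_sum, Prod.snd_sum, dX, dY, dZ, Finset.sum_apply, Pi.single_apply]
    · funext m
      simp [Prod.snd_sum, dX, dY, dZ, Finset.sum_apply, Pi.single_apply]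
  conv_lhs => rw [hv]
  simp only [map_add, map_sum, map_smul, smul_eq_mul, Finset.sum_range]
  congr 2
  · refine Finset.sum_congr rfl fun i _ => ?_
    rw [← vY_of_lt i.2, Y, dif_pos i.2]
    rfl
  · refine Finset.sum_congr rfl fun i _ => ?_
    rw [← vZ_of_lt i.2, Z, dif_pos i.2]
    rfl

theorem dD_eq (f : Sm k l) : dD f = px f + (∑ i ∈ Finset.range k, cy (i + 1) * pY i f +
    ∑ j ∈ Finset.range l, cz (j + 1) * pZ j f) := Sm.ext fun p => by
  simp only [Sm.add_val, Sm.sum_val, Sm.mul_val]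
  rw [dD, der_val, fderiv_val_eq, toFun_tot, show (total p).1 = 1 from rfl, one_mul]
  simp only [Y_total, Z_total, cy_val, cz_val]

theorem eq_const_of_dD_eq_zero {f : Sm k l} (hf : f ∈ Fn 0 0) (h : dD f = 0) :
    ∃ r : ℝ, f = algebraMap ℝ _ r := by
  have hy : ∀ i, pY i f = 0 := fun i => hf.1 i (Nat.zero_le i)
  have hz : ∀ i, pZ i f = 0 := fun i => hf.2 i (Nat.zero_le i)
  have hx : px f = 0 := by
    rw [dD_eq] at h
    simpa [hy, hz] using h
  refine ⟨f.1 0, Sm.ext fun p => ?_⟩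
  refine is_const_of_fderiv_eq_zero (𝕜 := ℝ) f.diff (fun q => ?_) p 0
  refine ContinuousLinearMap.ext fun v => ?_
  rw [fderiv_val_eq]
  simp [hx, hy, hz]

theorem mem_span_cx_pow {n : ℕ} {f : Sm k l} (hf : f ∈ Fn 0 0) (h : f ∈ Pn n) :
    f ∈ Submodule.span ℝ {g : Sm k l | ∃ i < n, g = cx ^ i} := by
  induction n generalizing f with
  | zero => rw [mem_Pn_zero.1 h]; exact zero_mem _
  | succ n ih =>
    have h1 := ih (dD_mem_Fn (Or.inl rfl) (Or.inl rfl) hf) (dD_mem_Pn.2 h)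
    -- F is a termwise antiderivative in x of D f, which is already known to be a polynomial in x.
    obtain ⟨F, hF, hF', hF''⟩ : ∃ F ∈ Submodule.span ℝ {g : Sm k l | ∃ i < n + 1, g = cx ^ i},
        F ∈ Fn 0 0 ∧ dD F = dD f := by
      generalize dD f = f' at h1
      clear h hf
      induction h1 using Submodule.span_induction with
      | mem g hg =>
        obtain ⟨i, hi, rfl⟩ := hg
        refine ⟨((i + 1 : ℕ) : ℝ)⁻¹ • cx ^ (i + 1),
          Submodule.smul_mem _ _ (Submodule.subset_span ⟨i + 1, by omega, rfl⟩),
          Subalgebra.smul_mem _ (pow_mem (cx_mem_Fn 0 0) _) _, ?_⟩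
        rw [Derivation.map_smul, Derivation.leibniz_pow, dD_cx, Nat.add_sub_cancel, smul_eq_mul,
          mul_one, ← Nat.cast_smul_eq_nsmul ℝ, smul_smul, inv_mul_cancel₀ (by positivity), one_smul]
      | zero => exact ⟨0, zero_mem _, zero_mem _, map_zero _⟩
      | add g g' _ _ hg hg' =>
        obtain ⟨F, h1, h2, h3⟩ := hg
        obtain ⟨F', h1', h2', h3'⟩ := hg'
        exact ⟨F + F', add_mem h1 h1', add_mem h2 h2', by rw [map_add, h3, h3']⟩
      | smul c g _ hg =>
        obtain ⟨F, h1, h2, h3⟩ := hg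
        exact ⟨c • F, Submodule.smul_mem _ _ h1, Subalgebra.smul_mem _ h2 _,
          by rw [Derivation.map_smul, h3]⟩
    obtain ⟨r, hr⟩ := eq_const_of_dD_eq_zero (sub_mem hf hF') (by rw [map_sub, hF'', sub_self])
    rw [← sub_add_cancel f F, hr, Algebra.algebraMap_eq_smul_one]
    exact add_mem (Submodule.smul_mem _ _ (Submodule.subset_span ⟨0, by omega, (pow_zero _).symm⟩))
      hF

/-- A function that is annihilated by the Euler field of the fibres depends on `x` only. -/
theorem mem_Fn_zero_of_euler_eq_zero {f : Sm k l}
    (h : ∑ i ∈ Finset.range k, cy i * pY i f + ∑ j ∈ Finset.range l, cz j * pZ j f = 0) :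
    f ∈ Fn 0 0 := by
  have key : ∀ p : EqMan k l, f.1 p = f.1 (p.1, 0) := by
    intro p
    -- The ray from the zero section to p; f is shown to be constant along it.
    let γ : ℝ → EqMan k l := fun s => (p.1, s • p.2)
    have hγ : ∀ s, HasDerivAt γ (0, p.2) s := fun s => by
      refine (hasDerivAt_const s p.1).prodMk ?_
      simpa using (hasDerivAt_id s).smul_const p.2
    have h1 : ∀ s, HasDerivAt (fun s => f.1 (γ s)) (fderiv ℝ f.1 (γ s) (0, p.2)) s :=
      fun s => (f.diff (γ s)).hasFDerivAt.comp_hasDerivAt s (hγ s)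
    have h2 : (fun s => fderiv ℝ f.1 (γ s) (0, p.2)) = fun _ => 0 := by
      have hγc : Continuous γ := continuous_iff_continuousAt.2 fun s => (hγ s).continuousAt
      have hc : Continuous fun s => fderiv ℝ f.1 (γ s) (0, p.2) :=
        ((f.smooth.continuous_fderiv (by simp)).comp hγc).clm_apply continuous_const
      -- The Euler equation at γ(s) only gives s times the derivative. Continuity supplies the value
      -- at s = 0.
      refine Continuous.ext_on (dense_compl_singleton (0 : ℝ)) hc continuous_const fun s hs => ?_
      have h3 : s * fderiv ℝ f.1 (γ s) (0, p.2) = 0 := by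
        rw [← smul_eq_mul, ← map_smul, fderiv_val_eq]
        have h4 := congrArg (fun g : Sm k l => g.1 (γ s)) h
        simp only [Sm.add_val, Sm.sum_val, Sm.mul_val, cy_val, cz_val, Sm.zero_val] at h4
        rw [show (s • ((0, p.2) : EqMan k l)).1 = 0 by simp, zero_mul, zero_add]
        exact h4
      exact (mul_eq_zero.1 h3).resolve_left hs
    have h5 := is_const_of_deriv_eq_zero (fun s => (h1 s).differentiableAt)
      (fun s => (h1 s).deriv.trans (congrFun h2 s)) 1 0
    simpa [γ] using h5
  have hv : ∀ v : EqMan k l, v.1 = 0 → dc v f = 0 := fun v hv => Sm.ext fun p => by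
    let π : EqMan k l →L[ℝ] EqMan k l := (ContinuousLinearMap.inl ℝ ℝ _).comp
      (ContinuousLinearMap.fst ℝ ℝ _)
    have h1 : f.1 = f.1 ∘ π := funext fun p => key p
    have h2 : HasFDerivAt (f.1 ∘ π) ((fderiv ℝ f.1 (π p)).comp π) p :=
      (f.diff (π p)).hasFDerivAt.comp p π.hasFDerivAt
    rw [dc, der_val, h1, h2.fderiv, toFun_cst]
    have : π v = 0 := by
      change (v.1, 0) = _
      rw [hv]
      rfl
    rw [ContinuousLinearMap.comp_apply, this, map_zero, Sm.zero_val]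
  exact ⟨fun i _ => hv _ (vY_fst i), fun i _ => hv _ (vZ_fst i)⟩

/-! ### The functions `g_{i,j}^{(s)}` as smooth functions -/

/-- The functions `g_{i,j}`, as smooth functions. -/
def gb (u : ℕ → Sm k l) (i j : ℕ) : Sm k l :=
  (((i + j).factorial : ℝ)⁻¹) • ∑ m ∈ Finset.range (i + 1),
    ((-1) ^ m * (i.choose m : ℝ) * (j.ascFactorial m : ℝ)) • (cx ^ (i - m) * u (i - m))

/-- The functions `g_{i,j}^{(s)}`, as smooth functions. -/
def gs (u : ℕ → Sm k l) (i j s : ℕ) : Sm k l := px^[s] (gb u i j)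

theorem gs_val (u : ℕ → Sm k l) (i j s : ℕ) :
    (gs u i j s).1 = g (fun n => (u n).1) i j s := by
  have h0 : (gb u i j).1 = gBase (fun n => (u n).1) i j := funext fun p => by
    rw [gb, Sm.smul_val, Sm.sum_val, gBase, div_eq_inv_mul]
    congr 1
    refine Finset.sum_congr rfl fun m _ => ?_
    rw [Sm.smul_val, Sm.mul_val, Sm.pow_val, cx_val, X]
    ring
  rw [gs, g]
  induction s with
  | zero => exact h0
  | succ s ih =>
    rw [Function.iterate_succ_apply', Function.iterate_succ_apply', ← ih]
    rfl

/-- The coefficients of `g_{d,N-d}^{(s)}`. -/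
def gcoef (N d s r : ℕ) : ℝ :=
  (N.factorial : ℝ)⁻¹ * ((-1) ^ (d - r) * (d.choose r : ℝ) * ((N - d).ascFactorial (d - r) : ℝ) *
    (r.descFactorial s : ℝ))

/-- ∂_x acts on the powers of x only and produces the falling factorials of `gcoef`. The summation
index of `gb` is reversed so that r is the jet order. -/
theorem gs_eq {u : ℕ → Sm k l} (hu : ∀ i, px (u i) = 0) {N d : ℕ} (hd : d < N) (s : ℕ) :
    gs u d (N - d) s =
      ∑ r ∈ Finset.range (d + 1), (gcoef N d s r • cx ^ (r - s)) * u r := by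
  induction s with
  | zero =>
    rw [gs, Function.iterate_zero, id, gb, ← Finset.sum_range_reflect, Finset.smul_sum]
    refine Finset.sum_congr rfl fun r hr => ?_
    have hr' : r ≤ d := by have := Finset.mem_range.1 hr; omega
    have h1 : d + 1 - 1 - r = d - r := by omega
    have h2 : d - (d - r) = r := by omega
    have h3 : d + (N - d) = N := by omega
    rw [h1, h2, h3, gcoef, Nat.choose_symm hr', smul_smul, Nat.descFactorial_zero, Nat.cast_one,
      mul_one, Nat.sub_zero, smul_mul_assoc]
  | succ s ih =>
    rw [gs, Function.iterate_succ_apply', ← gs, ih, map_sum]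
    refine Finset.sum_congr rfl fun r _ => ?_
    rw [Derivation.leibniz, hu, smul_zero, zero_add, Derivation.map_smul, Derivation.leibniz_pow,
      px_cx, smul_eq_mul, smul_eq_mul, mul_one, mul_comm, ← Nat.cast_smul_eq_nsmul ℝ, smul_smul,
      Nat.sub_sub, gcoef, gcoef, Nat.descFactorial_succ]
    congr 2
    push_cast
    ring

/-! ### Blocks of jet variables -/

/-- The properties of the jet variables `u_0, …, u_{N-1}` of an equation `u_N = 0`, and of the
corresponding partial derivatives `P_0, …, P_{N-1}`, that are used in the classification. -/
structure IsBlock (N : ℕ) (P : ℕ → Derivation ℝ (Sm k l) (Sm k l)) (u : ℕ → Sm k l) : Prop where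
  P_cx : ∀ i, P i cx = 0
  P_zero_dD : ∀ f, P 0 (dD f) = dD (P 0 f)
  P_succ_dD : ∀ i, i + 1 < N → ∀ f, P (i + 1) (dD f) = dD (P (i + 1) f) + P i f
  P_u : ∀ i j, P i (u j) = if i = j ∧ i < N then 1 else 0
  dD_u : ∀ i, dD (u i) = u (i + 1)
  u_of_le : ∀ i, N ≤ i → u i = 0
  px_u : ∀ i, px (u i) = 0

theorem isBlockY : IsBlock (k := k) (l := l) k pY cy :=
  ⟨pY_cx, pY_zero_dD, fun _ => pY_succ_dD, pY_cy, dD_cy, fun _ => cy_of_le, px_cy⟩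

theorem isBlockZ : IsBlock (k := k) (l := l) l pZ cz :=
  ⟨pZ_cx, pZ_zero_dD, fun _ => pZ_succ_dD, pZ_cz, dD_cz, fun _ => cz_of_le, px_cz⟩

namespace IsBlock

variable {N : ℕ} {P : ℕ → Derivation ℝ (Sm k l) (Sm k l)} {u : ℕ → Sm k l}

theorem P_smul_cx_pow (h : IsBlock N P u) (i n : ℕ) (t : ℝ) :
    P i (t • cx ^ n) = 0 := by
  rw [Derivation.map_smul, Derivation.leibniz_pow, h.P_cx, smul_zero, smul_zero, smul_zero]

/-! ### Translation along the solutions (x - t)^(N-1) of u_N = 0. -/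

variable (P) in
/-- The symmetry of the equation `u_N = 0` given by the solution `(x - t)^{N-1}`, truncated after
the order `q - 1` and divided by `(x - t)^{N-q}`. -/
def transl (N q : ℕ) (t : ℝ) (f : Sm k l) : Sm k l :=
  ∑ i ∈ Finset.range q,
    (((N - 1).descFactorial i : ℝ) • (cx - algebraMap ℝ _ t) ^ (q - 1 - i)) * P i f

/-- (x - t)^(N-1) solves the linear equation u_N = 0, so adding multiples of it to u is a symmetry.
In coordinates, the terms from [∂_{u_{i+1}}, D] = ∂_{u_i} cancel those in which D differentiates the
coefficients. -/
theorem transl_dD (h : IsBlock N P u) (t : ℝ) (f : Sm k l) :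
    transl P N N t (dD f) = dD (transl P N N t f) := by
  rcases N with _ | M
  · simp [transl]
  rw [← sub_eq_zero]
  set w : Sm k l := cx - algebraMap ℝ _ t with hw
  have hDw : dD w = 1 := by rw [hw, map_sub, dD_cx, Derivation.map_algebraMap, sub_zero]
  simp only [transl, map_sum, ← hw, Nat.add_sub_cancel, Derivation.leibniz, Derivation.map_smul,
    Derivation.leibniz_pow, hDw, smul_eq_mul, mul_one]
  rw [Finset.sum_add_distrib, Finset.sum_range_succ', h.P_zero_dD,
    Finset.sum_congr rfl fun i hi => by
      rw [h.P_succ_dD i (by have := Finset.mem_range.1 hi; omega)],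
    Finset.sum_range_succ' (fun i => ((M.descFactorial i : ℝ) • w ^ (M - i)) * dD (P i f)),
    Finset.sum_range_succ (fun i => P i f * (M.descFactorial i : ℝ) • ((M - i) • w ^ (M - i - 1)))]
  simp only [mul_add, Finset.sum_add_distrib, Nat.sub_self, zero_smul, smul_zero, mul_zero,
    add_zero]
  have : ∑ i ∈ Finset.range M, ((M.descFactorial (i + 1) : ℝ) • w ^ (M - (i + 1))) * P i f =
      ∑ i ∈ Finset.range M, P i f * (M.descFactorial i : ℝ) • ((M - i) • w ^ (M - i - 1)) := by
    refine Finset.sum_congr rfl fun i _ => ?_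
    rw [Nat.descFactorial_succ, mul_comm, ← Nat.cast_smul_eq_nsmul ℝ, smul_smul, Nat.sub_sub]
    congr 2
    push_cast
    ring
  rw [this]
  abel

theorem transl_eq_pow_mul {q : ℕ} (hq : q ≤ N) (t : ℝ) {f : Sm k l}
    (hf : ∀ i, q ≤ i → P i f = 0) :
    transl P N N t f = (cx - algebraMap ℝ _ t) ^ (N - q) * transl P N q t f := by
  obtain ⟨m, rfl⟩ := Nat.exists_eq_add_of_le hq
  rw [transl, Finset.sum_range_add, transl, Finset.mul_sum]
  rw [Finset.sum_eq_zero (s := Finset.range m) fun i _ => by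
    rw [hf _ (Nat.le_add_right q i), mul_zero], add_zero]
  refine Finset.sum_congr rfl fun i hi => ?_
  have : q + m - 1 - i = (q + m - q) + (q - 1 - i) := by
    have := Finset.mem_range.1 hi; omega
  rw [this, pow_add, Algebra.smul_def, Algebra.smul_def]
  ring

theorem transl_iterate (h : IsBlock N P u) (t : ℝ) (n : ℕ) (f : Sm k l) :
    transl P N N t (dD^[n] f) = dD^[n] (transl P N N t f) := by
  induction n with
  | zero => rfl
  | succ n ih => rw [Function.iterate_succ_apply', Function.iterate_succ_apply', h.transl_dD, ih]

theorem transl_zero (q : ℕ) (t : ℝ) : transl P N q t (0 : Sm k l) = 0 := by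
  simp [transl]

/-- The full translation commutes with D, so it keeps D^n f = 0. It equals (x - t)^(N-q) times the
truncated one, and each factor x - t divided off lowers the degree by one. -/
theorem transl_mem_Pn (h : IsBlock N P u) {q n : ℕ} (hq : q ≤ N) (t : ℝ) {f : Sm k l}
    (hf : ∀ i, q ≤ i → P i f = 0) (hn : f ∈ Pn n) : transl P N q t f ∈ Pn (n - (N - q)) := by
  refine mem_Pn_of_sub_pow_mul_mem _ t ?_
  rw [← transl_eq_pow_mul hq t hf, mem_Pn, ← h.transl_iterate, mem_Pn.1 hn, transl_zero]

variable (P) in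
/-- The coefficients of `transl` as a polynomial in the parameter `t`. -/
def translCoeff (N q e : ℕ) (f : Sm k l) : Sm k l :=
  ∑ i ∈ Finset.range q, (((N - 1).descFactorial i : ℝ) * ((-1) ^ e * ((q - 1 - i).choose e : ℝ))) •
    (cx ^ (q - 1 - i - e) * P i f)

theorem sub_pow_eq_sum {n q : ℕ} (h : n < q) (t : ℝ) :
    ((cx : Sm k l) - algebraMap ℝ _ t) ^ n =
      ∑ e ∈ Finset.range q, t ^ e • (((-1) ^ e * (n.choose e : ℝ)) • cx ^ (n - e)) := by
  rw [sub_eq_neg_add, add_pow]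
  have h1 : Finset.range (n + 1) ⊆ Finset.range q := Finset.range_subset_range.2 h
  refine Eq.trans (Finset.sum_congr rfl fun e _ => ?_) (Finset.sum_subset h1 fun e _ he => ?_)
  · rw [← map_neg, ← map_pow, neg_pow, smul_smul, Algebra.smul_def, map_mul, map_mul, map_mul,
      map_natCast]
    ring
  · rw [Nat.choose_eq_zero_of_lt (by have := Finset.mem_range.not.1 he; omega), Nat.cast_zero,
      mul_zero, zero_smul, smul_zero]

theorem transl_eq_sum (q : ℕ) (t : ℝ) (f : Sm k l) :
    transl P N q t f = ∑ e ∈ Finset.range q, t ^ e • translCoeff P N q e f := by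
  simp only [transl, translCoeff, Finset.smul_sum]
  rw [Finset.sum_comm]
  refine Finset.sum_congr rfl fun i hi => ?_
  have : q - 1 - i < q := by have := Finset.mem_range.1 hi; omega
  rw [sub_pow_eq_sum this, Finset.smul_sum, Finset.sum_mul]
  refine Finset.sum_congr rfl fun e _ => ?_
  simp only [smul_smul, smul_mul_assoc]
  congr 1
  ring

/-- The degree bound for the translation holds for every t, so it holds for each coefficient of the
polynomial in t. -/
theorem translCoeff_mem_Pn (h : IsBlock N P u) {q n e : ℕ} (hq : q ≤ N) (he : e < q) {f : Sm k l}
    (hf : ∀ i, q ≤ i → P i f = 0) (hn : f ∈ Pn n) : translCoeff P N q e f ∈ Pn (n - (N - q)) := by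
  have h1 : ∀ t : ℝ, ∑ e ∈ Finset.range q,
      t ^ e • ((dD : Derivation ℝ (Sm k l) (Sm k l)) ^ (n - (N - q)) : Module.End ℝ (Sm k l))
        (translCoeff P N q e f) = 0 := fun t => by
    have := h.transl_mem_Pn hq t hf hn
    rw [transl_eq_sum, Pn, LinearMap.mem_ker, map_sum] at this
    simpa only [map_smul] using this
  exact eq_zero_of_forall_sum_pow_smul h1 he

/-- The binomial formula for (a + b)^d differentiated s times in a. -/
theorem sum_choose_descFactorial (a b : Sm k l) {d s : ℕ} (hs : s ≤ d) :
    ∑ r ∈ Finset.range (d + 1),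
      ((d.choose r * r.descFactorial s : ℕ) : ℝ) • (a ^ (r - s) * b ^ (d - r)) =
        (d.descFactorial s : ℝ) • (a + b) ^ (d - s) := by
  obtain ⟨n, rfl⟩ := Nat.exists_eq_add_of_le hs
  rw [add_assoc, Finset.sum_range_add, Finset.sum_eq_zero fun r hr => by
    rw [Nat.descFactorial_of_lt (Finset.mem_range.1 hr), mul_zero, Nat.cast_zero, zero_smul],
    zero_add, Nat.add_sub_cancel_left, add_pow, Finset.smul_sum]
  refine Finset.sum_congr rfl fun r hr => ?_
  have hr' : r ≤ n := by have := Finset.mem_range.1 hr; omega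
  rw [Nat.add_sub_cancel_left, Nat.add_sub_add_left, ← nsmul_eq_mul', ← Nat.cast_smul_eq_nsmul ℝ,
    smul_smul]
  congr 1
  have h2 : (s + n).choose (s + r) * (s + r).choose s = (s + n).choose s * n.choose r := by
    rw [Nat.choose_mul (by omega)]
    congr 2 <;> omega
  rw [Nat.descFactorial_eq_factorial_mul_choose, Nat.descFactorial_eq_factorial_mul_choose]
  exact_mod_cast (by rw [mul_left_comm, h2, mul_assoc] :
    (s + n).choose (s + r) * (s.factorial * (s + r).choose s) =
      s.factorial * (s + n).choose s * n.choose r)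

theorem P_gs (h : IsBlock N P u) {d i : ℕ} (hd : d < N) (hi : i ≤ d) (s : ℕ) :
    P i (gs u d (N - d) s) = gcoef N d s i • cx ^ (i - s) := by
  rw [gs_eq h.px_u hd, map_sum, Finset.sum_eq_single i]
  · rw [Derivation.leibniz, h.P_smul_cx_pow, h.P_u, if_pos ⟨rfl, by omega⟩, smul_zero, add_zero,
      smul_eq_mul, mul_one]
  · intro j _ hj
    rw [Derivation.leibniz, h.P_smul_cx_pow, h.P_u, if_neg fun h => hj h.1.symm, smul_zero,
      smul_zero, add_zero]
  · exact fun h => absurd (Finset.mem_range.2 (by omega)) h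

theorem P_gs_of_lt (h : IsBlock N P u) {d i : ℕ} (hd : d < N) (hi : d < i) (s : ℕ) :
    P i (gs u d (N - d) s) = 0 := by
  rw [gs_eq h.px_u hd, map_sum]
  refine Finset.sum_eq_zero fun j hj => ?_
  rw [Derivation.leibniz, h.P_smul_cx_pow, h.P_u, if_neg, smul_zero, smul_zero, add_zero]
  have := Finset.mem_range.1 hj
  omega

/-! ### Partial derivatives dual to the functions g^{(s)}. -/

/-- The value of `translCoeff` on the corresponding function `g_{d,N-d}^{(s)}`. -/
def dualConst (N d s : ℕ) : ℝ :=
  (N.factorial : ℝ)⁻¹ * ((N - 1).descFactorial d : ℝ) * (d.descFactorial s : ℝ)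

theorem dualConst_ne_zero {d s : ℕ} (hd : d < N) (hs : s ≤ d) : dualConst N d s ≠ 0 := by
  have h1 : 0 < (N - 1).descFactorial d := Nat.descFactorial_pos.2 (by omega)
  have h2 : 0 < d.descFactorial s := Nat.descFactorial_pos.2 hs
  unfold dualConst
  positivity

/-- After (x - t)^(d-i) is rewritten through (t - x)^(d-i), the sum is the differentiated binomial
expansion of (x + (t - x))^d, so x drops out. Different s give different powers of t, which is why
the coefficients in t are dual to the g^{(s)}. -/
theorem transl_gs (h : IsBlock N P u) {d s : ℕ} (hd : d < N) (hs : s ≤ d) (t : ℝ) :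
    transl P N (d + 1) t (gs u d (N - d) s) =
      algebraMap ℝ _ (dualConst N d s * t ^ (d - s)) := by
  have h1 : (algebraMap ℝ (Sm k l) t) ^ (d - s) = (cx + (algebraMap ℝ _ t - cx)) ^ (d - s) := by
    ring
  rw [map_mul, map_pow, h1, dualConst, map_mul, mul_assoc,
    ← Algebra.smul_def (d.descFactorial s : ℝ), ← sum_choose_descFactorial _ _ hs, transl,
    Finset.mul_sum]
  refine Finset.sum_congr rfl fun i hi => ?_
  have hi' : i ≤ d := by have := Finset.mem_range.1 hi; omega
  rw [h.P_gs hd hi', gcoef]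
  have h2 : ((N - 1).descFactorial d : ℝ) =
      ((N - d).ascFactorial (d - i) : ℝ) * ((N - 1).descFactorial i : ℝ) := by
    have h3 := Nat.descFactorial_mul_descFactorial (n := N - 1) hi'
    have h4 : (N - d).ascFactorial (d - i) = (N - 1 - i).descFactorial (d - i) := by
      obtain ⟨m, hm⟩ : ∃ m, N - d = m + 1 := ⟨N - d - 1, by omega⟩
      rw [hm, ← Nat.add_descFactorial_eq_ascFactorial]
      congr 1
      omega
    rw [h4]
    exact_mod_cast h3.symm
  have h5 : (cx - algebraMap ℝ (Sm k l) t) ^ (d - i) =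
      ((-1 : ℝ) ^ (d - i)) • (algebraMap ℝ (Sm k l) t - cx) ^ (d - i) := by
    rw [← neg_sub, neg_pow, Algebra.smul_def, map_pow, map_neg, map_one]
  rw [← Algebra.smul_def, Nat.add_sub_cancel, h5, h2]
  simp only [smul_smul, smul_mul_assoc, mul_smul_comm]
  rw [mul_comm ((algebraMap ℝ (Sm k l) t - cx) ^ (d - i))]
  congr 1
  have h6 : ((-1 : ℝ) ^ (d - i)) * ((-1 : ℝ) ^ (d - i)) = 1 := by
    rw [← mul_pow]; simp
  push_cast
  linear_combination ((N - 1).descFactorial i : ℝ) * (N.factorial : ℝ)⁻¹ * (d.choose i : ℝ) *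
    ((N - d).ascFactorial (d - i) : ℝ) * (i.descFactorial s : ℝ) * h6

theorem translCoeff_gs (h : IsBlock N P u) {d s e : ℕ} (hd : d < N) (hs : s ≤ d) (he : e ≤ d) :
    translCoeff P N (d + 1) e (gs u d (N - d) s) =
      if e = d - s then algebraMap ℝ _ (dualConst N d s) else 0 := by
  rw [← sub_eq_zero]
  refine eq_zero_of_forall_sum_pow_smul (q := d + 1) (F := fun e =>
    translCoeff P N (d + 1) e (gs u d (N - d) s) -
      if e = d - s then algebraMap ℝ _ (dualConst N d s) else 0) (fun t => ?_) (by omega)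
  simp only [smul_sub, Finset.sum_sub_distrib]
  rw [← transl_eq_sum, h.transl_gs hd hs]
  simp only [smul_ite, smul_zero]
  rw [Finset.sum_ite_eq', if_pos (Finset.mem_range.2 (by omega)), Algebra.smul_def, ← map_mul,
    mul_comm, sub_self]

variable (P) in
/-- The partial derivative with respect to the variable `g_{d,N-d}^{(s)}`. -/
def dual (N d s : ℕ) (f : Sm k l) : Sm k l :=
  (dualConst N d s)⁻¹ • translCoeff P N (d + 1) (d - s) f

theorem dual_mem_Pn (h : IsBlock N P u) {d n : ℕ} (hd : d < N) (s : ℕ) {f : Sm k l}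
    (hf : ∀ i, d + 1 ≤ i → P i f = 0) (hn : f ∈ Pn n) :
    dual P N d s f ∈ Pn (n - (N - (d + 1))) :=
  Submodule.smul_mem _ _ (h.translCoeff_mem_Pn hd (by omega) hf hn)

theorem dual_gs (h : IsBlock N P u) {d s s' : ℕ} (hd : d < N) (hs : s ≤ d) (hs' : s' ≤ d) :
    dual P N d s (gs u d (N - d) s') = if s = s' then 1 else 0 := by
  rw [dual, h.translCoeff_gs hd hs' (by omega)]
  by_cases h1 : s = s'
  · subst h1
    rw [if_pos rfl, if_pos rfl, Algebra.algebraMap_eq_smul_one, smul_smul,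
      inv_mul_cancel₀ (dualConst_ne_zero hd hs), one_smul]
  · rw [if_neg h1, if_neg (by omega), smul_zero]

/-- The coefficients of `dual`. -/
def dualCoeff (N d s i : ℕ) : Sm k l :=
  ((dualConst N d s)⁻¹ * (((N - 1).descFactorial i : ℝ) *
    ((-1) ^ (d - s) * ((d - i).choose (d - s) : ℝ)))) • cx ^ (d - i - (d - s))

theorem dual_eq (d s : ℕ) (f : Sm k l) :
    dual P N d s f = ∑ i ∈ Finset.range (d + 1), dualCoeff N d s i * P i f := by
  rw [dual, translCoeff, Finset.smul_sum]
  refine Finset.sum_congr rfl fun i _ => ?_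
  rw [dualCoeff, Nat.add_sub_cancel, smul_smul, smul_mul_assoc]

/-- The Euler field in the variables `g_{d,N-d}^{(s)}`. -/
theorem sum_gs_mul_dual (h : IsBlock N P u) {d : ℕ} (hd : d < N) (f : Sm k l) :
    ∑ s ∈ Finset.range (d + 1), gs u d (N - d) s * dual P N d s f =
      ∑ i ∈ Finset.range (d + 1), u i * P i f := by
  let G : Matrix (Fin (d + 1)) (Fin (d + 1)) (Sm k l) :=
    fun s r => gcoef N d s r • cx ^ ((r : ℕ) - s)
  let U : Matrix (Fin (d + 1)) (Fin (d + 1)) (Sm k l) := fun r s => dualCoeff N d s r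
  have h1 : G * U = 1 := by
    ext s s'
    have h2 := h.dual_gs hd (s := s') (s' := s) (by omega) (by omega)
    rw [Matrix.mul_apply, Matrix.one_apply]
    rw [dual_eq, Finset.sum_range] at h2
    simp only [Fin.ext_iff, eq_comm (a := (s : ℕ))]
    rw [← h2]
    refine Finset.sum_congr rfl fun r _ => ?_
    rw [h.P_gs hd (by omega), mul_comm]
  -- Duality makes U a right inverse of the coefficient matrix G; over a commutative ring it is also
  -- a left inverse, which is the identity needed for the Euler field.
  have h3 : U * G = 1 := mul_eq_one_comm.1 h1
  have h4 : ∀ s : Fin (d + 1), gs u d (N - d) s * dual P N d s f =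
      ∑ r : Fin (d + 1), ∑ i : Fin (d + 1), (U i s * G s r) * (u r * P i f) := fun s => by
    rw [gs_eq h.px_u hd, dual_eq, Finset.sum_range, Finset.sum_range, Finset.sum_mul_sum]
    refine Finset.sum_congr rfl fun r _ => Finset.sum_congr rfl fun i _ => ?_
    change (G s r * u r) * (U i s * P i f) = _
    ring
  rw [Finset.sum_range, Finset.sum_range, Finset.sum_congr rfl fun s _ => h4 s, Finset.sum_comm]
  refine Finset.sum_congr rfl fun r _ => ?_
  rw [Finset.sum_comm]
  have h5 : ∀ i : Fin (d + 1), ∑ s : Fin (d + 1), (U i s * G s r) * (u r * P i f) =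
      (1 : Matrix (Fin (d + 1)) (Fin (d + 1)) (Sm k l)) i r * (u r * P i f) := fun i => by
    rw [← h3, Matrix.mul_apply, Finset.sum_mul]
  rw [Finset.sum_congr rfl fun i _ => h5 i, Finset.sum_eq_single r]
  · rw [Matrix.one_apply_eq, one_mul]
  · intro i _ hi
    rw [Matrix.one_apply_ne hi, zero_mul]
  · exact fun h => absurd (Finset.mem_univ r) h

/-- D is linear along the u-fibres, so it commutes with their scaling. -/
theorem euler_dD (h : IsBlock N P u) (f : Sm k l) :
    ∑ i ∈ Finset.range N, u i * P i (dD f) = dD (∑ i ∈ Finset.range N, u i * P i f) := by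
  rcases N with _ | M
  · simp
  rw [Finset.sum_range_succ', h.P_zero_dD, Finset.sum_congr rfl fun i hi => by
      rw [h.P_succ_dD i (by have := Finset.mem_range.1 hi; omega)], map_sum]
  simp only [Derivation.leibniz, smul_eq_mul, h.dD_u, Finset.sum_add_distrib, mul_add]
  rw [Finset.sum_range_succ' (fun i => u i * dD (P i f)),
    Finset.sum_range_succ (fun i => P i f * u (i + 1)), h.u_of_le (M + 1) le_rfl, mul_zero,
    add_zero, Finset.sum_congr rfl fun i _ => mul_comm (P i f) (u (i + 1))]
  abel

theorem euler_iterate (h : IsBlock N P u) (n : ℕ) (f : Sm k l) :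
    ∑ i ∈ Finset.range N, u i * P i (dD^[n] f) =
      dD^[n] (∑ i ∈ Finset.range N, u i * P i f) := by
  induction n with
  | zero => rfl
  | succ n ih => rw [Function.iterate_succ_apply', Function.iterate_succ_apply', h.euler_dD, ih]

theorem euler_gs (h : IsBlock N P u) {d : ℕ} (hd : d < N) (s : ℕ) :
    ∑ i ∈ Finset.range N, u i * P i (gs u d (N - d) s) = gs u d (N - d) s := by
  have h1 : Finset.range (d + 1) ⊆ Finset.range N := Finset.range_subset_range.2 hd
  rw [← Finset.sum_subset h1 fun i _ hi => by
    rw [h.P_gs_of_lt hd (by have := Finset.mem_range.not.1 hi; omega), mul_zero]]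
  conv_rhs => rw [gs_eq h.px_u hd]
  refine Finset.sum_congr rfl fun i hi => ?_
  rw [h.P_gs hd (by have := Finset.mem_range.1 hi; omega), mul_comm]

/-- The full translation of g^{(s)} is a constant times (x - t)^(N-d-1), so that of f = D^{N-d}
g^{(s)} vanishes for all t. Then all dual derivatives of f vanish, and so does its Euler derivative.
But g^{(s)} is linear in u, so the Euler derivative of f is f itself. -/
theorem gs_mem_Pn (h : IsBlock N P u) {d s : ℕ} (hd : d < N) (hs : s ≤ d) :
    gs u d (N - d) s ∈ Pn (N - d) := by
  set f := dD^[N - d] (gs u d (N - d) s) with hf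
  have h1 : ∀ t : ℝ, transl P N N t f = 0 := fun t => by
    rw [hf, h.transl_iterate, transl_eq_pow_mul (q := d + 1) (by omega) t fun i hi =>
      h.P_gs_of_lt hd (by omega) s, h.transl_gs hd hs, mul_comm, ← Algebra.smul_def, ← mem_Pn]
    refine Submodule.smul_mem _ _ ?_
    have h2 : (cx : Sm k l) - algebraMap ℝ _ t ∈ Pn 2 :=
      sub_mem cx_mem_Pn (Pn_mono (by omega) (algebraMap_mem_Pn t))
    have h3 := pow_mem_Pn (a := 1) h2 (N - (d + 1))
    have h4 : (N - (d + 1)) * 1 + 1 = N - d := by omega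
    rwa [h4] at h3
  obtain ⟨M, rfl⟩ : ∃ M, N = M + 1 := ⟨N - 1, by omega⟩
  -- Here the dual derivatives are those of the complete block, d = N - 1, which together control
  -- every ∂_{u_i}.
  have h2 : ∀ s ∈ Finset.range (M + 1), gs u M (M + 1 - M) s * dual P (M + 1) M s f = 0 :=
    fun s _ => by
      rw [dual, eq_zero_of_forall_sum_pow_smul (q := M + 1)
        (F := fun e => translCoeff P (M + 1) (M + 1) e f)
        (fun t => by rw [← transl_eq_sum, h1]) (show M - s < M + 1 by omega), smul_zero, mul_zero]
  have h3 := h.sum_gs_mul_dual (Nat.lt_succ_self M) f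
  rw [Finset.sum_eq_zero h2, hf, h.euler_iterate, h.euler_gs hd] at h3
  exact mem_Pn.2 h3.symm

end IsBlock

/-! ### Functions with `D^n f = 0` of jet variables of bounded order -/

theorem gs_cy_mem_Fn {d p : ℕ} (hd : d < k) (hp : d < p) (q s : ℕ) :
    (gs cy d (k - d) s : Sm k l) ∈ Fn p q := by
  rw [gs_eq px_cy hd]
  refine sum_mem fun r hr => mul_mem (Subalgebra.smul_mem _ (pow_mem (cx_mem_Fn p q) _) _)
    (cy_mem_Fn ?_ q)
  have := Finset.mem_range.1 hr
  omega

theorem gs_cz_mem_Fn {d q : ℕ} (hd : d < l) (p : ℕ) (hq : d < q) (s : ℕ) :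
    (gs cz d (l - d) s : Sm k l) ∈ Fn p q := by
  rw [gs_eq px_cz hd]
  refine sum_mem fun r hr => mul_mem (Subalgebra.smul_mem _ (pow_mem (cx_mem_Fn p q) _) _)
    (cz_mem_Fn p ?_)
  have := Finset.mem_range.1 hr
  omega

theorem dualCoeff_mem_Fn (N d s i p q : ℕ) : (IsBlock.dualCoeff N d s i : Sm k l) ∈ Fn p q :=
  Subalgebra.smul_mem _ (pow_mem (cx_mem_Fn p q) _) _

theorem dual_pY_mem_Fn {p q d s : ℕ} {f : Sm k l} (hf : f ∈ Fn p q) :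
    IsBlock.dual pY k d s f ∈ Fn p q := by
  rw [IsBlock.dual_eq]
  exact sum_mem fun i _ => mul_mem (dualCoeff_mem_Fn _ _ _ _ _ _) (dc_mem_Fn _ hf)

theorem dual_pZ_mem_Fn {p q d s : ℕ} {f : Sm k l} (hf : f ∈ Fn p q) :
    IsBlock.dual pZ l d s f ∈ Fn p q := by
  rw [IsBlock.dual_eq]
  exact sum_mem fun i _ => mul_mem (dualCoeff_mem_Fn _ _ _ _ _ _) (dc_mem_Fn _ hf)

/-! ### The Euler field and the classification of the solutions of D^n f = 0. -/

/-- The Euler field of the fibres. -/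
def euler : Derivation ℝ (Sm k l) (Sm k l) :=
  ∑ i ∈ Finset.range k, (cy i : Sm k l) • pY i + ∑ j ∈ Finset.range l, (cz j : Sm k l) • pZ j

theorem euler_apply (f : Sm k l) :
    euler f = ∑ i ∈ Finset.range k, cy i * pY i f + ∑ j ∈ Finset.range l, cz j * pZ j f := by
  have h : ∀ (s : Finset ℕ) (F : ℕ → Derivation ℝ (Sm k l) (Sm k l)),
      (∑ i ∈ s, F i) f = ∑ i ∈ s, F i f := fun s F => by
    rw [← Derivation.coeFnAddMonoidHom_apply, map_sum, Finset.sum_apply]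
    rfl
  rw [euler, Derivation.add_apply, h, h]
  rfl

/-- The functions that serve as coordinates along the fibres. -/
def wv (p q : ℕ) : Fin p ⊕ Fin q → Sm k l :=
  Sum.elim (fun s => gs cy (p - 1) (k - (p - 1)) s) fun s => gs cz (q - 1) (l - (q - 1)) s

/-- The degree of `wv` along the integral curves of `D`. -/
def wt (k l p q : ℕ) : Fin p ⊕ Fin q → ℕ := Sum.elim (fun _ => k - p) fun _ => l - q

/-- The partial derivative with respect to `wv`. -/
def wd (p q : ℕ) (σ : Fin p ⊕ Fin q) (f : Sm k l) : Sm k l :=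
  Sum.elim (fun s : Fin p => IsBlock.dual pY k (p - 1) s f)
    (fun s : Fin q => IsBlock.dual pZ l (q - 1) s f) σ

/-- The monomials in `x` and `wv` of degree less than `n` along the integral curves of `D`. -/
def mon (p q n : ℕ) : Set (Sm k l) :=
  {f | ∃ (i j : ℕ) (σ : Fin j → Fin p ⊕ Fin q), i + ∑ t, wt k l p q (σ t) < n ∧
    f = cx ^ i * ∏ t, wv p q (σ t)}

/-- The elements of `mon` that are not powers of `x`. -/
def monPos (p q n : ℕ) : Set (Sm k l) :=
  {f | ∃ (i j : ℕ) (σ : Fin (j + 1) → Fin p ⊕ Fin q), i + ∑ t, wt k l p q (σ t) < n ∧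
    f = cx ^ i * ∏ t, wv p q (σ t)}

variable {p q : ℕ}

theorem wv_mem_Fn (hp : p < k) (hq : q < l) (σ : Fin p ⊕ Fin q) :
    (wv p q σ : Sm k l) ∈ Fn p q := by
  rcases σ with s | s <;> have hs := s.2
  · exact gs_cy_mem_Fn (by omega) (by omega) _ _
  · exact gs_cz_mem_Fn (by omega) _ (by omega) _

theorem wv_mem_Pn (hp : p < k) (hq : q < l) (σ : Fin p ⊕ Fin q) :
    (wv p q σ : Sm k l) ∈ Pn (wt k l p q σ + 1) := by
  rcases σ with s | s <;> have hs := s.2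
  · have h := (isBlockY (k := k) (l := l)).gs_mem_Pn (d := p - 1) (s := s) (by omega) (by omega)
    have h1 : k - (p - 1) = k - p + 1 := by omega
    exact (congrArg (fun n => gs cy (p - 1) (k - (p - 1)) s ∈ Pn (k := k) (l := l) n) h1).mp h
  · have h := (isBlockZ (k := k) (l := l)).gs_mem_Pn (d := q - 1) (s := s) (by omega) (by omega)
    have h1 : l - (q - 1) = l - q + 1 := by omega
    exact (congrArg (fun n => gs cz (q - 1) (l - (q - 1)) s ∈ Pn (k := k) (l := l) n) h1).mp h

theorem euler_cx : euler (cx : Sm k l) = 0 := by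
  rw [euler_apply]
  simp

theorem euler_wv (hp : p < k) (hq : q < l) (σ : Fin p ⊕ Fin q) :
    euler (wv p q σ : Sm k l) = wv p q σ := by
  rw [euler_apply]
  rcases σ with s | s <;> have hs := s.2
  · rw [Finset.sum_eq_zero (s := Finset.range l) fun j _ => by
      rw [wv, Sum.elim_inl, (gs_cy_mem_Fn (by omega) (show p - 1 < p by omega) 0 s).2 j
        (Nat.zero_le j), mul_zero], add_zero]
    exact isBlockY.euler_gs (by omega) _
  · rw [Finset.sum_eq_zero (s := Finset.range k) fun j _ => by
      rw [wv, Sum.elim_inr, (gs_cz_mem_Fn (by omega) 0 (show q - 1 < q by omega) s).1 j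
        (Nat.zero_le j), mul_zero], zero_add]
    exact isBlockZ.euler_gs (by omega) _

theorem euler_prod (hp : p < k) (hq : q < l) {j : ℕ} (σ : Fin j → Fin p ⊕ Fin q) :
    euler (∏ t, wv p q (σ t) : Sm k l) = (j : ℝ) • ∏ t, wv p q (σ t) := by
  induction j with
  | zero => simp
  | succ j ih =>
    rw [Fin.prod_univ_succ, Derivation.leibniz, ih, euler_wv hp hq]
    push_cast
    simp only [smul_eq_mul, Algebra.smul_def, map_add, map_one]
    ring

theorem euler_mon (hp : p < k) (hq : q < l) {j : ℕ} (i : ℕ) (σ : Fin j → Fin p ⊕ Fin q) :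
    euler (cx ^ i * ∏ t, wv p q (σ t) : Sm k l) = (j : ℝ) • (cx ^ i * ∏ t, wv p q (σ t)) := by
  rw [Derivation.leibniz, euler_prod hp hq, Derivation.leibniz_pow, euler_cx, smul_zero, smul_zero,
    smul_zero, add_zero, smul_eq_mul, mul_smul_comm]

theorem euler_eq_sum (hp : p < k) (hq : q < l) {f : Sm k l} (hf : f ∈ Fn p q) :
    euler f = ∑ σ, wv p q σ * wd p q σ f := by
  rw [euler_apply, Fintype.sum_sum_type]
  congr 1
  · rw [← Finset.sum_subset (Finset.range_subset_range.2 hp.le) fun i _ hi => by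
      rw [hf.1 i (by have := Finset.mem_range.not.1 hi; omega), mul_zero]]
    rcases p with _ | d
    · simp
    · rw [← isBlockY.sum_gs_mul_dual (by omega), Finset.sum_range]
      rfl
  · rw [← Finset.sum_subset (Finset.range_subset_range.2 hq.le) fun i _ hi => by
      rw [hf.2 i (by have := Finset.mem_range.not.1 hi; omega), mul_zero]]
    rcases q with _ | d
    · simp
    · rw [← isBlockZ.sum_gs_mul_dual (by omega), Finset.sum_range]
      rfl

theorem wd_mem_Fn {f : Sm k l} (hf : f ∈ Fn p q) (σ : Fin p ⊕ Fin q) : wd p q σ f ∈ Fn p q := by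
  rcases σ with s | s
  · exact dual_pY_mem_Fn hf
  · exact dual_pZ_mem_Fn hf

/-- Differentiation by a fibre coordinate lowers the degree by the full weight of that coordinate;
this drives the induction in `mem_span_mon`. -/
theorem wd_mem_Pn (hp : p < k) (hq : q < l) {n : ℕ} {f : Sm k l} (hf : f ∈ Fn p q)
    (hn : f ∈ Pn n) (σ : Fin p ⊕ Fin q) : wd p q σ f ∈ Pn (n - wt k l p q σ) := by
  rcases σ with s | s
  · obtain ⟨d, rfl⟩ : ∃ d, p = d + 1 := ⟨p - 1, by have := s.2; omega⟩
    exact isBlockY.dual_mem_Pn (d := d) (by omega) s (fun i hi => hf.1 i hi) hn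
  · obtain ⟨d, rfl⟩ : ∃ d, q = d + 1 := ⟨q - 1, by have := s.2; omega⟩
    exact isBlockZ.dual_mem_Pn (d := d) (by omega) s (fun i hi => hf.2 i hi) hn

theorem span_mon_le (hp : p < k) (hq : q < l) (n : ℕ) :
    Submodule.span ℝ (mon p q n : Set (Sm k l)) ≤ Pn n := by
  refine Submodule.span_le.2 ?_
  rintro _ ⟨i, j, σ, h, rfl⟩
  refine Pn_mono (m := i + ∑ t, wt k l p q (σ t) + 1) h (mul_mem_Pn (cx_pow_mem_Pn i) ?_)
  clear h
  induction j with
  | zero => simpa using one_mem_Pn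
  | succ j ih =>
    rw [Fin.prod_univ_succ, Fin.sum_univ_succ]
    exact mul_mem_Pn (wv_mem_Pn hp hq _) (ih _)

theorem mon_mem_Fn (hp : p < k) (hq : q < l) {n : ℕ} {f : Sm k l} (hf : f ∈ mon p q n) :
    f ∈ Fn p q := by
  obtain ⟨i, j, σ, -, rfl⟩ := hf
  exact mul_mem (pow_mem (cx_mem_Fn _ _) _) (prod_mem fun t _ => wv_mem_Fn hp hq _)

theorem wv_mul_mem {n : ℕ} {f : Sm k l} (σ : Fin p ⊕ Fin q)
    (hf : f ∈ Submodule.span ℝ (mon p q (n - wt k l p q σ) : Set (Sm k l))) :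
    wv p q σ * f ∈ Submodule.span ℝ (monPos p q n : Set (Sm k l)) := by
  induction hf using Submodule.span_induction with
  | mem f hf =>
    obtain ⟨i, j, τ, h, rfl⟩ := hf
    refine Submodule.subset_span ⟨i, j, Fin.cons σ τ, ?_, ?_⟩
    · rw [Fin.sum_univ_succ]
      simp only [Fin.cons_zero, Fin.cons_succ]
      omega
    · rw [Fin.prod_univ_succ]
      simp only [Fin.cons_zero, Fin.cons_succ]
      ring
  | zero => rw [mul_zero]; exact zero_mem _
  | add f g _ _ hf hg => rw [mul_add]; exact add_mem hf hg
  | smul c f _ hf => rw [mul_smul_comm]; exact Submodule.smul_mem _ _ hf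

/-- The Euler field is diagonal on monomials, with the number of factors `wv` as eigenvalue; in
`monPos` this is positive. -/
theorem exists_euler_eq (hp : p < k) (hq : q < l) {n : ℕ} {f : Sm k l}
    (hf : f ∈ Submodule.span ℝ (monPos p q n : Set (Sm k l))) :
    ∃ g ∈ Submodule.span ℝ (mon p q n : Set (Sm k l)), euler g = f := by
  induction hf using Submodule.span_induction with
  | mem f hf =>
    obtain ⟨i, j, σ, h, rfl⟩ := hf
    refine ⟨((j + 1 : ℕ) : ℝ)⁻¹ • (cx ^ i * ∏ t, wv p q (σ t)),
      Submodule.smul_mem _ _ (Submodule.subset_span ⟨i, j + 1, σ, h, rfl⟩), ?_⟩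
    rw [Derivation.map_smul, euler_mon hp hq, smul_smul, inv_mul_cancel₀ (by positivity), one_smul]
  | zero => exact ⟨0, zero_mem _, map_zero _⟩
  | add f f' _ _ hf hf' =>
    obtain ⟨g, hg, h⟩ := hf
    obtain ⟨g', hg', h'⟩ := hf'
    exact ⟨g + g', add_mem hg hg', by rw [map_add, h, h']⟩
  | smul c f _ hf =>
    obtain ⟨g, hg, h⟩ := hf
    exact ⟨c • g, Submodule.smul_mem _ _ hg, by rw [Derivation.map_smul, h]⟩

/-- The classification of the functions of jet variables of bounded order that are polynomials of
bounded degree along the integral curves of `D`. -/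
theorem mem_span_mon (hp : p < k) (hq : q < l) {n : ℕ} {f : Sm k l} (hf : f ∈ Fn p q)
    (hn : f ∈ Pn n) : f ∈ Submodule.span ℝ (mon p q n : Set (Sm k l)) := by
  induction n using Nat.strong_induction_on generalizing f with
  | _ n ih =>
    rcases n with _ | n
    · rw [mem_Pn_zero.1 hn]; exact zero_mem _
    -- The derivatives `wd p q σ f` fall under the induction hypothesis because all weights are
    -- positive, by p < k and q < l.
    have h1 : euler f ∈ Submodule.span ℝ (monPos p q (n + 1) : Set (Sm k l)) := by
      rw [euler_eq_sum hp hq hf]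
      refine sum_mem fun σ _ => wv_mul_mem σ (ih _ ?_ (wd_mem_Fn hf σ) (wd_mem_Pn hp hq hf hn σ))
      rcases σ with s | s
      · change n + 1 - (k - p) < n + 1; omega
      · change n + 1 - (l - q) < n + 1; omega
    obtain ⟨g, hg, hgf⟩ := exists_euler_eq hp hq h1
    -- The Euler field kills the difference, so this is a function of x alone, hence a polynomial of
    -- degree below the bound.
    have h2 : f - g ∈ Fn 0 0 := by
      refine mem_Fn_zero_of_euler_eq_zero ?_
      rw [← euler_apply, map_sub, hgf, sub_self]
    have h3 := mem_span_cx_pow h2 (sub_mem hn (span_mon_le hp hq _ hg))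
    rw [← sub_add_cancel f g]
    refine add_mem (Submodule.span_mono ?_ h3) hg
    rintro _ ⟨i, hi, rfl⟩
    exact ⟨i, 0, Fin.elim0, by simpa using hi, by simp⟩

/-! ### The contact condition -/

theorem pZ_mul_cz_of_ne {i j : ℕ} (h : i ≠ j) (f : Sm k l) :
    pZ i (cz j * f) = cz j * pZ i f := by
  rw [Derivation.leibniz, pZ_cz, if_neg fun h' => h h'.1, smul_zero, add_zero, smul_eq_mul]

theorem pY_mul_cz (i j : ℕ) (f : Sm k l) : pY i (cz j * f) = cz j * pY i f := by
  rw [Derivation.leibniz, pY_cz, smul_zero, add_zero, smul_eq_mul]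

/-- Descending induction on i, starting from i = d + 1 where both sides vanish. Applying ∂_{z_{i+1}}
to c_{j+1} = D c_j - z_{j+1} D a and commuting it past D yields the identity for ∂_{z_i}. -/
theorem pZ_eq_of_pcoeff_mem {d : ℕ} (hd : d + 1 < l) {a c : Sm k l} (ha : a ∈ Fn 1 (d + 1))
    (hc : ∀ j ≤ d, j < l → pcoeff cz a c j ∈ Fn 1 (d + 1)) {i : ℕ} (hi : 1 ≤ i) :
    pZ i c = cz 1 * pZ i a := by
  have key : ∀ e i : ℕ, i + e = d + 1 → ∀ j < i,
      pZ i (pcoeff cz a c j) = cz (j + 1) * pZ i a := by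
    intro e
    induction e with
    | zero =>
      intro i hi j hj
      rw [(hc j (by omega) (by omega)).2 i (by omega), ha.2 i (by omega), mul_zero]
    | succ e ih =>
      intro i hi j hj
      have h1 := ih (i + 1) (by omega) (j + 1) (by omega)
      rw [pcoeff, map_sub, pZ_succ_dD (by omega), pZ_mul_cz_of_ne (by omega),
        pZ_succ_dD (by omega), ih (i + 1) (by omega) j (by omega), Derivation.leibniz, dD_cz,
        smul_eq_mul, smul_eq_mul] at h1
      linear_combination h1
  by_cases h : i ≤ d + 1
  · exact key (d + 1 - i) i (by omega) 0 (by omega)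
  · rw [ha.2 i (by omega), show pZ i c = 0 from (hc 0 (by omega) (by omega)).2 i (by omega), mul_zero]

/-- For d ≥ 1 the coefficient c_1 = D c - z_1 D a must not involve y_1, and its y_1-derivative is
∂_{y_0} c - z_1 ∂_{y_0} a. -/
theorem pY_eq_of_pcoeff_mem {d : ℕ} (hk : 2 ≤ k) (hd : d + 1 < l) (hd0 : 1 ≤ d) {a c : Sm k l}
    (ha : a ∈ Fn 1 (d + 1)) (hc : ∀ j ≤ d, j < l → pcoeff cz a c j ∈ Fn 1 (d + 1)) (i : ℕ) :
    pY i c = cz 1 * pY i a := by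
  have hc0 : c ∈ Fn 1 (d + 1) := hc 0 (by omega) (by omega)
  rcases i with _ | i
  · have h1 := (hc 1 hd0 (by omega)).1 1 le_rfl
    rw [pcoeff, pcoeff, map_sub, pY_mul_cz, pY_succ_dD (by omega), pY_succ_dD (by omega),
      ha.1 1 le_rfl, hc0.1 1 le_rfl] at h1
    simp only [map_zero, zero_add] at h1
    exact sub_eq_zero.1 h1
  · rw [ha.1 _ (by omega), hc0.1 _ (by omega), mul_zero]

/-- The contact Hamiltonian of a symbol. -/
def hamil (a c : Sm k l) : Sm k l := c - cz 1 * a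

/-- Thus a, and with it c, is recovered from the Hamiltonian. -/
theorem pZ_hamil {d : ℕ} (hd : d + 1 < l) {a c : Sm k l} (ha : a ∈ Fn 1 (d + 1))
    (hc : ∀ j ≤ d, j < l → pcoeff cz a c j ∈ Fn 1 (d + 1)) {i : ℕ} (hi : 1 ≤ i) :
    pZ i (hamil a c) = if i = 1 then -a else 0 := by
  rw [hamil, map_sub, Derivation.leibniz, pZ_eq_of_pcoeff_mem hd ha hc hi, pZ_cz]
  by_cases h : i = 1
  · rw [if_pos h, if_pos ⟨h, by omega⟩, smul_eq_mul, smul_eq_mul]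
    ring
  · rw [if_neg h, if_neg fun h' => h h'.1, smul_eq_mul]
    simp

theorem hamil_mem_Fn {d : ℕ} (hk : 2 ≤ k) (hd : d + 1 < l) (hd0 : 1 ≤ d) {a c : Sm k l}
    (ha : a ∈ Fn 1 (d + 1)) (hc : ∀ j ≤ d, j < l → pcoeff cz a c j ∈ Fn 1 (d + 1)) :
    hamil a c ∈ Fn 0 2 := by
  refine ⟨fun i _ => ?_, fun i hi => ?_⟩
  · rw [hamil, map_sub, pY_mul_cz, pY_eq_of_pcoeff_mem hk hd hd0 ha hc, sub_self]
  · rw [pZ_hamil hd ha hc (by omega), if_neg (by omega)]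

/-! ### Hamiltonians of first order -/

theorem gs_one_zero {u : ℕ → Sm k l} (hu : ∀ i, px (u i) = 0) {N : ℕ} (hN : 1 < N) :
    gs u 1 (N - 1) 0 = (N.factorial : ℝ)⁻¹ • (cx * u 1 - ((N : ℝ) - 1) • u 0) := by
  have h : ((N - 1 : ℕ) : ℝ) = N - 1 := by push_cast [hN.le]; ring
  rw [gs_eq hu hN, Finset.sum_range_succ, Finset.sum_range_one, gcoef, gcoef]
  simp only [Nat.sub_zero, pow_one, Nat.choose_zero_right, Nat.cast_one, mul_one, Nat.sub_self,
    Nat.ascFactorial_succ, Nat.ascFactorial_zero, add_zero, h, Nat.descFactorial_zero, pow_zero,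
    Nat.choose_self]
  simp only [Algebra.smul_def, map_mul, map_sub, map_neg, map_one, map_natCast]
  ring

theorem gs_one_one {u : ℕ → Sm k l} (hu : ∀ i, px (u i) = 0) {N : ℕ} (hN : 1 < N) :
    gs u 1 (N - 1) 1 = (N.factorial : ℝ)⁻¹ • u 1 := by
  rw [gs_eq hu hN, Finset.sum_range_succ, Finset.sum_range_one, gcoef, gcoef]
  simp

theorem gs_zero_zero {u : ℕ → Sm k l} (hu : ∀ i, px (u i) = 0) {N : ℕ} (hN : 0 < N) :
    gs u 0 (N - 0) 0 = (N.factorial : ℝ)⁻¹ • u 0 := by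
  rw [gs_eq hu hN, Finset.sum_range_one, gcoef]
  simp

theorem linear_mem_Pn {N : ℕ} {P : ℕ → Derivation ℝ (Sm k l) (Sm k l)} {u : ℕ → Sm k l}
    (h : IsBlock N P u) (hN : 1 < N) : cx * u 1 - ((N : ℝ) - 1) • u 0 ∈ Pn (N - 1) := by
  have h1 := h.gs_mem_Pn hN (Nat.zero_le 1)
  rw [gs_one_zero h.px_u hN] at h1
  have h2 := Submodule.smul_mem _ (N.factorial : ℝ) h1
  rwa [smul_smul, mul_inv_cancel₀ (by positivity), one_smul] at h2

/-- The linear function `x z_1 - (l - 1) z_0`. -/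
def lu : Sm k l := cx * cz 1 - ((l : ℝ) - 1) • cz 0

/-- The Hamiltonians of the projective symmetries of `z_l = 0`. -/
def projHam (k l : ℕ) : Set (Sm k l) :=
  {f | ∃ i < l, f = cx ^ i} ∪ {cz 1, cx * cz 1, lu, cx * lu}

theorem wv_eq_smul (hl : 2 < l) (σ : Fin 0 ⊕ Fin 2) :
    ∃ r : ℝ, (wv 0 2 σ : Sm k l) = r • lu ∨ (wv 0 2 σ : Sm k l) = r • cz 1 := by
  rcases σ with s | s
  · exact s.elim0
  · refine ⟨(l.factorial : ℝ)⁻¹, ?_⟩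
    fin_cases s
    · exact Or.inl (gs_one_zero px_cz (by omega))
    · exact Or.inr (gs_one_one px_cz (by omega))

theorem sum_wt (j : ℕ) (σ : Fin j → Fin 0 ⊕ Fin 2) : ∑ t, wt k l 0 2 (σ t) = j * (l - 2) := by
  rw [Finset.sum_congr rfl fun t _ => ?_, Finset.sum_const, Finset.card_univ, Fintype.card_fin,
    smul_eq_mul]
  generalize σ t = s
  rcases s with s | s
  · exact s.elim0
  · rfl

/-- A factor `lu` or z_1 uses weight l - 2 of the available l - 1, so at most one power of x can
accompany it. -/
theorem mem_span_projHam_of_wt {i j : ℕ} (hl : 2 < l) (hj : j ≤ 1) {σ : Fin j → Fin 0 ⊕ Fin 2}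
    (h : i + ∑ t, wt k l 0 2 (σ t) < l) :
    (cx ^ i * ∏ t, wv 0 2 (σ t) : Sm k l) ∈ Submodule.span ℝ (projHam k l) := by
  rw [sum_wt] at h
  interval_cases j
  · rw [Finset.univ_eq_empty, Finset.prod_empty, mul_one]
    exact Submodule.subset_span (Or.inl ⟨i, by omega, rfl⟩)
  · have hi : i ≤ 1 := by omega
    rw [Fin.prod_univ_one]
    obtain ⟨r, hr | hr⟩ := wv_eq_smul (k := k) hl (σ 0) <;> rw [hr, mul_smul_comm] <;>
      refine Submodule.smul_mem _ _ (Submodule.subset_span (Or.inr ?_)) <;>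
      interval_cases i <;> simp

/-- Two factors would have weight 2(l - 2) ≥ l, which is too much. -/
theorem mem_span_projHam (hk : 0 < k) (hl : 4 ≤ l) {f : Sm k l} (hf : f ∈ Fn 0 2)
    (hn : f ∈ Pn l) : f ∈ Submodule.span ℝ (projHam k l) := by
  have h := mem_span_mon hk (show 2 < l by omega) hf hn
  refine Submodule.span_le.2 ?_ h
  rintro _ ⟨i, j, σ, h, rfl⟩
  refine mem_span_projHam_of_wt (by omega) ?_ h
  rw [sum_wt] at h
  by_contra hj
  have : 2 * (l - 2) ≤ j * (l - 2) := Nat.mul_le_mul_right _ (by omega)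
  omega

/-- The Hamiltonians of the contact symmetries of `z_3 = 0`. -/
def contHam (k : ℕ) : Set (Sm k 3) :=
  projHam k 3 ∪ {lu * lu, lu * cz 1, cz 1 * cz 1}

/-- For l = 3 the weights are 1 and the bound is 2, so exactly the pure products of two linear
factors are added. -/
theorem mem_span_contHam (hk : 0 < k) {f : Sm k 3} (hf : f ∈ Fn 0 2) (hn : f ∈ Pn 3) :
    f ∈ Submodule.span ℝ (contHam k) := by
  have h := mem_span_mon hk (show 2 < 3 by omega) hf hn
  refine Submodule.span_le.2 ?_ h
  rintro _ ⟨i, j, σ, h, rfl⟩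
  by_cases hj : j ≤ 1
  · exact Submodule.span_mono (Set.subset_union_left) (mem_span_projHam_of_wt (by omega) hj h)
  · rw [sum_wt] at h
    obtain ⟨rfl, rfl⟩ : i = 0 ∧ j = 2 := by omega
    rw [Fin.prod_univ_two, pow_zero, one_mul]
    obtain ⟨r, hr | hr⟩ := wv_eq_smul (k := k) (l := 3) (by omega) (σ 0) <;>
    obtain ⟨r', hr' | hr'⟩ := wv_eq_smul (k := k) (l := 3) (by omega) (σ 1) <;>
      rw [hr, hr', mul_smul_comm, smul_mul_assoc] <;>
      refine Submodule.smul_mem _ _ (Submodule.smul_mem _ _ (Submodule.subset_span (Or.inr ?_))) <;>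
      simp [mul_comm]

theorem pZ_one_lu (hl : 1 < l) : pZ 1 (lu : Sm k l) = cx := by
  rw [lu, map_sub, Derivation.leibniz, pZ_cx, Derivation.map_smul, pZ_cz, pZ_cz, if_pos ⟨rfl, hl⟩,
    if_neg (by omega)]
  simp

theorem pZ_one_cz_one (hl : 1 < l) : pZ 1 (cz 1 : Sm k l) = 1 := by
  rw [pZ_cz, if_pos ⟨rfl, hl⟩]

theorem pZ_pZ_projHam (hl : 1 < l) {f : Sm k l} (hf : f ∈ Submodule.span ℝ (projHam k l)) :
    pZ 1 (pZ 1 f) = 0 := by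
  induction hf using Submodule.span_induction with
  | mem f hf =>
    rcases hf with ⟨i, -, rfl⟩ | rfl | rfl | rfl | rfl
    · rw [Derivation.leibniz_pow, pZ_cx]; simp
    · rw [pZ_one_cz_one hl]; simp
    · rw [Derivation.leibniz, pZ_one_cz_one hl]; simp
    · rw [pZ_one_lu hl]; simp
    · rw [Derivation.leibniz, pZ_one_lu hl]; simp
  | zero => simp
  | add f g _ _ hf hg => rw [map_add, map_add, hf, hg, add_zero]
  | smul c f _ hf => rw [Derivation.map_smul, Derivation.map_smul, hf, smul_zero]

/-- For l = 3 the quadratic part r `lu`² + s `lu` z_1 + t z_1² has second z_1-derivative 2(r x² + s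
x + t), so the hypothesis removes it. -/
theorem mem_span_projHam_of_pZ_pZ (hk : 0 < k) (hl : 3 ≤ l) {f : Sm k l} (hf : f ∈ Fn 0 2)
    (hn : f ∈ Pn l) (h : pZ 1 (pZ 1 f) = 0) : f ∈ Submodule.span ℝ (projHam k l) := by
  rcases hl.eq_or_lt with rfl | hl'
  · have h1 := mem_span_contHam hk hf hn
    rw [contHam, Submodule.span_union, Submodule.mem_sup] at h1
    obtain ⟨f₁, hf₁, f₂, hf₂, rfl⟩ := h1
    obtain ⟨r, s, t, rfl⟩ := Submodule.mem_span_triple.1 hf₂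
    rw [map_add, map_add, pZ_pZ_projHam (by omega) hf₁, zero_add] at h
    simp only [map_add, Derivation.map_smul, Derivation.leibniz, pZ_one_lu (show 1 < 3 by omega),
      pZ_one_cz_one (show 1 < 3 by omega), pZ_cx, smul_eq_mul, Derivation.map_one_eq_zero] at h
    have h2 : ∀ x : ℝ, r * x ^ 2 + s * x + t = 0 := fun x => by
      have := congrArg (fun g : Sm k 3 => g.1 (x, 0)) h
      simp only [Sm.add_val, Sm.smul_val, Sm.mul_val, cx_val, Sm.zero_val, Sm.one_val] at this
      linear_combination this / 2
    have ht := h2 0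
    have h3 := h2 1
    have h4 := h2 (-1)
    obtain rfl : t = 0 := by linarith
    obtain rfl : r = 0 := by linarith
    obtain rfl : s = 0 := by linarith
    simpa using hf₁
  · exact mem_span_projHam hk hl' hf hn

/-! ### Reduction to the coefficient at `∂_{y_0}` -/

/-- y_0 has weight k - 1 and every other factor weight at least 1, so below weight k the variable
y_0 occurs only by itself. -/
theorem mem_mon_one {q n : ℕ} (hk : 1 < k) (hq : q < l) (hn : n ≤ k) {f : Sm k l}
    (hf : f ∈ mon 1 q n) :
    (∃ r : ℝ, f = r • cy 0) ∨ ∃ (i j : ℕ) (s : Fin j → Fin q), i + (l - q) * j < n ∧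
      f = cx ^ i * ∏ t, gs cz (q - 1) (l - (q - 1)) (s t) := by
  obtain ⟨i, j, σ, h, rfl⟩ := hf
  by_cases hσ : ∃ t s, σ t = Sum.inl s
  · obtain ⟨t, s, ht⟩ := hσ
    have h1 := Finset.add_sum_erase Finset.univ (fun t => wt k l 1 q (σ t)) (Finset.mem_univ t)
    have h2 := Finset.card_nsmul_le_sum (Finset.univ.erase t) (fun t => wt k l 1 q (σ t)) 1
      fun t _ => by
        rcases σ t with s | s
        · change 1 ≤ k - 1; omega
        · change 1 ≤ l - q; omega
    rw [Finset.card_erase_of_mem (Finset.mem_univ t), Finset.card_univ, Fintype.card_fin,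
      smul_eq_mul, mul_one] at h2
    have h3 : wt k l 1 q (σ t) = k - 1 := by rw [ht]; rfl
    simp only [h3] at h1
    have hj := t.2
    obtain ⟨rfl, rfl⟩ : i = 0 ∧ j = 1 := by omega
    refine Or.inl ⟨(k.factorial : ℝ)⁻¹, ?_⟩
    obtain rfl : s = 0 := Subsingleton.elim _ _
    rw [Fin.prod_univ_one, pow_zero, one_mul, ← Subsingleton.elim t 0, ht,
      ← gs_zero_zero px_cy (by omega)]
    rfl
  · push Not at hσ
    have h1 : ∀ t, ∃ s, σ t = Sum.inr s := fun t => by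
      rcases h2 : σ t with s | s
      · exact absurd h2 (hσ t s)
      · exact ⟨s, rfl⟩
    choose s hs using h1
    refine Or.inr ⟨i, j, s, ?_, ?_⟩
    · rw [Finset.sum_congr rfl fun t _ => by rw [hs t]] at h
      simpa [wt, mul_comm] using h
    · congr 1
      exact Finset.prod_congr rfl fun t _ => by rw [hs t]; rfl

/-- The difference of two symmetries with the same a and c is (0, b - b', 0), and the only
conditions left on it are D^k = 0 and the bound on the jet order. So b' may be any convenient
choice. -/
theorem mem_span_of_mem_symTrip {d : ℕ} (hk : 1 < k) (hd : d + 1 < l) {T : Set (Trip k l)}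
    (hT : T ⊆ symTrip k l d) (hy : (0, cy 0, 0) ∈ T)
    (hg : ∀ (i j : ℕ) (s : Fin j → Fin (d + 1)), i + (l - (d + 1)) * j < k →
      ((0, cx ^ i * ∏ t, gs cz d (l - d) (s t), 0) : Trip k l) ∈ Submodule.span ℝ T)
    {a b b' c : Sm k l} (h : (a, b, c) ∈ symTrip k l d)
    (h' : (a, b', c) ∈ Submodule.span ℝ T) : (a, b, c) ∈ Submodule.span ℝ T := by
  have h1 := sub_mem h (Submodule.span_le.2 hT h')
  have h2 : ((0, b - b', 0) : Trip k l) ∈ Submodule.span ℝ T := by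
    rw [Prod.mk_sub_mk, Prod.mk_sub_mk, sub_self, sub_self,
      mem_symTrip_iff (by omega) (by omega)] at h1
    obtain ⟨h2, -, -, h3, -⟩ := h1
    rw [mul_zero, sub_zero, ← mem_Pn] at h2
    have h4 := mem_span_mon hk hd h3 h2
    let L : Sm k l →ₗ[ℝ] Trip k l := LinearMap.inr ℝ (Sm k l) (Sm k l × Sm k l) ∘ₗ
      LinearMap.inl ℝ (Sm k l) (Sm k l)
    have h5 : Submodule.span ℝ (mon 1 (d + 1) k) ≤ (Submodule.span ℝ T).comap L := by
      refine Submodule.span_le.2 fun f hf => ?_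
      rcases mem_mon_one hk hd le_rfl hf with ⟨r, rfl⟩ | ⟨i, j, s, hs, rfl⟩
      · change L (r • cy 0) ∈ Submodule.span ℝ T
        rw [map_smul]
        exact Submodule.smul_mem _ _ (Submodule.subset_span hy)
      · exact hg i j s hs
    exact h5 h4
  have h3 := add_mem h2 h'
  rwa [Prod.mk_add_mk, Prod.mk_add_mk, zero_add, zero_add, sub_add_cancel] at h3

/-- When a depends on x alone and c on x and z_0, the coefficient c_j involves only z_0, ..., z_j,
so the condition from F on the c_j is automatic. -/
theorem symm_of_proj {d : ℕ} (hk : 0 < k) (hl : 0 < l) {a b c : Sm k l} (ha : a ∈ Fn 0 0)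
    (hb : b ∈ Fn 1 (d + 1)) (hc : c ∈ Fn 0 1) (hby : b - cy 1 * a ∈ Pn k)
    (hcz : c - cz 1 * a ∈ Pn l) : (a, b, c) ∈ symTrip k l d := by
  rw [mem_symTrip_iff hk hl]
  refine ⟨mem_Pn.1 hby, mem_Pn.1 hcz, Fn_mono (by omega) (by omega) ha, hb, fun j hj _ => ?_⟩
  have : ∀ j, pcoeff cz a c j ∈ Fn 0 (j + 1) := fun j => by
    induction j with
    | zero => exact hc
    | succ j ih =>
      exact sub_mem (dD_mem_Fn (Or.inl rfl) (Or.inr le_rfl) ih)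
        (mul_mem (cz_mem_Fn _ (by omega)) (dD_mem_Fn (Or.inl rfl) (Or.inl rfl) ha))
  exact Fn_mono (by omega) (by omega) (this j)

/-- The linear function `x y_1 - (k - 1) y_0`. -/
def lv : Sm k l := cx * cy 1 - ((k : ℝ) - 1) • cy 0

theorem lv_mem_Pn (hk : 1 < k) : (lv : Sm k l) ∈ Pn (k - 1) := linear_mem_Pn isBlockY hk

theorem lu_mem_Pn (hl : 1 < l) : (lu : Sm k l) ∈ Pn (l - 1) := linear_mem_Pn isBlockZ hl

theorem mul_mem_Pn' {m n : ℕ} {f g : Sm k l} (hf : f ∈ Pn 2) (hg : g ∈ Pn m) (h : m + 1 = n)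
    (hm : 0 < m) : f * g ∈ Pn n := by
  obtain ⟨m, rfl⟩ : ∃ m', m = m' + 1 := ⟨m - 1, by omega⟩
  have := mul_mem_Pn (a := 1) hf hg
  rwa [show 1 + m + 1 = n by omega] at this

/-! ### The projective symmetries and the cases with projective Hamiltonian. -/

/-- The triples of coefficients of the elements of `commonGens`. -/
def commonT (k l : ℕ) : Set (Trip k l) :=
  {(1, 0, 0), (cx, 0, 0), (cx ^ 2, ((k : ℝ) - 1) • (cx * cy 0), ((l : ℝ) - 1) • (cx * cz 0)),
    (0, cy 0, 0), (0, 0, cz 0)}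

/-- The triples of coefficients of the elements of `powZGens`. -/
def powZT (k l : ℕ) : Set (Trip k l) := {v | ∃ j : ℕ, j < l ∧ v = (0, 0, cx ^ j)}

/-- The triples of coefficients of the elements of `outerZGens`. -/
def outerT (k l d : ℕ) : Set (Trip k l) :=
  commonT k l ∪ powZT k l ∪
    {v | ∃ (i j : ℕ) (s : Fin j → ℕ), (∀ t, s t ≤ d) ∧ i + (l - d - 1) * j ≤ k - 1 ∧
      v = (0, cx ^ i * ∏ t, gs cz d (l - d) (s t), 0)}

theorem Sm.prod_val {ι : Type*} (s : Finset ι) (f : ι → Sm k l) :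
    (∏ i ∈ s, f i).1 = ∏ i ∈ s, (f i).1 := map_prod (smoothFns k l).subtype f s

theorem image_commonT : Trip.symb '' commonT k l = commonGens k l := by
  simp only [commonT, Set.image_insert_eq, Set.image_singleton]
  rfl

theorem outerZGens_eq (d : ℕ) : outerZGens k l d = Trip.symb '' outerT k l d := by
  rw [outerT, Set.image_union, Set.image_union, image_commonT, outerZGens]
  congr 1
  · congr 1
    ext v
    constructor
    · rintro ⟨j, hj, rfl⟩
      exact ⟨_, ⟨j, hj, rfl⟩, rfl⟩
    · rintro ⟨_, ⟨j, hj, rfl⟩, rfl⟩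
      exact ⟨j, hj, rfl⟩
  · have key : ∀ (i j : ℕ) (s : Fin j → ℕ),
        Trip.symb ((0, cx ^ i * ∏ t, gs cz d (l - d) (s t), 0) : Trip k l) =
          ⟨0, X ^ i * ∏ t, g Z d (l - d) (s t), 0⟩ := fun i j s => by
      refine Symb.ext rfl ?_ rfl
      change X ^ i * (∏ t, gs cz d (l - d) (s t) : Sm k l).1 = _
      rw [Sm.prod_val]
      congr 1
      exact Finset.prod_congr rfl fun t _ => gs_val _ _ _ _
    ext v
    constructor
    · rintro ⟨i, j, s, hs, h, rfl⟩
      exact ⟨_, ⟨i, j, s, hs, h, rfl⟩, key i j s⟩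
    · rintro ⟨_, ⟨i, j, s, hs, h, rfl⟩, rfl⟩
      exact ⟨i, j, s, hs, h, key i j s⟩

theorem gs_monomial_mem {d : ℕ} (hk : 0 < k) (hd : d + 1 < l) (i j : ℕ) (s : Fin j → ℕ)
    (hs : ∀ t, s t ≤ d) (h : i + (l - d - 1) * j ≤ k - 1) :
    ((0, cx ^ i * ∏ t, gs cz d (l - d) (s t), 0) : Trip k l) ∈ symTrip k l d := by
  have h1 : (cx ^ i * ∏ t, gs cz d (l - d) (s t) : Sm k l) ∈ mon 0 (d + 1) k := by
    refine ⟨i, j, fun t => Sum.inr ⟨s t, Nat.lt_succ_of_le (hs t)⟩, ?_, rfl⟩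
    simp only [wt, Sum.elim_inr, Finset.sum_const, Finset.card_univ, Fintype.card_fin, smul_eq_mul]
    rw [mul_comm j, ← Nat.sub_sub]
    omega
  refine symm_of_proj hk (by omega) (zero_mem _) (Fn_mono (Nat.zero_le 1) le_rfl (mon_mem_Fn hk hd h1))
    (zero_mem _) ?_ ?_
  · rw [mul_zero, sub_zero]
    exact span_mon_le hk hd k (Submodule.subset_span h1)
  · rw [mul_zero, sub_zero]
    exact zero_mem _

/-- The characteristics are -x `lv` and -x `lu`, and the linear functions have degrees at most k - 2
and l - 2 along D. -/
theorem projective_mem (hk : 1 < k) (hl : 1 < l) (d : ℕ) :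
    ((cx ^ 2, ((k : ℝ) - 1) • (cx * cy 0), ((l : ℝ) - 1) • (cx * cz 0)) : Trip k l) ∈
      symTrip k l d := by
  refine symm_of_proj (by omega) (by omega) (pow_mem (cx_mem_Fn _ _) _)
    (Subalgebra.smul_mem _ (mul_mem (cx_mem_Fn _ _) (cy_mem_Fn one_pos _)) _)
    (Subalgebra.smul_mem _ (mul_mem (cx_mem_Fn _ _) (cz_mem_Fn _ one_pos)) _) ?_ ?_
  · have : ((k : ℝ) - 1) • (cx * cy 0) - cy 1 * cx ^ 2 = -((cx : Sm k l) * lv) := by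
      rw [lv, mul_sub, mul_smul_comm]; ring
    rw [this]
    exact neg_mem (mul_mem_Pn' cx_mem_Pn (lv_mem_Pn hk) (by omega) (by omega))
  · have : ((l : ℝ) - 1) • (cx * cz 0) - cz 1 * cx ^ 2 = -((cx : Sm k l) * lu) := by
      rw [lu, mul_sub, mul_smul_comm]; ring
    rw [this]
    exact neg_mem (mul_mem_Pn' cx_mem_Pn (lu_mem_Pn hl) (by omega) (by omega))

theorem commonT_subset (hk : 1 < k) (hl : 1 < l) (d : ℕ) : commonT k l ⊆ symTrip k l d := by
  rintro _ (rfl | rfl | rfl | rfl | rfl)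
  · refine symm_of_proj (by omega) (by omega) (one_mem _) (zero_mem _) (zero_mem _) ?_ ?_ <;>
      rw [mul_one, zero_sub]
    · exact neg_mem (cy_mem_Pn (by omega))
    · exact neg_mem (cz_mem_Pn (by omega))
  · refine symm_of_proj (by omega) (by omega) (cx_mem_Fn _ _) (zero_mem _) (zero_mem _) ?_ ?_ <;>
      rw [mul_comm, zero_sub]
    · exact neg_mem (mul_mem_Pn' (m := k - 1) cx_mem_Pn (cy_mem_Pn (by omega)) (by omega) (by omega))
    · exact neg_mem (mul_mem_Pn' (m := l - 1) cx_mem_Pn (cz_mem_Pn (by omega)) (by omega) (by omega))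
  · exact projective_mem hk hl d
  · refine symm_of_proj (by omega) (by omega) (zero_mem _) (cy_mem_Fn one_pos _) (zero_mem _) ?_ ?_ <;>
      rw [mul_zero, sub_zero]
    · exact cy_mem_Pn (by omega)
    · exact zero_mem _
  · refine symm_of_proj (by omega) (by omega) (zero_mem _) (zero_mem _) (cz_mem_Fn _ one_pos) ?_ ?_ <;>
      rw [mul_zero, sub_zero]
    · exact zero_mem _
    · exact cz_mem_Pn (by omega)

theorem powZT_subset (hk : 0 < k) (hl : 0 < l) (d : ℕ) : powZT k l ⊆ symTrip k l d := by
  rintro _ ⟨j, hj, rfl⟩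
  refine symm_of_proj hk hl (zero_mem _) (zero_mem _) (pow_mem (cx_mem_Fn _ _) _) ?_ ?_ <;>
    rw [mul_zero, sub_zero]
  · exact zero_mem _
  · exact Pn_mono hj (cx_pow_mem_Pn j)

/-- The symbols with given Hamiltonian, up to the coefficient at `∂_{y_0}`. -/
theorem exists_of_mem_span {H : Set (Sm k l)} {T : Set (Trip k l)}
    (h : ∀ f ∈ H, ∃ b, ((-pZ 1 f, b, f - cz 1 * pZ 1 f) : Trip k l) ∈ Submodule.span ℝ T)
    {f : Sm k l} (hf : f ∈ Submodule.span ℝ H) :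
    ∃ b, ((-pZ 1 f, b, f - cz 1 * pZ 1 f) : Trip k l) ∈ Submodule.span ℝ T := by
  induction hf using Submodule.span_induction with
  | mem f hf => exact h f hf
  | zero =>
    refine ⟨0, ?_⟩
    simp only [map_zero, neg_zero, mul_zero, sub_zero]
    exact zero_mem _
  | add f f' _ _ hf hf' =>
    obtain ⟨b, hb⟩ := hf
    obtain ⟨b', hb'⟩ := hf'
    refine ⟨b + b', ?_⟩
    convert add_mem hb hb' using 1
    rw [Prod.mk_add_mk, Prod.mk_add_mk, map_add, neg_add, mul_add]
    congr 2
    ring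
  | smul r f _ hf =>
    obtain ⟨b, hb⟩ := hf
    refine ⟨r • b, ?_⟩
    convert Submodule.smul_mem _ r hb using 1
    rw [Prod.smul_mk, Prod.smul_mk, Derivation.map_smul, smul_neg, mul_smul_comm, smul_sub]

/-- x^i corresponds to x^i ∂_{z_0}, z_1 to -∂_x, x z_1 to -x ∂_x, and `lu` to -x ∂_x - (l - 1) z_0
∂_{z_0}. Only x `lu` needs a nonzero coefficient at ∂_{y_0}. -/
theorem exists_of_mem_projHam (hl : 1 < l) {T : Set (Trip k l)} (hT : commonT k l ∪ powZT k l ⊆ T)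
    {f : Sm k l} (hf : f ∈ projHam k l) :
    ∃ b, ((-pZ 1 f, b, f - cz 1 * pZ 1 f) : Trip k l) ∈ Submodule.span ℝ T := by
  have hc : ∀ v ∈ commonT k l, v ∈ Submodule.span ℝ T := fun v hv =>
    Submodule.subset_span (hT (Or.inl hv))
  rcases hf with ⟨i, hi, rfl⟩ | rfl | rfl | rfl | rfl
  · refine ⟨0, Submodule.subset_span (hT (Or.inr ⟨i, hi, ?_⟩))⟩
    rw [Derivation.leibniz_pow, pZ_cx]
    simp
  · refine ⟨0, ?_⟩
    convert neg_mem (hc (1, 0, 0) (by simp [commonT])) using 1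
    rw [pZ_one_cz_one hl]
    simp
  · refine ⟨0, ?_⟩
    convert neg_mem (hc (cx, 0, 0) (by simp [commonT])) using 1
    rw [Derivation.leibniz, pZ_one_cz_one hl, pZ_cx]
    simp [mul_comm]
  · refine ⟨0, ?_⟩
    convert add_mem (neg_mem (hc (cx, 0, 0) (by simp [commonT])))
      (Submodule.smul_mem _ (-((l : ℝ) - 1)) (hc (0, 0, cz 0) (by simp [commonT]))) using 1
    rw [pZ_one_lu hl, lu]
    simp only [Prod.neg_mk, neg_zero, Prod.smul_mk, smul_zero, Prod.mk_add_mk, add_zero, zero_add,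
      neg_smul]
    congr 2
    ring
  · refine ⟨-(((k : ℝ) - 1) • (cx * cy 0)), ?_⟩
    convert neg_mem (hc (cx ^ 2, ((k : ℝ) - 1) • (cx * cy 0), ((l : ℝ) - 1) • (cx * cz 0))
      (by simp [commonT])) using 1
    rw [Derivation.leibniz, pZ_one_lu hl, pZ_cx, lu]
    simp only [Prod.neg_mk, smul_eq_mul]
    refine Prod.ext (by ring) (Prod.ext rfl ?_)
    simp only [mul_sub, mul_smul_comm]
    ring

/-- The symmetries of the system of shift `d` in the cases where the coefficients at `∂_x` and
`∂_{z_0}` are those of a projective symmetry of `z_l = 0`. -/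
theorem symTrip_eq_span_outerT {d : ℕ} (hk : 2 ≤ k) (hd : d + 1 < l)
    (h : 1 ≤ d ∧ 4 ≤ l ∨ d = 0 ∧ 3 ≤ l ∧ l < k) :
    symTrip k l d = Submodule.span ℝ (outerT k l d) := by
  have hT : outerT k l d ⊆ symTrip k l d := by
    rintro v ((hv | hv) | ⟨i, j, s, hs, h, rfl⟩)
    · exact commonT_subset (by omega) (by omega) d hv
    · exact powZT_subset (by omega) (by omega) d hv
    · exact gs_monomial_mem (by omega) hd i j s hs h
  refine le_antisymm ?_ (Submodule.span_le.2 hT)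
  rintro ⟨a, b, c⟩ hv
  obtain ⟨hy, hz, ha, hb, hc⟩ := (mem_symTrip_iff (by omega) (by omega) d _).1 hv
  simp only at hy hz ha hb hc
  have hPz : hamil a c ∈ Pn l := mem_Pn.2 hz
  have hχ : hamil a c ∈ Fn 0 2 := by
    rcases h with ⟨h1, -⟩ | ⟨rfl, h2, h3⟩
    · exact hamil_mem_Fn hk hd h1 ha hc
    · have hc0 : c ∈ Fn 1 1 := hc 0 le_rfl (by omega)
      have h4 : hamil a c ∈ Fn 1 2 := sub_mem (Fn_mono le_rfl (by omega) hc0)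
        (mul_mem (cz_mem_Fn _ (by omega)) (Fn_mono le_rfl (by omega) ha))
      -- For d = 0 nothing yet makes the Hamiltonian independent of y_0. But y_0 has weight k - 1 ≥
      -- l, so it cannot occur in a monomial of weight below l.
      have h5 := mem_span_mon (by omega) (by omega) h4 hPz
      refine Submodule.span_le (p := Subalgebra.toSubmodule (Fn 0 2)).2 (fun f hf => ?_) h5
      obtain ⟨i, j, σ, hσ, rfl⟩ := hf
      change _ ∈ (Fn 0 2 : Subalgebra ℝ (Sm k l))
      refine mul_mem (pow_mem (cx_mem_Fn _ _) _) (prod_mem fun t _ => ?_)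
      rcases ht : σ t with s | s
      · have h6 := Finset.single_le_sum (f := fun t => wt k l 1 2 (σ t))
          (fun _ _ => Nat.zero_le _) (Finset.mem_univ t)
        have h7 : wt k l 1 2 (σ t) = k - 1 := by rw [ht]; rfl
        simp only [h7] at h6
        omega
      · exact gs_cz_mem_Fn (by omega) _ (by omega) _
  have hpZ : pZ 1 (hamil a c) = -a := by rw [pZ_hamil hd ha hc le_rfl, if_pos rfl]
  have hproj : hamil a c ∈ Submodule.span ℝ (projHam k l) := by
    by_cases hl : 4 ≤ l
    · exact mem_span_projHam (by omega) hl hχ hPz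
    · refine mem_span_projHam_of_pZ_pZ (by omega) (by omega) hχ hPz ?_
      rw [hpZ, map_neg, ha.2 1 (by omega), neg_zero]
  obtain ⟨b', hb'⟩ := exists_of_mem_span
    (fun f hf => exists_of_mem_projHam (T := outerT k l d) (by omega) Set.subset_union_left hf) hproj
  rw [hpZ, neg_neg, mul_neg, sub_neg_eq_add, hamil, sub_add_cancel] at hb'
  refine mem_span_of_mem_symTrip (by omega) hd hT (Or.inl (Or.inl (by simp [commonT]))) ?_ hv hb'
  intro i j s hs
  refine Submodule.subset_span (Or.inr ⟨i, j, fun t => s t, fun t => Nat.le_of_lt_succ (s t).2, ?_, rfl⟩)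
  rw [Nat.sub_sub]
  omega

/-! ### The contact case `l = 3`, `δ = 1` -/

/-- c_1 = D c - z_1 D a could contain z_2; the contact relation ∂_{z_1} c = z_1 ∂_{z_1} a is
precisely what removes it. -/
theorem symm_of_contact (hk : 0 < k) {a b c : Sm k 3} (ha : a ∈ Fn 0 2) (hb : b ∈ Fn 1 2)
    (hc : c ∈ Fn 0 2) (hac : pZ 1 c = cz 1 * pZ 1 a) (hby : b - cy 1 * a ∈ Pn k)
    (hcz : c - cz 1 * a ∈ Pn 3) : (a, b, c) ∈ symTrip k 3 1 := by
  rw [mem_symTrip_iff hk (by omega)]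
  refine ⟨mem_Pn.1 hby, mem_Pn.1 hcz, Fn_mono (Nat.zero_le _) le_rfl ha, hb, fun j hj _ => ?_⟩
  refine Fn_mono (Nat.zero_le _) le_rfl (p := 0) (q := 2) ?_
  interval_cases j
  · exact hc
  · have h1 := dD_mem_Fn (p' := 0) (q' := 3) (Or.inl rfl) (Or.inr le_rfl) ha
    have h2 := dD_mem_Fn (p' := 0) (q' := 3) (Or.inl rfl) (Or.inr le_rfl) hc
    have h3 : dD c - cz 1 * dD a ∈ Fn 0 3 := sub_mem h2 (mul_mem (cz_mem_Fn _ (by omega)) h1)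
    refine ⟨h3.1, fun i hi => ?_⟩
    rcases hi.eq_or_lt with rfl | hi
    · change pZ 2 (dD c - cz 1 * dD a) = 0
      rw [map_sub, pZ_mul_cz_of_ne (by omega), pZ_succ_dD (by omega), pZ_succ_dD (by omega),
        ha.2 2 le_rfl, hc.2 2 le_rfl, map_zero, zero_add, zero_add, hac, sub_self]
    · exact h3.2 i hi

/-- The triples of coefficients of the elements of `contactZGens`. -/
def contactT (k : ℕ) : Set (Trip k 3) :=
  {(cx * (2 * cz 0 - cx * cz 1), ((k : ℝ) - 1) • (cy 0 * (2 * cz 0 - cx * cz 1)),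
      2 * cz 0 ^ 2 - (1 / 2 : ℝ) • (cx ^ 2 * cz 1 ^ 2)),
    (2 * (cz 0 - cx * cz 1), -(((k : ℝ) - 1) • (cy 0 * cz 1)), -(cx * cz 1 ^ 2)),
    (cx ^ 2, ((k : ℝ) - 1) • (cx * cy 0), 2 * cx * cz 0),
    (cx, 0, 0), (0, 0, cz 0), (0, cy 0, 0),
    (cz 1, 0, (1 / 2 : ℝ) • cz 1 ^ 2), (1, 0, 0), (0, 0, 1), (0, 0, cx), (0, 0, cx ^ 2)} ∪
  {v | ∃ i j₀ j₁ : ℕ, i + j₀ + j₁ ≤ k - 1 ∧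
    v = (0, cx ^ i * (cx * cz 1 - 2 * cz 0) ^ j₀ * cz 1 ^ j₁, 0)}

theorem contactZGens_eq (k : ℕ) : contactZGens k = Trip.symb '' contactT k := by
  rw [contactT, Set.image_union, contactZGens]
  congr 1
  · simp only [Set.image_insert_eq, Set.image_singleton]
    rfl
  · ext v
    constructor
    · rintro ⟨i, j₀, j₁, h, rfl⟩
      exact ⟨_, ⟨i, j₀, j₁, h, rfl⟩, rfl⟩
    · rintro ⟨_, ⟨i, j₀, j₁, h, rfl⟩, rfl⟩
      exact ⟨i, j₀, j₁, h, rfl⟩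

theorem two_smul_eq (f : Sm k l) : (2 : ℝ) • f = 2 * f := by
  rw [Algebra.smul_def, map_ofNat]

theorem three_sub_one_smul (f : Sm k l) : (((3 : ℕ) : ℝ) - 1) • f = 2 * f := by
  rw [← two_smul_eq]
  congr 1
  norm_num

theorem derivation_two (d : Derivation ℝ (Sm k l) (Sm k l)) : d 2 = 0 :=
  (d.map_natCast 2)

theorem two_mul_half : (2 : Sm k l) * algebraMap ℝ _ (1 / 2) = 1 := by
  have h : (2 : Sm k l) = algebraMap ℝ _ 2 := (map_ofNat _ 2).symm
  rw [h, ← map_mul]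
  norm_num

theorem lu_three : (lu : Sm k 3) = cx * cz 1 - 2 * cz 0 := by
  rw [lu, three_sub_one_smul]

theorem lu_mem_Fn (p : ℕ) : (lu : Sm k l) ∈ Fn p 2 :=
  sub_mem (mul_mem (cx_mem_Fn _ _) (cz_mem_Fn _ (by omega)))
    (Subalgebra.smul_mem _ (cz_mem_Fn _ (by omega)) _)

theorem two_mem_Fn (p q : ℕ) : (2 : Sm k l) ∈ Fn p q := by
  have := Subalgebra.algebraMap_mem (Fn p q : Subalgebra ℝ (Sm k l)) 2
  rwa [map_ofNat] at this

/-- The z-characteristic is `lu`²/2 and the y-characteristic factors as `lu` times `lv`, so the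
degrees are at most 2 and k - 1. The coefficient k - 1 at y_0 is what makes this factorization
possible. -/
theorem contact_one_mem (hk : 2 ≤ k) :
    ((cx * (2 * cz 0 - cx * cz 1), ((k : ℝ) - 1) • (cy 0 * (2 * cz 0 - cx * cz 1)),
      2 * cz 0 ^ 2 - (1 / 2 : ℝ) • (cx ^ 2 * cz 1 ^ 2)) : Trip k 3) ∈ symTrip k 3 1 := by
  have hx := cx_mem_Fn (k := k) (l := 3) 0 2
  have h0 := cz_mem_Fn (k := k) (l := 3) (i := 0) (q := 2) 0 (by omega)
  have h1 := cz_mem_Fn (k := k) (l := 3) (i := 1) (q := 2) 0 (by omega)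
  have h2 := two_mem_Fn (k := k) (l := 3) 0 2
  have e : (2 * cz 0 - cx * cz 1 : Sm k 3) = -lu := by rw [lu_three]; ring
  refine symm_of_contact (by omega) ?_ ?_ ?_ ?_ ?_ ?_
  · exact mul_mem hx (sub_mem (mul_mem h2 h0) (mul_mem hx h1))
  · rw [e]
    exact Subalgebra.smul_mem _ (mul_mem (cy_mem_Fn one_pos _) (neg_mem (lu_mem_Fn _))) _
  · exact sub_mem (mul_mem h2 (pow_mem h0 _))
      (Subalgebra.smul_mem _ (mul_mem (pow_mem hx _) (pow_mem h1 _)) _)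
  · have hh := two_mul_half (k := k) (l := 3)
    simp only [map_sub, Derivation.leibniz, Derivation.leibniz_pow, Derivation.map_smul, pZ_cx,
      pZ_one_cz_one (show 1 < 3 by omega), smul_eq_mul, pZ_cz, derivation_two]
    rw [if_neg (by omega)]
    simp only [Algebra.smul_def (1 / 2 : ℝ), Nat.cast_ofNat, nsmul_eq_mul, Nat.add_one_sub_one,
      pow_one]
    linear_combination (-cx ^ 2 * cz 1) * hh
  · have : ((k : ℝ) - 1) • (cy 0 * (2 * cz 0 - cx * cz 1)) -
        cy 1 * (cx * (2 * cz 0 - cx * cz 1)) = (lu : Sm k 3) * lv := by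
      rw [e, lv, Algebra.smul_def, Algebra.smul_def]; ring
    rw [this]
    exact mul_mem_Pn' (lu_mem_Pn (by omega)) (lv_mem_Pn (by omega)) (by omega) (by omega)
  · have : 2 * cz 0 ^ 2 - (1 / 2 : ℝ) • (cx ^ 2 * cz 1 ^ 2) -
        cz 1 * (cx * (2 * cz 0 - cx * cz 1)) = (1 / 2 : ℝ) • ((lu : Sm k 3) * lu) := by
      rw [lu_three, Algebra.smul_def, Algebra.smul_def]
      linear_combination (-cx ^ 2 * cz 1 ^ 2 + 2 * cx * cz 1 * cz 0 - 2 * cz 0 ^ 2) *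
        two_mul_half (k := k) (l := 3)
    rw [this]
    exact Submodule.smul_mem _ _
      (mul_mem_Pn' (lu_mem_Pn (by omega)) (lu_mem_Pn (by omega)) (by omega) (by omega))

/-- Here the z-characteristic is `lu` z_1 and the y-characteristic is z_1 `lv` + `lu` y_1. -/
theorem contact_two_mem (hk : 2 ≤ k) :
    ((2 * (cz 0 - cx * cz 1), -(((k : ℝ) - 1) • (cy 0 * cz 1)), -(cx * cz 1 ^ 2)) : Trip k 3) ∈
      symTrip k 3 1 := by
  have hx := cx_mem_Fn (k := k) (l := 3) 0 2
  have h0 := cz_mem_Fn (k := k) (l := 3) (i := 0) (q := 2) 0 (by omega)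
  have h1 := cz_mem_Fn (k := k) (l := 3) (i := 1) (q := 2) 0 (by omega)
  have h2 := two_mem_Fn (k := k) (l := 3) 0 2
  have hz : (cz 1 : Sm k 3) ∈ Pn 2 := cz_mem_Pn (by omega)
  refine symm_of_contact (by omega) ?_ ?_ ?_ ?_ ?_ ?_
  · exact mul_mem h2 (sub_mem h0 (mul_mem hx h1))
  · exact neg_mem (Subalgebra.smul_mem _ (mul_mem (cy_mem_Fn one_pos _)
      (cz_mem_Fn _ (by omega))) _)
  · exact neg_mem (mul_mem hx (pow_mem h1 _))
  · simp only [map_sub, map_neg, Derivation.leibniz, Derivation.leibniz_pow, pZ_cx,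
      pZ_one_cz_one (show 1 < 3 by omega), smul_eq_mul, pZ_cz, derivation_two]
    simp
    ring
  · have : -(((k : ℝ) - 1) • (cy 0 * cz 1)) - cy 1 * (2 * (cz 0 - cx * cz 1)) =
        (cz 1 : Sm k 3) * lv + lu * cy 1 := by
      rw [lu_three, lv, Algebra.smul_def, Algebra.smul_def]; ring
    rw [this]
    exact add_mem (mul_mem_Pn' hz (lv_mem_Pn (by omega)) (by omega) (by omega))
      (mul_mem_Pn' (m := k - 1) (lu_mem_Pn (by omega)) (cy_mem_Pn (by omega)) (by omega) (by omega))
  · have : -(cx * cz 1 ^ 2) - cz 1 * (2 * (cz 0 - cx * cz 1)) = (lu : Sm k 3) * cz 1 := by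
      rw [lu_three]; ring
    rw [this]
    exact mul_mem_Pn' (lu_mem_Pn (by omega)) hz (by omega) (by omega)

theorem contact_three_mem (hk : 2 ≤ k) :
    ((cz 1, 0, (1 / 2 : ℝ) • cz 1 ^ 2) : Trip k 3) ∈ symTrip k 3 1 := by
  have h1 := cz_mem_Fn (k := k) (l := 3) (i := 1) (q := 2) 0 (by omega)
  have hz : (cz 1 : Sm k 3) ∈ Pn 2 := cz_mem_Pn (by omega)
  refine symm_of_contact (by omega) h1 (zero_mem _) (Subalgebra.smul_mem _ (pow_mem h1 _) _)
    ?_ ?_ ?_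
  · rw [Derivation.map_smul, Derivation.leibniz_pow, pZ_one_cz_one (show 1 < 3 by omega)]
    rw [Algebra.smul_def, smul_eq_mul, nsmul_eq_mul, Nat.cast_ofNat, Nat.add_one_sub_one, pow_one]
    linear_combination cz 1 * two_mul_half (k := k) (l := 3)
  · rw [zero_sub, mul_comm]
    exact neg_mem (mul_mem_Pn' (m := k - 1) hz (cy_mem_Pn (by omega)) (by omega) (by omega))
  · have : (1 / 2 : ℝ) • cz 1 ^ 2 - (cz 1 : Sm k 3) * cz 1 = (-(1 / 2) : ℝ) • (cz 1 * cz 1) := by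
      rw [← pow_two]
      module
    rw [this]
    exact Submodule.smul_mem _ _ (mul_mem_Pn' hz hz (by omega) (by omega))

theorem contactT_subset (hk : 2 ≤ k) : contactT k ⊆ symTrip k 3 1 := by
  have hc := commonT_subset (k := k) (l := 3) (by omega) (by omega) 1
  have hp := powZT_subset (k := k) (l := 3) (by omega) (by omega) 1
  rintro v (hv | ⟨i, j₀, j₁, h, rfl⟩)
  · rcases hv with rfl | rfl | rfl | rfl | rfl | rfl | rfl | rfl | rfl | rfl | rfl
    · exact contact_one_mem hk
    · exact contact_two_mem hk
    · have := projective_mem (k := k) (l := 3) (by omega) (by omega) 1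
      rwa [three_sub_one_smul, ← mul_assoc] at this
    · exact hc (by simp [commonT])
    · exact hc (by simp [commonT])
    · exact hc (by simp [commonT])
    · exact contact_three_mem hk
    · exact hc (by simp [commonT])
    · exact hp ⟨0, by omega, by rw [pow_zero]⟩
    · exact hp ⟨1, by omega, by rw [pow_one]⟩
    · exact hp ⟨2, by omega, rfl⟩
  · rw [← lu_three]
    refine symm_of_proj (by omega) (by omega) (zero_mem _) ?_ (zero_mem _) ?_ ?_
    · exact mul_mem (mul_mem (pow_mem (cx_mem_Fn _ _) _) (pow_mem (lu_mem_Fn _) _))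
        (pow_mem (cz_mem_Fn _ (by omega)) _)
    · rw [mul_zero, sub_zero]
      have h1 := pow_mem_Pn (a := 1) (lu_mem_Pn (k := k) (l := 3) (by omega)) j₀
      have h2 := pow_mem_Pn (a := 1) (cz_mem_Pn (k := k) (l := 3) (i := 1) (n := 2) (by omega)) j₁
      exact Pn_mono (by omega) (mul_mem_Pn (mul_mem_Pn (cx_pow_mem_Pn i) h1) h2)
    · rw [mul_zero, sub_zero]
      exact zero_mem _

theorem mk_mem_of_eq {T : Submodule ℝ (Trip k l)} {a b c a' c' : Sm k l} (h : (a, b, c) ∈ T)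
    (ha : a' = a) (hc : c' = c) : (a', b, c') ∈ T := by
  rw [ha, hc]
  exact h

/-- The quadratic Hamiltonians `lu`², `lu` z_1 and z_1² come from twice the first generator, the
second generator, and minus twice the one with a = z_1. -/
theorem exists_of_mem_contHam {f : Sm k 3} (hf : f ∈ contHam k) :
    ∃ b, ((-pZ 1 f, b, f - cz 1 * pZ 1 f) : Trip k 3) ∈ Submodule.span ℝ (contactT k) := by
  have hs : commonT k 3 ∪ powZT k 3 ⊆ contactT k := by
    rintro v (hv | ⟨j, hj, rfl⟩)
    · refine Or.inl ?_
      rcases hv with rfl | rfl | rfl | rfl | rfl <;>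
        simp only [three_sub_one_smul, ← mul_assoc, Set.mem_insert_iff, true_or, or_true]
    · refine Or.inl ?_
      interval_cases j <;>
        simp only [pow_zero, pow_one, Set.mem_insert_iff, Set.mem_singleton_iff, true_or, or_true]
  have hc : ∀ v ∈ contactT k, v ∈ Submodule.span ℝ (contactT k) := fun v hv =>
    Submodule.subset_span hv
  have hpl := pZ_one_lu (k := k) (show 1 < 3 by omega)
  rw [lu_three] at hpl
  have hpz := pZ_one_cz_one (k := k) (show 1 < 3 by omega)
  have hh := two_mul_half (k := k) (l := 3)
  rcases hf with hf | rfl | rfl | rfl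
  · exact exists_of_mem_projHam (by omega) hs hf
  · have h1 := Submodule.smul_mem _ (2 : ℝ) (hc _ (Or.inl (Set.mem_insert _ _)))
    rw [Prod.smul_mk, Prod.smul_mk, two_smul_eq (cx * _), two_smul_eq (2 * _ - _)] at h1
    refine ⟨_, mk_mem_of_eq h1 ?_ ?_⟩
    · simp only [Derivation.leibniz, hpl, lu_three, smul_eq_mul]
      ring
    · simp only [Derivation.leibniz, hpl, lu_three, smul_eq_mul, Algebra.smul_def]
      linear_combination (cx ^ 2 * cz 1 ^ 2) * hh
  · have h1 := hc _ (Or.inl (Set.mem_insert_of_mem _ (Set.mem_insert _ _)))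
    refine ⟨_, mk_mem_of_eq h1 ?_ ?_⟩
    · simp only [Derivation.leibniz, hpl, hpz, lu_three, smul_eq_mul]
      ring
    · simp only [Derivation.leibniz, hpl, hpz, lu_three, smul_eq_mul]
      ring
  · have h1 := neg_mem (Submodule.smul_mem _ (2 : ℝ) (hc (cz 1, 0, (1 / 2 : ℝ) • cz 1 ^ 2)
      (Or.inl (by simp only [Set.mem_insert_iff, true_or, or_true]))))
    rw [Prod.smul_mk, Prod.smul_mk, two_smul_eq (cz 1), two_smul_eq (_ • _), Prod.neg_mk,
      Prod.neg_mk] at h1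
    refine ⟨_, mk_mem_of_eq h1 ?_ ?_⟩
    · simp only [Derivation.leibniz, hpz, smul_eq_mul]
      ring
    · simp only [Derivation.leibniz, hpz, smul_eq_mul, Algebra.smul_def]
      linear_combination (cz 1 ^ 2) * hh

theorem prod_wv_eq {j : ℕ} (s : Fin j → Fin 2) :
    ∃ (r : ℝ) (j₀ j₁ : ℕ), j₀ + j₁ = j ∧
      (∏ t, gs cz 1 (3 - 1) (s t) : Sm k 3) = r • (lu ^ j₀ * cz 1 ^ j₁) := by
  induction j with
  | zero => exact ⟨1, 0, 0, rfl, by simp⟩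
  | succ j ih =>
    obtain ⟨r, j₀, j₁, h, hr⟩ := ih fun t => s t.succ
    rw [Fin.prod_univ_succ, hr]
    obtain ⟨r', hr' | hr'⟩ := wv_eq_smul (k := k) (l := 3) (by omega) (Sum.inr (s 0))
    · refine ⟨r' * r, j₀ + 1, j₁, by omega, ?_⟩
      change wv 0 2 (Sum.inr (s 0)) * _ = _
      rw [hr', smul_mul_smul_comm, pow_succ]
      congr 1
      ring
    · refine ⟨r' * r, j₀, j₁ + 1, by omega, ?_⟩
      change wv 0 2 (Sum.inr (s 0)) * _ = _
      rw [hr', smul_mul_smul_comm, pow_succ]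
      congr 1
      ring

theorem symTrip_eq_span_contactT (hk : 2 ≤ k) :
    symTrip k 3 1 = Submodule.span ℝ (contactT k) := by
  refine le_antisymm ?_ (Submodule.span_le.2 (contactT_subset hk))
  rintro ⟨a, b, c⟩ hv
  obtain ⟨hy, hz, ha, hb, hc⟩ := (mem_symTrip_iff (by omega) (by omega) 1 _).1 hv
  simp only at hy hz ha hb hc
  have hχ : hamil a c ∈ Fn 0 2 := hamil_mem_Fn hk (by omega) le_rfl ha hc
  obtain ⟨b', hb'⟩ := exists_of_mem_span (fun f hf => exists_of_mem_contHam hf)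
    (mem_span_contHam (by omega) hχ (mem_Pn.2 hz))
  have hpZ : pZ 1 (hamil a c) = -a := by rw [pZ_hamil (by omega) ha hc le_rfl, if_pos rfl]
  rw [hpZ, neg_neg, mul_neg, sub_neg_eq_add, hamil, sub_add_cancel] at hb'
  refine mem_span_of_mem_symTrip (by omega) (by omega) (contactT_subset hk)
    (Or.inl (by simp only [Set.mem_insert_iff, true_or, or_true])) ?_ hv hb'
  intro i j s hs
  obtain ⟨r, j₀, j₁, h, hr⟩ := prod_wv_eq (k := k) s
  have h1 : ((0, cx ^ i * ∏ t, gs cz 1 (3 - 1) (s t), 0) : Trip k 3) =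
      r • (0, cx ^ i * (cx * cz 1 - 2 * cz 0) ^ j₀ * cz 1 ^ j₁, 0) := by
    rw [hr, Prod.smul_mk, Prod.smul_mk, smul_zero, mul_smul_comm, lu_three, mul_assoc]
  rw [h1]
  exact Submodule.smul_mem _ _ (Submodule.subset_span (Or.inr ⟨i, j₀, j₁, by omega, rfl⟩))

/-! ### The case `l = 2`, `δ = 0` -/

/-- The triples of coefficients of the elements of `firstKindTwoGens`, with the two dependent
variables exchanged. -/
def pointT (k : ℕ) : Set (Trip k 2) :=
  {(1, 0, 0), (0, 0, 1), (cx, 0, 0), (0, 0, cx), (cz 0, 0, 0), (0, 0, cz 0), (0, cy 0, 0),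
    (cx ^ 2, ((k : ℝ) - 1) • (cx * cy 0), cx * cz 0),
    (cx * cz 0, ((k : ℝ) - 1) • (cz 0 * cy 0), cz 0 ^ 2)} ∪
  {v | ∃ i j : ℕ, i + j ≤ k - 1 ∧ v = (0, cx ^ i * cz 0 ^ j, 0)}

theorem symm_of_point (hk : 0 < k) {a b c : Sm k 2} (ha : a ∈ Fn 0 1) (hb : b ∈ Fn 1 1)
    (hc : c ∈ Fn 0 1) (hby : b - cy 1 * a ∈ Pn k) (hcz : c - cz 1 * a ∈ Pn 2) :
    (a, b, c) ∈ symTrip k 2 0 := by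
  rw [mem_symTrip_iff hk (by omega)]
  refine ⟨mem_Pn.1 hby, mem_Pn.1 hcz, Fn_mono (Nat.zero_le _) le_rfl ha, hb, fun j hj _ => ?_⟩
  obtain rfl : j = 0 := by omega
  exact Fn_mono (Nat.zero_le _) le_rfl hc

theorem lu_two : (lu : Sm k 2) = cx * cz 1 - cz 0 := by
  rw [lu]
  congr 1
  norm_num

theorem pointT_subset (hk : 2 ≤ k) : pointT k ⊆ symTrip k 2 0 := by
  have hc := commonT_subset (k := k) (l := 2) (by omega) (by omega) 0
  have hp := powZT_subset (k := k) (l := 2) (by omega) (by omega) 0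
  have hz0 : (cz 0 : Sm k 2) ∈ Pn 2 := cz_mem_Pn (by omega)
  have hz1 : (cz 1 : Sm k 2) ∈ Pn 1 := cz_mem_Pn (by omega)
  have hf := cz_mem_Fn (k := k) (l := 2) (i := 0) (q := 1) 0 (by omega)
  have hcm : ∀ v ∈ commonT k 2, v ∈ symTrip k 2 0 := fun v hv => hc hv
  rintro v (hv | ⟨i, j, h, rfl⟩)
  · rcases hv with rfl | rfl | rfl | rfl | rfl | rfl | rfl | rfl | rfl
    · exact hc (by simp only [commonT, Set.mem_insert_iff, true_or])
    · exact hp ⟨0, by omega, by rw [pow_zero]⟩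
    · exact hc (by simp only [commonT, Set.mem_insert_iff, true_or, or_true])
    · exact hp ⟨1, by omega, by rw [pow_one]⟩
    · refine symm_of_point (by omega) hf (zero_mem _) (zero_mem _) ?_ ?_ <;>
        rw [zero_sub, mul_comm]
      · exact neg_mem (mul_mem_Pn' (m := k - 1) hz0 (cy_mem_Pn (by omega)) (by omega) (by omega))
      · exact neg_mem (mul_mem_Pn' hz0 hz1 (by omega) (by omega))
    · exact hc (by simp only [commonT, Set.mem_insert_iff, Set.mem_singleton_iff, or_true])
    · exact hc (by simp only [commonT, Set.mem_insert_iff, true_or, or_true])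
    · have := projective_mem (k := k) (l := 2) (by omega) (by omega) 0
      rwa [show ((2 : ℕ) : ℝ) - 1 = 1 by norm_num, one_smul] at this
    · refine symm_of_point (by omega) (mul_mem (cx_mem_Fn _ _) hf) ?_ (pow_mem hf _) ?_ ?_
      · exact Subalgebra.smul_mem _ (mul_mem (cz_mem_Fn _ one_pos) (cy_mem_Fn one_pos _)) _
      · have : ((k : ℝ) - 1) • (cz 0 * cy 0) - cy 1 * (cx * cz 0) = -(cz 0 * (lv : Sm k 2)) := by
          rw [lv, Algebra.smul_def, Algebra.smul_def]; ring
        rw [this]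
        exact neg_mem (mul_mem_Pn' hz0 (lv_mem_Pn (by omega)) (by omega) (by omega))
      · have : cz 0 ^ 2 - cz 1 * (cx * cz 0) = -(cz 0 * (lu : Sm k 2)) := by
          rw [lu_two]; ring
        rw [this]
        exact neg_mem (mul_mem_Pn' hz0 (lu_mem_Pn (by omega)) (by omega) (by omega))
  · refine symm_of_point (by omega) (zero_mem _) ?_ (zero_mem _) ?_ ?_
    · exact mul_mem (pow_mem (cx_mem_Fn _ _) _) (pow_mem (cz_mem_Fn _ one_pos) _)
    · rw [mul_zero, sub_zero]
      have := pow_mem_Pn (a := 1) hz0 j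
      exact Pn_mono (by omega) (mul_mem_Pn (cx_pow_mem_Pn i) this)
    · rw [mul_zero, sub_zero]
      exact zero_mem _

theorem prod_wv_zero_eq {j : ℕ} (s : Fin j → Fin 1) :
    (∏ t, gs cz 0 (2 - 0) (s t) : Sm k 2) = (((2 : ℕ).factorial : ℝ)⁻¹) ^ j • cz 0 ^ j := by
  rw [Finset.prod_congr rfl fun t _ => show gs cz 0 (2 - 0) (s t) =
    (((2 : ℕ).factorial : ℝ)⁻¹) • (cz 0 : Sm k 2) from ?_, Finset.prod_const, Finset.card_univ,
    Fintype.card_fin, smul_pow]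
  rw [← gs_zero_zero px_cz (by omega), Subsingleton.elim (s t) 0]
  rfl

/-- For l = 2 the coordinate z_0 has weight 1, so these are the polynomials of total degree at most
2 in x and z_0. -/
theorem mem_span_of_mem_Fn_zero_one {f : Sm k 2} (hk : 0 < k) (hf : f ∈ Fn 0 1)
    (hn : f ∈ Pn 3) :
    ∃ r₀ r₁ r₂ r₃ r₄ r₅ : ℝ, f = r₀ • 1 + (r₁ • cx + (r₂ • cz 0 + (r₃ • cx ^ 2 +
      (r₄ • (cx * cz 0) + r₅ • cz 0 ^ 2)))) := by
  have h : f ∈ Submodule.span ℝ {(1 : Sm k 2), cx, cz 0, cx ^ 2, cx * cz 0, cz 0 ^ 2} := by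
    refine Submodule.span_le.2 ?_ (mem_span_mon hk (by omega) hf hn)
    rintro _ ⟨i, j, σ, h, rfl⟩
    have h1 : ∀ σ : Fin 0 ⊕ Fin 1, wt k 2 0 1 σ = 1 := by rintro (s | s) <;> [exact s.elim0; rfl]
    have h2 : ∏ t, wv 0 1 (σ t) = (((2 : ℕ).factorial : ℝ)⁻¹) ^ j • (cz 0 ^ j : Sm k 2) := by
      rw [← prod_wv_zero_eq fun _ => 0]
      refine Finset.prod_congr rfl fun t _ => ?_
      rcases σ t with s | s
      · exact s.elim0
      · rw [Subsingleton.elim s 0]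
        rfl
    rw [Finset.sum_congr rfl fun t _ => h1 (σ t), Finset.sum_const, Finset.card_univ,
      Fintype.card_fin, smul_eq_mul, mul_one] at h
    rw [h2, mul_smul_comm]
    refine Submodule.smul_mem _ _ (Submodule.subset_span ?_)
    obtain ⟨rfl, rfl⟩ | ⟨rfl, rfl⟩ | ⟨rfl, rfl⟩ | ⟨rfl, rfl⟩ | ⟨rfl, rfl⟩ | ⟨rfl, rfl⟩ :
        i = 0 ∧ j = 0 ∨ i = 1 ∧ j = 0 ∨ i = 0 ∧ j = 1 ∨ i = 2 ∧ j = 0 ∨ i = 1 ∧ j = 1 ∨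
          i = 0 ∧ j = 2 := by omega
    all_goals simp only [pow_zero, pow_one, mul_one, one_mul, Set.mem_insert_iff,
      Set.mem_singleton_iff, true_or, or_true]
  simp only [Submodule.mem_span_insert, Submodule.mem_span_singleton] at h
  obtain ⟨r₀, _, ⟨r₁, _, ⟨r₂, _, ⟨r₃, _, ⟨r₄, _, ⟨r₅, rfl⟩, rfl⟩, rfl⟩, rfl⟩, rfl⟩, rfl⟩ := h
  exact ⟨r₀, r₁, r₂, r₃, r₄, r₅, rfl⟩

theorem pZ_one_dD (f : Sm k 2) : pZ 1 (dD f) = dD (pZ 1 f) + pZ 0 f :=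
  pZ_succ_dD (by omega) f

theorem dD_cz_one : dD (cz 1 : Sm k 2) = 0 := by
  rw [dD_cz, cz_of_le le_rfl]

theorem eq_zero_of_ofNat_mul (r : ℝ) (hr : r ≠ 0) {f : Sm k l} (h : algebraMap ℝ _ r * f = 0) :
    f = 0 := by
  rw [← Algebra.smul_def] at h
  exact (smul_eq_zero.1 h).resolve_left hr

theorem pZ_four (i : ℕ) : pZ i (4 : Sm k l) = 0 :=
  (pZ i).map_natCast 4

/-- The consequences of the determining equation `D² c = z_1 D² a` for functions of `x`, `z_0`. -/
theorem point_identities {a c : Sm k 2} (ha : pZ 1 a = 0) (hc : pZ 1 c = 0)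
    (h : dD (dD c) = cz 1 * dD (dD a)) : dD (dD (dD a)) = 0 ∧ dD (dD (dD c)) = 0 := by
  have hcz := pZ_one_cz_one (k := k) (show 1 < 2 by omega)
  have hz0 : pZ 0 (cz 1 : Sm k 2) = 0 := by rw [pZ_cz, if_neg (by omega)]
  have hq : ∀ f : Sm k 2, pZ 1 f = 0 → pZ 1 (pZ 0 f) = 0 := fun f hf => by
    rw [pZ_pZ, hf, map_zero]
  have hdd : ∀ f : Sm k 2, pZ 1 f = 0 → pZ 1 (dD (dD f)) = 2 * dD (pZ 0 f) := fun f hf => by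
    rw [pZ_one_dD, pZ_one_dD, pZ_zero_dD, hf, map_zero, zero_add]
    ring
  have hd : ∀ f : Sm k 2, pZ 1 f = 0 → pZ 1 (dD f) = pZ 0 f := fun f hf => by
    rw [pZ_one_dD, hf, map_zero, zero_add]
  -- Since a and c do not involve z_1, successive derivatives in z_1 separate the determining
  -- equation into its coefficients. The third one leaves 6 ∂_{z_0}² a = 0.
  have e1 : 2 * dD (pZ 0 c) = dD (dD a) + 2 * (cz 1 * dD (pZ 0 a)) := by
    have := congrArg (pZ 1) h
    rw [hdd c hc, Derivation.leibniz, hdd a ha, hcz, smul_eq_mul, smul_eq_mul] at this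
    linear_combination this
  have e2 : 2 * pZ 0 (pZ 0 c) = 4 * dD (pZ 0 a) + 2 * (cz 1 * pZ 0 (pZ 0 a)) := by
    have := congrArg (pZ 1) e1
    rw [Derivation.leibniz, map_add, Derivation.leibniz, Derivation.leibniz, hd _ (hq c hc),
      hd _ (hq a ha), hdd a ha, hcz, derivation_two, smul_eq_mul, smul_eq_mul, smul_eq_mul,
      smul_eq_mul, smul_eq_mul, smul_eq_mul] at this
    linear_combination this
  have e3 : pZ 0 (pZ 0 a) = 0 := by
    have := congrArg (pZ 1) e2
    rw [Derivation.leibniz, map_add, Derivation.leibniz, Derivation.leibniz, Derivation.leibniz,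
      hq _ (hq c hc), hd _ (hq a ha), hq _ (hq a ha), hcz, derivation_two, pZ_four, smul_eq_mul,
      smul_eq_mul, smul_eq_mul, smul_eq_mul, smul_eq_mul, smul_eq_mul, smul_eq_mul,
      smul_eq_mul] at this
    refine eq_zero_of_ofNat_mul 6 (by norm_num) ?_
    rw [map_ofNat]
    linear_combination -this
  have e4 : pZ 0 (pZ 0 c) = 2 * dD (pZ 0 a) := by
    rw [e3, mul_zero, mul_zero, add_zero] at e2
    refine sub_eq_zero.1 (eq_zero_of_ofNat_mul 2 (by norm_num) ?_)
    rw [map_ofNat]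
    linear_combination e2
  -- Differentiating `e1` in z_0 and inserting `e4` gives 4 D² ∂_{z_0} a = D² ∂_{z_0} a.
  have e5 : dD (dD (pZ 0 a)) = 0 := by
    have := congrArg (pZ 0) e1
    rw [Derivation.leibniz, map_add, Derivation.leibniz, Derivation.leibniz, pZ_zero_dD,
      pZ_zero_dD, pZ_zero_dD, pZ_zero_dD, e3, e4, Derivation.leibniz, hz0, derivation_two,
      derivation_two, map_zero, smul_eq_mul, smul_eq_mul, smul_eq_mul] at this
    refine eq_zero_of_ofNat_mul 3 (by norm_num) ?_
    rw [map_ofNat]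
    simp only [smul_zero, mul_zero, add_zero] at this
    linear_combination this
  have e6 : dD (dD (pZ 0 c)) = 0 := by
    have := congrArg (pZ 0) h
    rwa [Derivation.leibniz, pZ_zero_dD, pZ_zero_dD, pZ_zero_dD, pZ_zero_dD, e5, hz0, smul_zero,
      smul_zero, add_zero] at this
  have e7 : dD (dD (dD a)) = 0 := by
    have := congrArg dD e1
    rw [Derivation.leibniz, map_add, Derivation.leibniz, Derivation.leibniz, e5, e6, dD_cz_one,
      derivation_two] at this
    simpa using this.symm
  refine ⟨e7, ?_⟩
  rw [h, Derivation.leibniz, e7, dD_cz_one, smul_zero, smul_zero, add_zero]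

theorem dD_dD_quadratic (r₀ r₁ r₂ r₃ r₄ r₅ : ℝ) :
    dD (dD (r₀ • 1 + (r₁ • cx + (r₂ • cz 0 + (r₃ • cx ^ 2 + (r₄ • (cx * cz 0) +
      r₅ • (cz 0 : Sm k 2) ^ 2)))))) =
      (2 * r₃) • 1 + (2 * r₄) • cz 1 + (2 * r₅) • cz 1 ^ 2 := by
  simp only [map_add, Derivation.map_smul, Derivation.leibniz, Derivation.leibniz_pow, dD_cx,
    dD_cz, Derivation.map_one_eq_zero, smul_eq_mul, nsmul_eq_mul, zero_add,
    cz_of_le (show 2 ≤ 1 + 1 by omega), Nat.cast_ofNat, derivation_two, Nat.add_one_sub_one,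
    pow_one, mul_one, mul_zero, add_zero, smul_zero]
  simp only [Algebra.smul_def, map_mul, map_ofNat]
  ring

/-- The Hamiltonian involves z_1 while l = 2, outside the range of `mem_span_mon`. Instead a and c
themselves are shown to be killed by D³, hence quadratic in x and z_0, and comparison of
coefficients leaves the projective algebra of the plane. -/
theorem symTrip_eq_span_pointT (hk : 2 < k) :
    symTrip k 2 0 = Submodule.span ℝ (pointT k) := by
  refine le_antisymm ?_ (Submodule.span_le.2 (pointT_subset hk.le))
  rintro ⟨a, b, c⟩ hv
  obtain ⟨-, hz, ha, -, hc⟩ := (mem_symTrip_iff (by omega) (by omega) 0 _).1 hv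
  simp only at hz ha hc
  replace hc : c ∈ Fn 1 1 := hc 0 le_rfl (by omega)
  have hψ : hamil a c ∈ Fn 1 2 :=
    sub_mem (Fn_mono le_rfl (by omega) hc)
      (mul_mem (cz_mem_Fn _ (by omega)) (Fn_mono le_rfl (by omega) ha))
  -- As k ≥ 3, the variable y_2 exists. Applying ∂_{y_2} to D² of the Hamiltonian and commuting
  -- twice past D leaves only its y_0-derivative.
  have hψ0 : pY 0 (hamil a c) = 0 := by
    have h := congrArg (pY 2) hz
    change pY 2 (dD (dD (hamil a c))) = pY 2 0 at h
    rw [pY_succ_dD (by omega), pY_succ_dD (by omega), pY_succ_dD (by omega), zero_add,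
      one_add_one_eq_two, hψ.1 1 le_rfl, hψ.1 2 (by omega)] at h
    simpa using h
  have hψ1 : pZ 1 (hamil a c) = -a := by
    rw [pZ_hamil (d := 0) (by omega) ha
      (fun j hj _ => by obtain rfl : j = 0 := by omega
                        exact hc) le_rfl, if_pos rfl]
  have ha0 : pY 0 a = 0 := by
    rw [← neg_neg a, ← hψ1, map_neg, pY_pZ, hψ0, map_zero, neg_zero]
  have hc0 : pY 0 c = 0 := by
    rw [hamil, map_sub, Derivation.leibniz, ha0, pY_cz, smul_zero, smul_zero, zero_add,
      sub_zero] at hψ0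
    exact hψ0
  have ha1 : a ∈ Fn 0 1 := ⟨fun i _ => i.eq_zero_or_pos.elim (fun h => h ▸ ha0) (ha.1 i), ha.2⟩
  have hc1 : c ∈ Fn 0 1 := ⟨fun i _ => i.eq_zero_or_pos.elim (fun h => h ▸ hc0) (hc.1 i), hc.2⟩
  have hE : dD (dD c) = cz 1 * dD (dD a) := by
    change dD (dD (c - cz 1 * a)) = 0 at hz
    rw [map_sub, Derivation.leibniz, dD_cz_one, smul_zero, add_zero, map_sub, smul_eq_mul,
      Derivation.leibniz, dD_cz_one, smul_zero, add_zero, smul_eq_mul] at hz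
    exact sub_eq_zero.1 hz
  obtain ⟨ha3, hc3⟩ := point_identities (ha1.2 1 le_rfl) (hc1.2 1 le_rfl) hE
  obtain ⟨a₀, a₁, a₂, a₃, a₄, a₅, rfl⟩ :=
    mem_span_of_mem_Fn_zero_one (by omega) ha1 (mem_Pn.2 ha3)
  obtain ⟨c₀, c₁, c₂, c₃, c₄, c₅, rfl⟩ :=
    mem_span_of_mem_Fn_zero_one (by omega) hc1 (mem_Pn.2 hc3)
  -- The determining equation at the point with x = 0, y = 0 and z_1 = t; comparing powers of t
  -- gives c₃ = 0, c₄ = a₃, c₅ = a₄ and a₅ = 0.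
  have hev : ∀ t : ℝ, 2 * c₃ + 2 * c₄ * t + 2 * c₅ * t ^ 2 =
      t * (2 * a₃ + 2 * a₄ * t + 2 * a₅ * t ^ 2) := fun t => by
    rw [dD_dD_quadratic, dD_dD_quadratic] at hE
    have := congrFun (congrArg Subtype.val hE) ((0, 0, fun _ => t) : EqMan k 2)
    simpa [cz_val, Z] using this
  obtain rfl : c₃ = 0 := by linarith [hev 0]
  obtain rfl : a₅ = 0 := by linarith [hev 1, hev (-1), hev 2, hev (-2)]
  obtain rfl : c₅ = a₄ := by linarith [hev 1, hev (-1)]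
  obtain rfl : c₄ = a₃ := by linarith [hev 1, hev (-1)]
  have hmem : ∀ v ∈ pointT k, ∀ r : ℝ, r • v ∈ Submodule.span ℝ (pointT k) := fun v hv r =>
    Submodule.smul_mem _ _ (Submodule.subset_span hv)
  have h1 := add_mem (hmem (1, 0, 0) (Or.inl (by simp)) a₀)
    (add_mem (hmem (cx, 0, 0) (Or.inl (by simp)) a₁)
    (add_mem (hmem (cz 0, 0, 0) (Or.inl (by simp)) a₂)
    (add_mem (hmem (cx ^ 2, ((k : ℝ) - 1) • (cx * cy 0), cx * cz 0) (Or.inl (by simp)) c₄)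
    (add_mem (hmem (cx * cz 0, ((k : ℝ) - 1) • (cz 0 * cy 0), cz 0 ^ 2) (Or.inl (by simp)) c₅)
    (add_mem (hmem (0, 0, 1) (Or.inl (by simp)) c₀)
    (add_mem (hmem (0, 0, cx) (Or.inl (by simp)) c₁)
    (hmem (0, 0, cz 0) (Or.inl (by simp)) c₂)))))))
  simp only [Prod.smul_mk, Prod.mk_add_mk, smul_zero, add_zero, zero_add] at h1
  refine mem_span_of_mem_symTrip (by omega) (by omega) (pointT_subset hk.le) (Or.inl (by simp))
    ?_ hv (mk_mem_of_eq h1 ?_ ?_)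
  · intro i j s hs
    have h2 : ((0, cx ^ i * ∏ t, gs cz 0 (2 - 0) (s t), 0) : Trip k 2) =
        (((2 : ℕ).factorial : ℝ)⁻¹) ^ j • (0, cx ^ i * cz 0 ^ j, 0) := by
      rw [prod_wv_zero_eq, Prod.smul_mk, Prod.smul_mk, smul_zero, mul_smul_comm]
    rw [h2]
    exact hmem _ (Or.inr ⟨i, j, by omega, rfl⟩) _
  · simp only [zero_smul, add_zero]
  · simp only [zero_smul, zero_add]
    abel

/-! ### Exchanging the two dependent variables -/

/-- The exchange of the two dependent variables. -/
def swap (k l : ℕ) : EqMan k l ≃L[ℝ] EqMan l k :=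
  (ContinuousLinearEquiv.refl ℝ ℝ).prodCongr (ContinuousLinearEquiv.prodComm ℝ (Fin k → ℝ) (Fin l → ℝ))

/-- Conjugation of maps by the exchange of the two dependent variables. -/
def swapMap (k l : ℕ) : (EqMan k l → EqMan k l) →ₗ[ℝ] (EqMan l k → EqMan l k) where
  toFun V p := swap k l (V (swap l k p))
  map_add' _ _ := rfl
  map_smul' _ _ := rfl

theorem fderiv_comp_swap {E : Type*} [NormedAddCommGroup E] [NormedSpace ℝ E] (f : EqMan k l → E)
    (p v : EqMan l k) : fderiv ℝ (fun q => f (swap l k q)) p v =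
      fderiv ℝ f (swap l k p) (swap l k v) := by
  have := (swap l k).comp_right_fderiv (f := f) (x := p)
  exact congrArg (fun L : EqMan l k →L[ℝ] E => L v) this

theorem fderiv_swapMap (V : EqMan k l → EqMan k l) (p v : EqMan l k) :
    fderiv ℝ (swapMap k l V) p v = swap k l (fderiv ℝ V (swap l k p) (swap l k v)) := by
  have := (swap k l).comp_fderiv (f := fun q => V (swap l k q)) (x := p)
  rw [← fderiv_comp_swap]
  exact congrArg (fun L : EqMan l k →L[ℝ] EqMan l k => L v) this

/-- Conjugation of vector fields by the exchange of the two dependent variables. -/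
def swapField (V : VField k l) : VField l k :=
  ⟨swapMap k l (VField.toFun V), (swap k l).contDiff.comp (V.smooth.comp (swap l k).contDiff)⟩

theorem toFun_swapField (V : VField k l) :
    VField.toFun (swapField V) = swapMap k l (VField.toFun V) := rfl

theorem swapField_swapField (V : VField k l) : swapField (swapField V) = V := rfl

theorem swapField_lie (V W : VField k l) : swapField ⁅V, W⁆ = ⁅swapField V, swapField W⁆ := by
  refine VField.toFun_injective (funext fun p => ?_)
  rw [VField.toFun_lie, toFun_swapField, toFun_swapField, toFun_swapField, VField.toFun_lie]
  change swap k l (VectorField.lieBracket ℝ _ _ (swap l k p)) = _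
  rw [VectorField.lieBracket, VectorField.lieBracket, map_sub, fderiv_swapMap, fderiv_swapMap]
  rfl

theorem Preserves.swapField {Δ : EqMan k l → Submodule ℝ (EqMan k l)}
    {Δ' : EqMan l k → Submodule ℝ (EqMan l k)} (h : ∀ p v, swap k l v ∈ Δ' (swap k l p) ↔ v ∈ Δ p)
    {S : VField k l} (hS : Preserves S Δ) : Preserves (swapField S) Δ' := by
  intro V hV p
  have h1 := hS (EqMan.swapField V) fun q => (h q _).1 (hV (swap k l q))
  have h2 := (h (swap l k p) _).2 (h1 (swap l k p))
  rwa [← swapField_swapField V, ← swapField_lie]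

theorem swap_mem_span_iff {s : Set (EqMan k l)} {t : Set (EqMan l k)}
    (h : swap k l '' s = t) (v : EqMan k l) :
    swap k l v ∈ Submodule.span ℝ t ↔ v ∈ Submodule.span ℝ s := by
  have h1 : Submodule.span ℝ t = (Submodule.span ℝ s).map (swap k l).toLinearMap := by
    rw [Submodule.map_span]
    exact congrArg _ h.symm
  rw [h1]
  exact Function.Injective.mem_set_image (swap k l).injective

theorem swap_mem_distE (p v : EqMan k l) :
    swap k l v ∈ distE l k (swap k l p) ↔ v ∈ distE k l p := by
  have h : swap k l (total p) = total (swap k l p) := rfl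
  refine swap_mem_span_iff ?_ v
  rw [Set.image_singleton, h]

theorem swap_mem_distF (δ : ℤ) (p v : EqMan k l) :
    swap k l v ∈ distF l k (-δ) (swap k l p) ↔ v ∈ distF k l δ p := by
  refine swap_mem_span_iff ?_ v
  rw [Set.image_union, Set.union_comm]
  congr 1
  · ext v
    constructor
    · rintro ⟨_, ⟨j, hj, rfl⟩, rfl⟩
      exact ⟨j, by rwa [neg_neg], rfl⟩
    · rintro ⟨j, hj, rfl⟩
      exact ⟨_, ⟨j, by rwa [neg_neg] at hj, rfl⟩, rfl⟩
  · ext v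
    constructor
    · rintro ⟨_, ⟨j, hj, rfl⟩, rfl⟩
      exact ⟨j, hj, rfl⟩
    · rintro ⟨j, hj, rfl⟩
      exact ⟨_, ⟨j, hj, rfl⟩, rfl⟩

theorem swapField_mem {δ : ℤ} {V : VField k l} (hV : V ∈ symmetryAlgebra k l δ) :
    swapField V ∈ symmetryAlgebra l k (-δ) :=
  ⟨Preserves.swapField swap_mem_distE hV.1, Preserves.swapField (swap_mem_distF δ) hV.2⟩

theorem swapField_mem' {δ : ℤ} {V : VField l k} (hV : V ∈ symmetryAlgebra l k (-δ)) :
    swapField V ∈ symmetryAlgebra k l δ := by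
  have := swapField_mem hV
  rwa [neg_neg] at this

/-- The symmetry algebras of the systems of shift `δ` and `-δ`, with the two dependent variables
exchanged, are isomorphic. -/
def swapEquiv (k l : ℕ) (δ : ℤ) : symmetryAlgebra k l δ ≃ₗ⁅ℝ⁆ symmetryAlgebra l k (-δ) where
  toFun V := ⟨swapField V.1, swapField_mem V.2⟩
  invFun V := ⟨swapField V.1, swapField_mem' V.2⟩
  map_add' _ _ := rfl
  map_smul' _ _ := rfl
  map_lie' {V W} := Subtype.ext (swapField_lie V.1 W.1)
  left_inv _ := rfl
  right_inv _ := rfl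

/-- The symbol with the two dependent variables exchanged. -/
def Symb.swap (v : Symb k l) : Symb l k :=
  ⟨fun p => v.a (EqMan.swap l k p), fun p => v.c (EqMan.swap l k p),
    fun p => v.b (EqMan.swap l k p)⟩

theorem D_comp_swap (f : EqMan k l → ℝ) :
    D (fun p => f (swap l k p)) = fun p => D f (swap l k p) :=
  funext fun p => fderiv_comp_swap f p (total p)

theorem partialX_comp_swap (f : EqMan k l → ℝ) :
    partialX (fun p => f (swap l k p)) = fun p => partialX f (swap l k p) :=
  funext fun p => fderiv_comp_swap f p dX

theorem prolongCoeff_swap (u : ℕ → EqMan k l → ℝ) (a b : EqMan k l → ℝ) (i : ℕ) :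
    prolongCoeff (fun i p => u i (swap l k p)) (fun p => a (swap l k p))
      (fun p => b (swap l k p)) i = fun p => prolongCoeff u a b i (swap l k p) := by
  induction i with
  | zero => rfl
  | succ i ih =>
    rw [prolongCoeff, ih, D_comp_swap, D_comp_swap]
    rfl

theorem g_swap (i j s : ℕ) :
    (fun p => g Z i j s (swap l k p)) = (g Y i j s : EqMan l k → ℝ) := by
  have h : ∀ s, (fun p => partialX^[s] (gBase Z i j : EqMan k l → ℝ) (swap l k p)) =
      (partialX^[s] (gBase Y i j) : EqMan l k → ℝ) := fun s => by
    induction s with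
    | zero => rfl
    | succ s ih =>
      rw [Function.iterate_succ_apply', Function.iterate_succ_apply', ← ih, partialX_comp_swap]
  exact h s

theorem prolong_swap (v : Symb k l) : v.swap.prolong = swapMap k l v.prolong := by
  funext p
  refine Prod.ext rfl (Prod.ext (funext fun i => ?_) (funext fun i => ?_))
  · exact congrFun (prolongCoeff_swap Z v.a v.c i) p
  · exact congrFun (prolongCoeff_swap Y v.a v.b i) p

theorem prolongSpan_swap (S : Set (Symb k l)) :
    prolongSpan (Symb.swap '' S) = (prolongSpan S).map (swapMap k l) := by
  rw [prolongSpan, prolongSpan, Submodule.map_span, Set.image_image, Set.image_image]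
  simp only [prolong_swap]

theorem symmetrySpace_swap (δ : ℤ) :
    symmetrySpace l k (-δ) = (symmetrySpace k l δ).map (swapMap k l) := by
  ext V
  constructor
  · rintro ⟨W, hW, rfl⟩
    exact ⟨_, ⟨swapField W, swapField_mem' hW, rfl⟩, rfl⟩
  · rintro ⟨_, ⟨W, hW, rfl⟩, rfl⟩
    exact ⟨swapField W, swapField_mem hW, rfl⟩

/-- Transports a classification for k, l, δ to one for l, k, -δ. -/
theorem symmetrySpace_neg_eq {δ : ℤ} {S : Set (Symb k l)} {S' : Set (Symb l k)}
    (h : symmetrySpace k l δ = prolongSpan S) (hS : S' = Symb.swap '' S) :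
    symmetrySpace l k (-δ) = prolongSpan S' := by
  rw [symmetrySpace_swap, h, hS, prolongSpan_swap]

theorem commonGens_swap : commonGens l k = Symb.swap '' commonGens k l := by
  simp only [commonGens, Set.image_insert_eq, Set.image_singleton]
  ext v
  simp only [Set.mem_insert_iff, Set.mem_singleton_iff]
  refine or_congr Iff.rfl (or_congr Iff.rfl (or_congr Iff.rfl or_comm))

theorem powYGens_swap : powYGens l k = Symb.swap '' powZGens k l := by
  ext v
  constructor
  · rintro ⟨i, h, rfl⟩
    exact ⟨_, ⟨i, h, rfl⟩, rfl⟩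
  · rintro ⟨_, ⟨i, h, rfl⟩, rfl⟩
    exact ⟨i, h, rfl⟩

theorem outerYGens_eq_swap (d : ℕ) : outerYGens l k d = Symb.swap '' outerZGens k l d := by
  rw [outerZGens, Set.image_union, Set.image_union, ← commonGens_swap, ← powYGens_swap, outerYGens]
  congr 1
  have key : ∀ (i j : ℕ) (s : Fin j → ℕ),
      Symb.swap (⟨0, X ^ i * ∏ t, g Z d (l - d) (s t), 0⟩ : Symb k l) =
        ⟨0, 0, X ^ i * ∏ t, g Y d (l - d) (s t)⟩ := fun i j s => by
    refine Symb.ext rfl rfl (funext fun p => ?_)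
    change X p ^ i * (∏ t, g Z d (l - d) (s t)) (swap l k p) =
      X p ^ i * (∏ t, g Y d (l - d) (s t)) p
    rw [Finset.prod_apply, Finset.prod_apply]
    exact congrArg _ (Finset.prod_congr rfl fun t _ => congrFun (g_swap d (l - d) (s t)) p)
  ext v
  constructor
  · rintro ⟨i, j, s, hs, h, rfl⟩
    exact ⟨_, ⟨i, j, s, hs, h, rfl⟩, key i j s⟩
  · rintro ⟨_, ⟨i, j, s, hs, h, rfl⟩, rfl⟩
    exact ⟨i, j, s, hs, h, key i j s⟩

theorem contactYGens_eq_swap : contactYGens k = Symb.swap '' contactZGens k := by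
  rw [contactZGens, Set.image_union, contactYGens]
  congr 1
  · simp only [Set.image_insert_eq, Set.image_singleton]
    rfl
  · ext v
    constructor
    · rintro ⟨i, j₀, j₁, h, rfl⟩
      exact ⟨_, ⟨i, j₀, j₁, h, rfl⟩, rfl⟩
    · rintro ⟨_, ⟨i, j₀, j₁, h, rfl⟩, rfl⟩
      exact ⟨i, j₀, j₁, h, rfl⟩

theorem firstKindTwoGens_eq_swap :
    firstKindTwoGens k = Symb.swap '' (Trip.symb '' pointT k) := by
  rw [pointT, Set.image_union, Set.image_union, firstKindTwoGens]
  congr 1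
  · simp only [Set.image_insert_eq, Set.image_singleton]
    rfl
  · ext v
    constructor
    · rintro ⟨i, j, h, rfl⟩
      exact ⟨_, ⟨_, ⟨i, j, h, rfl⟩, rfl⟩, rfl⟩
    · rintro ⟨_, ⟨_, ⟨i, j, h, rfl⟩, rfl⟩, rfl⟩
      exact ⟨i, j, h, rfl⟩

/-! ### Other spanning sets of the symmetry algebras -/

/-- The triples of coefficients of the elements of `powYGens`. -/
def powYT (k l : ℕ) : Set (Trip k l) := {v | ∃ i : ℕ, i < k ∧ v = (0, cx ^ i, 0)}

/-- The triples of coefficients of the elements of `firstKindGens`, with the two dependent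
variables exchanged. -/
def firstT (k l : ℕ) : Set (Trip k l) :=
  commonT k l ∪ powZT k l ∪
    {v | ∃ i j : ℕ, i + (l - 1) * j ≤ k - 1 ∧ v = (0, cx ^ i * cz 0 ^ j, 0)}

/-- The triples of coefficients of the elements of `innerGens`. -/
def innerT (k l : ℕ) : Set (Trip k l) := commonT k l ∪ powYT k l ∪ powZT k l

/-- The triples of coefficients of the elements of `secondKindGens`. -/
def secondT (k l : ℕ) : Set (Trip k l) :=
  commonT k l ∪ powZT k l ∪ powYT k l ∪
    {v | ∃ s : ℕ, s ≤ l - k ∧ v = (0, gs cz (l - k) k s, 0)}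

theorem image_powZT : Trip.symb '' powZT k l = powZGens k l := by
  ext v
  constructor
  · rintro ⟨_, ⟨j, hj, rfl⟩, rfl⟩
    exact ⟨j, hj, rfl⟩
  · rintro ⟨j, hj, rfl⟩
    exact ⟨_, ⟨j, hj, rfl⟩, rfl⟩

theorem image_powYT : Trip.symb '' powYT k l = powYGens k l := by
  ext v
  constructor
  · rintro ⟨_, ⟨j, hj, rfl⟩, rfl⟩
    exact ⟨j, hj, rfl⟩
  · rintro ⟨j, hj, rfl⟩
    exact ⟨_, ⟨j, hj, rfl⟩, rfl⟩

theorem innerGens_eq : innerGens k l = Trip.symb '' innerT k l := by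
  rw [innerT, Set.image_union, Set.image_union, image_commonT, image_powYT, image_powZT, innerGens]

theorem secondKindGens_eq : secondKindGens k l = Trip.symb '' secondT k l := by
  rw [secondT, Set.image_union, Set.image_union, Set.image_union, image_commonT, image_powYT,
    image_powZT, secondKindGens]
  congr 1
  have key : ∀ s, Trip.symb ((0, gs cz (l - k) k s, 0) : Trip k l) = ⟨0, g Z (l - k) k s, 0⟩ :=
    fun s => Symb.ext rfl (gs_val _ _ _ _) rfl
  ext v
  constructor
  · rintro ⟨s, hs, rfl⟩
    exact ⟨_, ⟨s, hs, rfl⟩, key s⟩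
  · rintro ⟨_, ⟨s, hs, rfl⟩, rfl⟩
    exact ⟨s, hs, key s⟩

theorem firstKindGens_eq_swap :
    firstKindGens l k = Symb.swap '' (Trip.symb '' firstT k l) := by
  rw [firstT, Set.image_union, Set.image_union, Set.image_union, Set.image_union, image_commonT,
    image_powZT, ← commonGens_swap, ← powYGens_swap, firstKindGens]
  congr 1
  ext v
  constructor
  · rintro ⟨i, j, h, rfl⟩
    exact ⟨_, ⟨_, ⟨i, j, h, rfl⟩, rfl⟩, rfl⟩
  · rintro ⟨_, ⟨_, ⟨i, j, h, rfl⟩, rfl⟩, rfl⟩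
    exact ⟨i, j, h, rfl⟩

/-- At shift 0 the only g^{(s)} is z_0 / l!, so the generators agree up to nonzero factors. -/
theorem span_outerT_zero (hl : 0 < l) :
    Submodule.span ℝ (outerT k l 0) = Submodule.span ℝ (firstT k l) := by
  have key : ∀ (i j : ℕ) (s : Fin j → ℕ), (∀ t, s t ≤ 0) →
      ((0, cx ^ i * ∏ t, gs cz 0 (l - 0) (s t), 0) : Trip k l) =
        ((l.factorial : ℝ)⁻¹) ^ j • (0, cx ^ i * cz 0 ^ j, 0) := fun i j s hs => by
    rw [Finset.prod_congr rfl fun t _ => show gs cz 0 (l - 0) (s t) = (l.factorial : ℝ)⁻¹ • cz 0 by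
      rw [Nat.le_zero.1 (hs t), gs_zero_zero px_cz hl], Finset.prod_const, Finset.card_univ,
      Fintype.card_fin, smul_pow, Prod.smul_mk, Prod.smul_mk, smul_zero, mul_smul_comm]
  refine le_antisymm (Submodule.span_le.2 ?_) (Submodule.span_le.2 ?_)
  · rintro v (hv | ⟨i, j, s, hs, h, rfl⟩)
    · exact Submodule.subset_span (Or.inl hv)
    · rw [SetLike.mem_coe, key i j s hs]
      exact Submodule.smul_mem _ _ (Submodule.subset_span (Or.inr ⟨i, j, h, rfl⟩))
  · rintro v (hv | ⟨i, j, h, rfl⟩)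
    · exact Submodule.subset_span (Or.inl hv)
    · have h1 : ((l.factorial : ℝ)⁻¹) ^ j ≠ 0 :=
        pow_ne_zero _ (inv_ne_zero (Nat.cast_ne_zero.2 l.factorial_ne_zero))
      rw [SetLike.mem_coe, ← Submodule.smul_mem_iff _ h1, ← key i j (fun _ => 0) fun _ => le_rfl]
      exact Submodule.subset_span (Or.inr ⟨i, j, fun _ => 0, fun _ => le_rfl, h, rfl⟩)

/-- Each g^{(s)} has weight l - d - 1 ≥ k, exceeding the bound k - 1, so only powers of x remain. -/
theorem outerT_eq_innerT {d : ℕ} (hk : 0 < k) (h : d + k < l) : outerT k l d = innerT k l := by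
  rw [outerT, innerT, Set.union_right_comm]
  congr 2
  ext v
  constructor
  · rintro ⟨i, j, s, -, h', rfl⟩
    obtain rfl : j = 0 := by
      by_contra hj
      have := Nat.le_mul_of_pos_right (l - d - 1) (Nat.pos_of_ne_zero hj)
      omega
    exact ⟨i, by omega, by rw [Finset.univ_eq_empty, Finset.prod_empty, mul_one]⟩
  · rintro ⟨i, hi, rfl⟩
    exact ⟨i, 0, Fin.elim0, fun t => t.elim0, by omega,
      by rw [Finset.univ_eq_empty, Finset.prod_empty, mul_one]⟩

/-- Each g^{(s)} has weight exactly k - 1, so it can occur only once and without x. -/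
theorem outerT_eq_secondT (hk : 2 ≤ k) (h : k ≤ l) : outerT k l (l - k) = secondT k l := by
  rw [outerT, secondT, Set.union_assoc _ (powYT k l)]
  congr 1
  have hlk : l - (l - k) = k := by omega
  ext v
  constructor
  · rintro ⟨i, j, s, hs, h', rfl⟩
    rw [hlk] at h' ⊢
    rcases j with _ | _ | j
    · exact Or.inl ⟨i, by omega, by rw [Finset.univ_eq_empty, Finset.prod_empty, mul_one]⟩
    · obtain rfl : i = 0 := by omega
      exact Or.inr ⟨s 0, hs 0, by rw [Fin.prod_univ_one, pow_zero, one_mul]⟩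
    · have := Nat.mul_le_mul_left (k - 1) (show 2 ≤ j + 1 + 1 by omega)
      omega
  · rintro (⟨i, hi, rfl⟩ | ⟨s, hs, rfl⟩)
    · exact ⟨i, 0, Fin.elim0, fun t => t.elim0, by omega,
        by rw [Finset.univ_eq_empty, Finset.prod_empty, mul_one]⟩
    · refine ⟨0, 1, fun _ => s, fun _ => hs, by omega, ?_⟩
      rw [hlk, Fin.prod_univ_one, pow_zero, one_mul]

/-! ### The contact algebra and `csp(4, ℝ) ⋉ S^{k-1}(ℝ^4)` -/

/-- The homogeneous coordinates on the projective space with affine coordinates `x`, `z_0`, `z_1`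
in which the contact structure is given by the standard symplectic form. -/
def hcoord (k : ℕ) : Fin 2 ⊕ Fin 2 → Sm k 3 := Sum.elim ![1, cx] ![lu, -cz 1]

/-- Dehomogenization. -/
def dehom (k : ℕ) : MvPolynomial (Fin 2 ⊕ Fin 2) ℝ →ₐ[ℝ] Sm k 3 := MvPolynomial.aeval (hcoord k)

theorem dehom_X (i : Fin 2 ⊕ Fin 2) : dehom k (MvPolynomial.X i) = hcoord k i :=
  MvPolynomial.aeval_X _ _

theorem der_dehom (d : Derivation ℝ (Sm k 3) (Sm k 3)) (P : MvPolynomial (Fin 2 ⊕ Fin 2) ℝ) :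
    d (dehom k P) = ∑ i, dehom k (MvPolynomial.pderiv i P) * d (hcoord k i) := by
  induction P using MvPolynomial.induction_on with
  | C r =>
    simp only [MvPolynomial.pderiv_C, map_zero, zero_mul, Finset.sum_const_zero]
    rw [← MvPolynomial.algebraMap_eq, AlgHom.commutes, Derivation.map_algebraMap]
  | add P Q hP hQ =>
    simp only [map_add, hP, hQ, add_mul, Finset.sum_add_distrib]
  | mul_X P i hP =>
    simp only [Derivation.leibniz, map_mul, hP, MvPolynomial.pderiv_X, map_add, smul_eq_mul,
      dehom_X, add_mul, Finset.sum_add_distrib, Finset.mul_sum]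
    congr 1
    · rw [Finset.sum_eq_single i]
      · rw [Pi.single_eq_same, map_one, mul_one]
      · intro j _ hj
        rw [Pi.single_eq_of_ne hj.symm, map_zero, mul_zero, zero_mul]
      · exact fun h => absurd (Finset.mem_univ i) h
    · exact Finset.sum_congr rfl fun j _ => by ring

theorem dehom_matDer_X (A : Matrix (Fin 2 ⊕ Fin 2) (Fin 2 ⊕ Fin 2) ℝ) (i : Fin 2 ⊕ Fin 2) :
    dehom k (SymPow.matDer A (MvPolynomial.X i)) = ∑ j, A j i • hcoord k j := by
  rw [SymPow.matDer, MvPolynomial.mkDerivation_X, map_sum]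
  simp only [map_smul, dehom_X]

theorem dehom_val (P : MvPolynomial (Fin 2 ⊕ Fin 2) ℝ) (p : EqMan k 3) :
    (dehom k P).1 p = MvPolynomial.eval (fun i => (hcoord k i).1 p) P := by
  induction P using MvPolynomial.induction_on with
  | C r =>
    rw [MvPolynomial.eval_C, ← MvPolynomial.algebraMap_eq, AlgHom.commutes,
      Algebra.algebraMap_eq_smul_one, Sm.smul_val, Sm.one_val, mul_one]
  | add P Q hP hQ => rw [map_add, map_add, Sm.add_val, hP, hQ]
  | mul_X P i hP => rw [map_mul, map_mul, Sm.mul_val, hP, dehom_X, MvPolynomial.eval_X]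

theorem sum_eq_of_mem_support {n : ℕ} {P : MvPolynomial (Fin 2 ⊕ Fin 2) ℝ} (hP : P.IsHomogeneous n)
    {d : Fin 2 ⊕ Fin 2 →₀ ℕ} (hd : d ∈ P.support) : ∑ i, d i = n := by
  rw [← Finsupp.degree_eq_sum, Finsupp.degree_eq_weight_one]
  exact hP (MvPolynomial.mem_support_iff.1 hd)

theorem eval_mul_of_isHomogeneous {n : ℕ} {P : MvPolynomial (Fin 2 ⊕ Fin 2) ℝ}
    (hP : P.IsHomogeneous n) (t : ℝ) (c : Fin 2 ⊕ Fin 2 → ℝ) :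
    MvPolynomial.eval (fun i => t * c i) P = t ^ n * MvPolynomial.eval c P := by
  rw [MvPolynomial.eval_eq', MvPolynomial.eval_eq', Finset.mul_sum]
  refine Finset.sum_congr rfl fun d hd => ?_
  simp only [mul_pow, Finset.prod_mul_distrib]
  rw [Finset.prod_pow_eq_pow_sum, sum_eq_of_mem_support hP hd]
  ring

theorem exists_hcoord_eq {r : Fin 2 ⊕ Fin 2 → ℝ} (hr : r (Sum.inl 0) ≠ 0) :
    ∃ p : EqMan k 3, ∀ i, r (Sum.inl 0) * (hcoord k i).1 p = r i := by
  set t := r (Sum.inl 0)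
  set a := r (Sum.inl 1)
  set b := r (Sum.inr 0)
  set c := r (Sum.inr 1)
  -- The point solves x = a/t, x z_1 - 2 z_0 = b/t and -z_1 = c/t; the other coordinates do not
  -- matter.
  refine ⟨(a / t, 0, ![(a / t * (-(c / t)) - b / t) / 2, -(c / t), 0]), fun i => ?_⟩
  rcases i with i | i <;> fin_cases i
  · exact mul_one t
  · exact mul_div_cancel₀ a hr
  · change t * (lu : Sm k 3).1 _ = b
    rw [lu_three, ← two_smul_eq]
    simp only [Sm.sub_val, Sm.mul_val, Sm.smul_val, cx_val, cz_val, Z]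
    simp only [show (0 : ℕ) < 3 by omega, show (1 : ℕ) < 3 by omega, dite_true]
    change t * (a / t * (-(c / t)) - 2 * ((a / t * (-(c / t)) - b / t) / 2)) = b
    field_simp
    ring
  · change t * (-cz 1 : Sm k 3).1 _ = c
    simp only [Sm.neg_val, cz_val, Z, show (1 : ℕ) < 3 by omega, dite_true]
    change t * -(-(c / t)) = c
    rw [neg_neg, mul_div_cancel₀ c hr]

/-- Every vector with nonzero first entry is a multiple of a value of `hcoord`, so by homogeneity P
vanishes there. Multiplying P by the first variable covers the remaining vectors. -/
theorem dehom_injective {n : ℕ} {P : MvPolynomial (Fin 2 ⊕ Fin 2) ℝ} (hP : P.IsHomogeneous n)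
    (h : dehom k P = 0) : P = 0 := by
  have h2 : MvPolynomial.X (Sum.inl 0) * P = 0 := by
    refine MvPolynomial.funext fun r => ?_
    rw [map_mul, MvPolynomial.eval_X, map_zero]
    by_cases hr : r (Sum.inl 0) = 0
    · rw [hr, zero_mul]
    · obtain ⟨p, hp⟩ := exists_hcoord_eq (k := k) hr
      have h3 := eval_mul_of_isHomogeneous hP (r (Sum.inl 0)) fun i => (hcoord k i).1 p
      rw [← dehom_val, h, Sm.zero_val, mul_zero, funext hp] at h3
      rw [h3, mul_zero]
  exact (mul_eq_zero.1 h2).resolve_left (MvPolynomial.X_ne_zero _)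

theorem hcoord_mem_Fn (i : Fin 2 ⊕ Fin 2) : hcoord k i ∈ Fn 0 2 := by
  rcases i with i | i <;> fin_cases i
  · exact one_mem _
  · exact cx_mem_Fn _ _
  · exact lu_mem_Fn _
  · exact neg_mem (cz_mem_Fn _ (by omega))

theorem dehom_mem_Fn (P : MvPolynomial (Fin 2 ⊕ Fin 2) ℝ) : dehom k P ∈ Fn 0 2 := by
  induction P using MvPolynomial.induction_on with
  | C r =>
    rw [← MvPolynomial.algebraMap_eq, AlgHom.commutes]
    exact Subalgebra.algebraMap_mem _ _
  | add P Q hP hQ => rw [map_add]; exact add_mem hP hQ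
  | mul_X P i hP => rw [map_mul, dehom_X]; exact mul_mem hP (hcoord_mem_Fn i)

theorem hcoord_mem_Pn (i : Fin 2 ⊕ Fin 2) : hcoord k i ∈ Pn 2 := by
  rcases i with i | i <;> fin_cases i
  · exact Pn_mono (by omega) one_mem_Pn
  · exact cx_mem_Pn
  · exact lu_mem_Pn (by omega)
  · exact neg_mem (cz_mem_Pn (by omega))

theorem dehom_mem_Pn {n : ℕ} {P : MvPolynomial (Fin 2 ⊕ Fin 2) ℝ} (hP : P.IsHomogeneous n) :
    dehom k P ∈ Pn (n + 1) := by
  rw [dehom, MvPolynomial.aeval_def, MvPolynomial.eval₂_eq']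
  refine sum_mem fun d hd => ?_
  rw [← Algebra.smul_def, ← sum_eq_of_mem_support hP hd]
  refine Submodule.smul_mem _ _ ?_
  generalize (Finset.univ : Finset (Fin 2 ⊕ Fin 2)) = s
  induction s using Finset.induction_on with
  | empty => exact Pn_mono (by simp) one_mem_Pn
  | insert i s hi ih =>
    rw [Finset.prod_insert hi, Finset.sum_insert hi]
    have := pow_mem_Pn (a := 1) (hcoord_mem_Pn (k := k) i) (d i)
    rw [mul_one] at this
    exact mul_mem_Pn this ih

/-! ### Symmetries as projective maps with a fibre coordinate of degree k - 1. -/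

/-- The relation between a symmetry of the system of shift `1` and its image in
`csp(4, ℝ) ⋉ S^{k-1}(ℝ^4)`. -/
def Rel (V : VField k 3) (A : Matrix (Fin 2 ⊕ Fin 2) (Fin 2 ⊕ Fin 2) ℝ)
    (P : MvPolynomial (Fin 2 ⊕ Fin 2) ℝ) : Prop :=
  (∀ i, der V (hcoord k i) = dehom k (SymPow.matDer A (MvPolynomial.X i)) -
      hcoord k i * dehom k (SymPow.matDer A (MvPolynomial.X (Sum.inl 0)))) ∧
    der V (cy 0) = dehom k P -
      ((k : ℝ) - 1) • (dehom k (SymPow.matDer A (MvPolynomial.X (Sum.inl 0))) * cy 0)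

namespace Rel

variable {V W : VField k 3} {A B : Matrix (Fin 2 ⊕ Fin 2) (Fin 2 ⊕ Fin 2) ℝ}
  {P Q : MvPolynomial (Fin 2 ⊕ Fin 2) ℝ}

protected theorem add (h : Rel V A P) (h' : Rel W B Q) : Rel (V + W) (A + B) (P + Q) := by
  refine ⟨fun i => ?_, ?_⟩
  · rw [der_add, h.1, h'.1, SymPow.matDer_add, Derivation.add_apply, Derivation.add_apply, map_add,
      map_add]
    ring
  · rw [der_add, h.2, h'.2, SymPow.matDer_add, Derivation.add_apply, map_add, map_add, add_mul,
      smul_add]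
    ring

protected theorem smul (t : ℝ) (h : Rel V A P) : Rel (t • V) (t • A) (t • P) := by
  refine ⟨fun i => ?_, ?_⟩
  · rw [der_smul, h.1, SymPow.matDer_smul, Derivation.smul_apply, Derivation.smul_apply, map_smul,
      map_smul, mul_smul_comm, smul_sub]
  · rw [der_smul, h.2, SymPow.matDer_smul, Derivation.smul_apply, map_smul, map_smul, smul_mul_assoc,
      smul_sub, smul_comm t]

protected theorem sub (h : Rel V A P) (h' : Rel W B Q) : Rel (V - W) (A - B) (P - Q) := by
  have := h.add (h'.smul (-1))
  simpa only [neg_smul, one_smul, ← sub_eq_add_neg] using this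

/-- The affine field is the linear one minus the multiple of the Euler field that keeps the first
homogeneous coordinate equal to 1. On degree n, Euler's identity turns this correction into a factor
n. -/
theorem der_dehom {n : ℕ} (h : Rel V A P) (hQ : Q.IsHomogeneous n) :
    der V (dehom k Q) = dehom k (SymPow.matDer A Q) -
      n * (dehom k (SymPow.matDer A (MvPolynomial.X (Sum.inl 0))) * dehom k Q) := by
  have h1 : SymPow.matDer A Q =
      ∑ i, MvPolynomial.pderiv i Q * SymPow.matDer A (MvPolynomial.X i) := by
    rw [SymPow.matDer_eq]
    simp only [SymPow.matDer, MvPolynomial.mkDerivation_X]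
  have h2 : (n : Sm k 3) * dehom k Q =
      ∑ i, dehom k (MvPolynomial.pderiv i Q) * hcoord k i := by
    have := congrArg (dehom k) hQ.sum_X_mul_pderiv
    rw [map_nsmul, nsmul_eq_mul, map_sum] at this
    rw [← this]
    exact Finset.sum_congr rfl fun i _ => by rw [map_mul, dehom_X, mul_comm]
  rw [EqMan.der_dehom, h1, map_sum, mul_left_comm, h2, Finset.mul_sum, ← Finset.sum_sub_distrib]
  refine Finset.sum_congr rfl fun i _ => ?_
  rw [h.1, map_mul]
  ring

/-- The normalizing corrections cancel under antisymmetrization, because a function of degree n, and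
likewise y_0 with n = k - 1, is corrected by n times the same factor. -/
protected theorem lie (hk : 0 < k) (h : Rel V A P) (h' : Rel W B Q)
    (hP : P.IsHomogeneous (k - 1)) (hQ : Q.IsHomogeneous (k - 1)) :
    Rel ⁅V, W⁆ ⁅A, B⁆ (SymPow.matDer A Q - SymPow.matDer B P) := by
  have hX : ∀ (C : Matrix (Fin 2 ⊕ Fin 2) (Fin 2 ⊕ Fin 2) ℝ) (i : Fin 2 ⊕ Fin 2),
      (SymPow.matDer C (MvPolynomial.X i)).IsHomogeneous 1 := fun C i =>
    SymPow.matDer_mem C (MvPolynomial.isHomogeneous_X ℝ i)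
  have hb : ∀ i, dehom k (SymPow.matDer ⁅A, B⁆ (MvPolynomial.X i)) =
      dehom k (SymPow.matDer A (SymPow.matDer B (MvPolynomial.X i))) -
        dehom k (SymPow.matDer B (SymPow.matDer A (MvPolynomial.X i))) := fun i => by
    rw [SymPow.matDer_lie, Derivation.commutator_apply, map_sub]
  have hk1 : ((k : ℝ) - 1) = ((k - 1 : ℕ) : ℝ) := by rw [Nat.cast_sub hk, Nat.cast_one]
  refine ⟨fun i => ?_, ?_⟩
  · rw [der_lie, h.1, h'.1, map_sub, map_sub, Derivation.leibniz, Derivation.leibniz,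
      h.der_dehom (hX B i), h.der_dehom (hX B _), h'.der_dehom (hX A i), h'.der_dehom (hX A _), h.1,
      h'.1, hb, hb, smul_eq_mul, smul_eq_mul, smul_eq_mul, smul_eq_mul, Nat.cast_one]
    ring
  · rw [der_lie, h.2, h'.2, map_sub, map_sub, Derivation.map_smul, Derivation.map_smul,
      Derivation.leibniz, Derivation.leibniz, h.der_dehom (hX B _), h'.der_dehom (hX A _), h.2, h'.2,
      h.der_dehom hQ, h'.der_dehom hP, hb, map_sub, hk1]
    simp only [Algebra.smul_def, Algebra.algebraMap_self_apply, Nat.cast_one, map_natCast]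
    ring

/-- The y_0-derivative of the second relation isolates k - 1 times the normalizing factor, which
therefore vanishes. This detects the scalar matrices, invisible on projective space. The rest is
injectivity of dehomogenization. -/
theorem eq_zero (hk : 2 ≤ k) {n : ℕ} (h : Rel (0 : VField k 3) A P) (hP : P.IsHomogeneous n) :
    A = 0 ∧ P = 0 := by
  obtain ⟨h1, h2⟩ := h
  have h3 : dehom k (SymPow.matDer A (MvPolynomial.X (Sum.inl 0))) = 0 := by
    have := congrArg (pY 0) h2
    rw [der_zero, map_zero, map_sub, (dehom_mem_Fn P).1 0 le_rfl, Derivation.map_smul, Derivation.leibniz,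
      (dehom_mem_Fn _).1 0 le_rfl, pY_cy, if_pos ⟨rfl, by omega⟩, smul_zero, add_zero, zero_sub, smul_eq_mul,
      mul_one, eq_comm, neg_eq_zero] at this
    refine (smul_eq_zero.1 this).resolve_left ?_
    have : (2 : ℝ) ≤ k := by exact_mod_cast hk
    linarith
  rw [h3, zero_mul, smul_zero, sub_zero, der_zero] at h2
  refine ⟨?_, dehom_injective hP h2.symm⟩
  ext i j
  have h4 := h1 j
  rw [h3, mul_zero, sub_zero, der_zero] at h4
  have h5 := dehom_injective (SymPow.matDer_mem A (MvPolynomial.isHomogeneous_X ℝ j)) h4.symm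
  have h6 := congrArg (MvPolynomial.coeff (Finsupp.single i 1)) h5
  rw [SymPow.matDer, MvPolynomial.mkDerivation_X, MvPolynomial.coeff_sum] at h6
  simpa [MvPolynomial.coeff_smul, MvPolynomial.coeff_single_X] using h6

end Rel

/-! ### The generators matched with the eleven parameters of csp(4), and the isomorphism. -/

/-- The elements of `csp(4, ℝ)`. -/
def cspMat (t₁ t₂ t₃ t₄ t₅ t₆ t₇ t₈ t₉ t₁₀ t₁₁ : ℝ) :
    Matrix (Fin 2 ⊕ Fin 2) (Fin 2 ⊕ Fin 2) ℝ :=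
  Matrix.fromBlocks !![t₆, t₈; -t₃, t₄ + t₆] !![-(2 * t₉), -t₁₀; -t₁₀, -(2 * t₁₁)]
    !![t₁, -t₂; -t₂, -t₇] !![t₅ + t₆, t₃; -t₈, t₅ + t₆ - t₄]

/-- The combination of the generators in `contactT` that corresponds to `cspMat`. -/
def contactComb (k : ℕ) (t₁ t₂ t₃ t₄ t₅ t₆ t₇ t₈ t₉ t₁₀ t₁₁ : ℝ) : Trip k 3 :=
  t₁ • (cx * (2 * cz 0 - cx * cz 1), ((k : ℝ) - 1) • (cy 0 * (2 * cz 0 - cx * cz 1)),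
      2 * cz 0 ^ 2 - (1 / 2 : ℝ) • (cx ^ 2 * cz 1 ^ 2)) +
    (t₂ • (2 * (cz 0 - cx * cz 1), -(((k : ℝ) - 1) • (cy 0 * cz 1)), -(cx * cz 1 ^ 2)) +
    (t₃ • (cx ^ 2, ((k : ℝ) - 1) • (cx * cy 0), 2 * cx * cz 0) +
    (t₄ • (cx, 0, 0) + (t₅ • (0, 0, cz 0) + (-(((k : ℝ) - 1) * t₆) • (0, cy 0, 0) +
    (t₇ • (cz 1, 0, (1 / 2 : ℝ) • cz 1 ^ 2) + (t₈ • (1, 0, 0) + (t₉ • (0, 0, 1) +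
    (t₁₀ • (0, 0, cx) + t₁₁ • (0, 0, cx ^ 2))))))))))

theorem contactComb_mem (t₁ t₂ t₃ t₄ t₅ t₆ t₇ t₈ t₉ t₁₀ t₁₁ : ℝ) :
    contactComb k t₁ t₂ t₃ t₄ t₅ t₆ t₇ t₈ t₉ t₁₀ t₁₁ ∈ Submodule.span ℝ (contactT k) := by
  refine add_mem ?_ (add_mem ?_ (add_mem ?_ (add_mem ?_ (add_mem ?_ (add_mem ?_ (add_mem ?_
    (add_mem ?_ (add_mem ?_ (add_mem ?_ ?_)))))))))
  all_goals
    exact Submodule.smul_mem _ _ (Submodule.subset_span (Or.inl (by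
      simp only [Set.mem_insert_iff, Set.mem_singleton_iff, true_or, or_true])))

/-- A comparison of the action on 1, x, `lu`, -z_1 and y_0 with the columns of the matrix. The
parameter t₆ multiplies the identity matrix and acts on y_0 only. -/
theorem rel_contactComb (hk : 0 < k) (t₁ t₂ t₃ t₄ t₅ t₆ t₇ t₈ t₉ t₁₀ t₁₁ : ℝ) :
    Rel (prolongV (contactComb k t₁ t₂ t₃ t₄ t₅ t₆ t₇ t₈ t₉ t₁₀ t₁₁))
      (cspMat t₁ t₂ t₃ t₄ t₅ t₆ t₇ t₈ t₉ t₁₀ t₁₁) 0 := by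
  have hh := two_mul_half (k := k) (l := 3)
  set v := contactComb k t₁ t₂ t₃ t₄ t₅ t₆ t₇ t₈ t₉ t₁₀ t₁₁ with hv
  set C : ℝ →+* Sm k 3 := algebraMap ℝ (Sm k 3) with hC
  have ha : v.1 = C t₁ * (cx * (2 * cz 0 - cx * cz 1)) + C t₂ * (2 * (cz 0 - cx * cz 1)) +
      C t₃ * cx ^ 2 + C t₄ * cx + C t₇ * cz 1 + C t₈ := by
    simp only [hv, contactComb, Prod.smul_mk, Prod.mk_add_mk]
    simp only [Algebra.smul_def, ← hC]
    ring
  have hb : v.2.1 = (C k - 1) * (C t₁ * (cy 0 * (2 * cz 0 - cx * cz 1)) -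
      C t₂ * (cy 0 * cz 1) + C t₃ * (cx * cy 0) - C t₆ * cy 0) := by
    simp only [hv, contactComb, Prod.smul_mk, Prod.mk_add_mk]
    simp only [Algebra.smul_def, ← hC, map_sub,
      map_neg, map_mul, map_one]
    ring
  have hc : v.2.2 = C t₁ * (2 * cz 0 ^ 2 - C (1 / 2) * (cx ^ 2 * cz 1 ^ 2)) -
      C t₂ * (cx * cz 1 ^ 2) + C t₃ * (2 * cx * cz 0) + C t₅ * cz 0 +
      C t₇ * (C (1 / 2) * cz 1 ^ 2) + C t₉ + C t₁₀ * cx + C t₁₁ * cx ^ 2 := by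
    simp only [hv, contactComb, Prod.smul_mk, Prod.mk_add_mk]
    simp only [Algebra.smul_def, ← hC]
    ring
  have hx : der (prolongV v) cx = v.1 := der_prolongV_cx v
  have hz : der (prolongV v) (cz 0) = v.2.2 := der_prolongV_cz v (by omega)
  have hz1 : der (prolongV v) (cz 1) = dD v.2.2 - cz 1 * dD v.1 :=
    der_prolongV_cz v (by omega)
  have hdC : ∀ t, dD (C t) = 0 := fun t => Derivation.map_algebraMap _ _
  have hz1' : der (prolongV v) (cz 1) = C t₁₀ + 2 * C t₁₁ * cx - C t₃ * lu +
      (C t₅ - C t₄) * cz 1 - cz 1 * (-C t₃ * cx + C t₁ * lu + C t₂ * cz 1) := by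
    rw [hz1, ha, hc, lu_three]
    simp only [map_add, map_sub, Derivation.leibniz, Derivation.leibniz_pow, dD_cx, dD_cz, hdC,
      derivation_two, smul_eq_mul, nsmul_eq_mul, Nat.cast_ofNat, Nat.add_one_sub_one, pow_one]
    linear_combination (C t₇ * cz 1 * cz 2 - C t₁ * (cx * cz 1 ^ 2 + cx ^ 2 * cz 1 * cz 2)) * hh
  have hA : ∀ i, dehom k (SymPow.matDer (cspMat t₁ t₂ t₃ t₄ t₅ t₆ t₇ t₈ t₉ t₁₀ t₁₁)
      (MvPolynomial.X i)) = _ := fun i => dehom_matDer_X _ i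
  simp only [Fintype.sum_sum_type, Fin.sum_univ_two, Algebra.smul_def, ← hC] at hA
  have h0 := hA (Sum.inl 0)
  have h1 := hA (Sum.inl 1)
  have h2 := hA (Sum.inr 0)
  have h3 := hA (Sum.inr 1)
  simp only [cspMat, hcoord, Matrix.fromBlocks_apply₁₁, Matrix.fromBlocks_apply₁₂,
    Matrix.fromBlocks_apply₂₁, Matrix.fromBlocks_apply₂₂, Matrix.of_apply, Matrix.cons_val_zero,
    Matrix.cons_val_one, Sum.elim_inl, Sum.elim_inr, map_neg, map_mul, map_add, map_sub,
    map_ofNat] at h0 h1 h2 h3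
  refine ⟨fun i => ?_, ?_⟩
  · rcases i with i | i <;> fin_cases i
    · change der (prolongV v) 1 = dehom k (SymPow.matDer _ (MvPolynomial.X (Sum.inl 0))) -
        1 * dehom k (SymPow.matDer _ (MvPolynomial.X (Sum.inl 0)))
      rw [Derivation.map_one_eq_zero, one_mul, sub_self]
    · change der (prolongV v) cx = dehom k (SymPow.matDer _ (MvPolynomial.X (Sum.inl 1))) -
        cx * dehom k (SymPow.matDer _ (MvPolynomial.X (Sum.inl 0)))
      rw [hx, ha, cspMat, h0, h1, lu_three]
      ring
    · change der (prolongV v) lu = dehom k (SymPow.matDer _ (MvPolynomial.X (Sum.inr 0))) -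
        lu * dehom k (SymPow.matDer _ (MvPolynomial.X (Sum.inl 0)))
      rw [lu_three, map_sub, Derivation.leibniz, Derivation.leibniz, hx, hz, hz1', ha, hc, cspMat,
        h0, h2, lu_three, derivation_two, smul_eq_mul, smul_eq_mul, smul_eq_mul, smul_zero]
      linear_combination (C t₁ * cx ^ 2 * cz 1 ^ 2 - C t₇ * cz 1 ^ 2) * hh
    · change der (prolongV v) (-cz 1) = dehom k (SymPow.matDer _ (MvPolynomial.X (Sum.inr 1))) -
        -cz 1 * dehom k (SymPow.matDer _ (MvPolynomial.X (Sum.inl 0)))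
      rw [map_neg, hz1', cspMat, h0, h3]
      ring
  · rw [der_prolongV_cy v hk, pcoeff, hb, cspMat, h0, map_zero, Algebra.smul_def, ← hC, map_sub,
      map_one, lu_three]
    ring

theorem cspMat_mem (t₁ t₂ t₃ t₄ t₅ t₆ t₇ t₈ t₉ t₁₀ t₁₁ : ℝ) :
    cspMat t₁ t₂ t₃ t₄ t₅ t₆ t₇ t₈ t₉ t₁₀ t₁₁ ∈ csp4 := by
  refine ⟨t₅ + 2 * t₆, ?_⟩
  rw [cspMat, Matrix.J, Matrix.fromBlocks_transpose, Matrix.fromBlocks_multiply,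
    Matrix.fromBlocks_multiply, Matrix.fromBlocks_add, Matrix.fromBlocks_smul]
  congr 1 <;> ext i j <;> fin_cases i <;> fin_cases j <;> simp <;> ring

theorem exists_cspMat_eq {A : Matrix (Fin 2 ⊕ Fin 2) (Fin 2 ⊕ Fin 2) ℝ} (hA : A ∈ csp4) :
    ∃ t₁ t₂ t₃ t₄ t₅ t₆ t₇ t₈ t₉ t₁₀ t₁₁ : ℝ,
      A = cspMat t₁ t₂ t₃ t₄ t₅ t₆ t₇ t₈ t₉ t₁₀ t₁₁ := by
  obtain ⟨c, hc⟩ := hA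
  rw [← Matrix.fromBlocks_toBlocks A] at hc ⊢
  generalize A.toBlocks₁₁ = P at hc ⊢
  generalize A.toBlocks₁₂ = Q at hc ⊢
  generalize A.toBlocks₂₁ = R at hc ⊢
  generalize A.toBlocks₂₂ = S at hc ⊢
  rw [Matrix.J, Matrix.fromBlocks_transpose, Matrix.fromBlocks_multiply,
    Matrix.fromBlocks_multiply, Matrix.fromBlocks_add, Matrix.fromBlocks_smul,
    Matrix.fromBlocks_inj] at hc
  obtain ⟨h₁, h₂, -, h₄⟩ := hc
  have hR := congrFun₂ h₁ 0 1
  have hQ := congrFun₂ h₄ 0 1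
  have hS := fun i j => congrFun₂ h₂ i j
  simp at hR hQ
  refine ⟨R 0 0, -R 0 1, -P 1 0, P 1 1 - P 0 0, S 0 0 - P 0 0, P 0 0, -R 1 1, P 0 1, -(Q 0 0 / 2),
    -Q 0 1, -(Q 1 1 / 2), ?_⟩
  have h00 := hS 0 0
  have h01 := hS 0 1
  have h10 := hS 1 0
  have h11 := hS 1 1
  simp at h00 h01 h10 h11
  rw [cspMat]
  congr 1 <;> ext i j <;> fin_cases i <;> fin_cases j <;> simp <;> linarith

theorem matDer_zero : SymPow.matDer 0 = 0 := by
  simpa only [zero_smul] using SymPow.matDer_smul 0 0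

theorem rel_dehom (hk : 0 < k) (P : MvPolynomial (Fin 2 ⊕ Fin 2) ℝ) :
    Rel (prolongV (0, dehom k P, 0)) 0 P := by
  set v : Trip k 3 := (0, dehom k P, 0) with hv
  have hx : der (prolongV v) cx = 0 := der_prolongV_cx v
  have hz : der (prolongV v) (cz 0) = 0 := der_prolongV_cz v (by omega)
  have hz1 : der (prolongV v) (cz 1) = 0 := by
    rw [der_prolongV_cz v (by omega), pcoeff, pcoeff, hv, map_zero, mul_zero, sub_zero]
  simp only [Rel, matDer_zero, Derivation.zero_apply, map_zero, mul_zero, zero_mul, smul_zero,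
    sub_zero]
  refine ⟨fun i => ?_, der_prolongV_cy v hk⟩
  rcases i with i | i <;> fin_cases i
  · exact Derivation.map_one_eq_zero _
  · exact hx
  · change der (prolongV v) lu = 0
    rw [lu, map_sub, Derivation.leibniz, Derivation.map_smul, hx, hz, hz1, smul_zero, smul_zero,
      smul_zero, add_zero, sub_zero]
  · change der (prolongV v) (-cz 1) = 0
    rw [map_neg, hz1, neg_zero]

theorem exists_rel (hk : 2 ≤ k) {V : VField k 3} (hV : V ∈ symmetryAlgebra k 3 (1 : ℕ)) :
    ∃ A ∈ csp4, ∃ P : MvPolynomial (Fin 2 ⊕ Fin 2) ℝ, P.IsHomogeneous (k - 1) ∧ Rel V A P := by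
  have h1 : V ∈ (symTrip k 3 1).map prolongV := by rwa [map_prolongV_symTrip]
  obtain ⟨v, hv, rfl⟩ := h1
  rw [symTrip_eq_span_contactT hk] at hv
  induction hv using Submodule.span_induction with
  | zero =>
    refine ⟨0, zero_mem _, 0, MvPolynomial.isHomogeneous_zero _ _ _, ?_⟩
    have := rel_dehom (k := k) (by omega) 0
    rwa [map_zero] at this
  | add v w hv hw ihv ihw =>
    rw [← symTrip_eq_span_contactT hk] at hv hw
    obtain ⟨A, hA, P, hP, h⟩ := ihv hv
    obtain ⟨B, hB, Q, hQ, h'⟩ := ihw hw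
    rw [map_add]
    exact ⟨_, add_mem hA hB, _, hP.add hQ, h.add h'⟩
  | smul t v hv ih =>
    rw [← symTrip_eq_span_contactT hk] at hv
    obtain ⟨A, hA, P, hP, h⟩ := ih hv
    rw [map_smul]
    exact ⟨_, csp4.smul_mem t hA, _,
      Submodule.smul_mem (MvPolynomial.homogeneousSubmodule _ _ _) t hP, h.smul t⟩
  | mem v hv =>
    have key : ∀ t₁ t₂ t₃ t₄ t₅ t₆ t₇ t₈ t₉ t₁₀ t₁₁ : ℝ,
        contactComb k t₁ t₂ t₃ t₄ t₅ t₆ t₇ t₈ t₉ t₁₀ t₁₁ = v → ∃ A ∈ csp4,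
          ∃ P : MvPolynomial (Fin 2 ⊕ Fin 2) ℝ, P.IsHomogeneous (k - 1) ∧ Rel (prolongV v) A P := by
      rintro t₁ t₂ t₃ t₄ t₅ t₆ t₇ t₈ t₉ t₁₀ t₁₁ rfl
      exact ⟨_, cspMat_mem .., 0, MvPolynomial.isHomogeneous_zero _ _ _,
        rel_contactComb (by omega) ..⟩
    -- The identity matrix acts as -(k - 1) y_0 ∂_{y_0}, so y_0 ∂_{y_0} itself requires this
    -- inverse.
    have hk1 : -(((k : ℝ) - 1) * -((k : ℝ) - 1)⁻¹) = 1 := by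
      have : (2 : ℝ) ≤ k := by exact_mod_cast hk
      rw [mul_neg, neg_neg, mul_inv_cancel₀ (by linarith)]
    rcases hv with (rfl | rfl | rfl | rfl | rfl | rfl | rfl | rfl | rfl | rfl | rfl) |
      ⟨i, j₀, j₁, h, rfl⟩
    · refine key 1 0 0 0 0 0 0 0 0 0 0 ?_
      simp only [contactComb, mul_zero, neg_zero, zero_smul, one_smul, add_zero]
    · refine key 0 1 0 0 0 0 0 0 0 0 0 ?_
      simp only [contactComb, mul_zero, neg_zero, zero_smul, one_smul, add_zero, zero_add]
    · refine key 0 0 1 0 0 0 0 0 0 0 0 ?_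
      simp only [contactComb, mul_zero, neg_zero, zero_smul, one_smul, add_zero, zero_add]
    · refine key 0 0 0 1 0 0 0 0 0 0 0 ?_
      simp only [contactComb, mul_zero, neg_zero, zero_smul, one_smul, add_zero, zero_add]
    · refine key 0 0 0 0 1 0 0 0 0 0 0 ?_
      simp only [contactComb, mul_zero, neg_zero, zero_smul, one_smul, add_zero, zero_add]
    · refine key 0 0 0 0 0 (-((k : ℝ) - 1)⁻¹) 0 0 0 0 0 ?_
      simp only [contactComb, hk1, zero_smul, one_smul, add_zero, zero_add]
    · refine key 0 0 0 0 0 0 1 0 0 0 0 ?_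
      simp only [contactComb, mul_zero, neg_zero, zero_smul, one_smul, add_zero, zero_add]
    · refine key 0 0 0 0 0 0 0 1 0 0 0 ?_
      simp only [contactComb, mul_zero, neg_zero, zero_smul, one_smul, add_zero, zero_add]
    · refine key 0 0 0 0 0 0 0 0 1 0 0 ?_
      simp only [contactComb, mul_zero, neg_zero, zero_smul, one_smul, add_zero, zero_add]
    · refine key 0 0 0 0 0 0 0 0 0 1 0 ?_
      simp only [contactComb, mul_zero, neg_zero, zero_smul, one_smul, add_zero, zero_add]
    · refine key 0 0 0 0 0 0 0 0 0 0 1 ?_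
      simp only [contactComb, mul_zero, neg_zero, zero_smul, one_smul, zero_add]
    -- The monomial is homogenized to degree k - 1 by powers of the first variable; the sign
    -- compensates for the last homogeneous coordinate being -z_1.
    · refine ⟨0, zero_mem _, MvPolynomial.X (Sum.inl 0) ^ (k - 1 - (i + j₀ + j₁)) *
        (MvPolynomial.X (Sum.inl 1) ^ i * (MvPolynomial.X (Sum.inr 0) ^ j₀ *
          (-MvPolynomial.X (Sum.inr 1)) ^ j₁)), ?_, ?_⟩
      · have hX : ∀ i, (MvPolynomial.X i : MvPolynomial (Fin 2 ⊕ Fin 2) ℝ).IsHomogeneous 1 :=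
          MvPolynomial.isHomogeneous_X ℝ
        have := ((hX (Sum.inl 0)).pow (k - 1 - (i + j₀ + j₁))).mul (((hX (Sum.inl 1)).pow i).mul
          (((hX (Sum.inr 0)).pow j₀).mul ((hX (Sum.inr 1)).neg.pow j₁)))
        convert this using 1
        omega
      · convert rel_dehom (k := k) (by omega) _ using 4
        simp only [map_mul, map_pow, map_neg, dehom_X, hcoord, Sum.elim_inl, Sum.elim_inr,
          Matrix.cons_val_zero, Matrix.cons_val_one, lu_three, neg_neg, one_pow, one_mul, mul_assoc]

theorem rel_surjective (hk : 2 ≤ k) {A : Matrix (Fin 2 ⊕ Fin 2) (Fin 2 ⊕ Fin 2) ℝ} (hA : A ∈ csp4)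
    {P : MvPolynomial (Fin 2 ⊕ Fin 2) ℝ} (hP : P.IsHomogeneous (k - 1)) :
    ∃ V ∈ symmetryAlgebra k 3 (1 : ℕ), Rel V A P := by
  obtain ⟨t₁, t₂, t₃, t₄, t₅, t₆, t₇, t₈, t₉, t₁₀, t₁₁, rfl⟩ := exists_cspMat_eq hA
  have h1 := rel_contactComb (k := k) (by omega) t₁ t₂ t₃ t₄ t₅ t₆ t₇ t₈ t₉ t₁₀ t₁₁
  have h2 := contactComb_mem (k := k) t₁ t₂ t₃ t₄ t₅ t₆ t₇ t₈ t₉ t₁₀ t₁₁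
  rw [← symTrip_eq_span_contactT hk] at h2
  have h3 : ((0, dehom k P, 0) : Trip k 3) ∈ symTrip k 3 1 := by
    refine symm_of_proj (by omega) (by omega) (zero_mem _)
      (Fn_mono (Nat.zero_le _) le_rfl (dehom_mem_Fn P)) (zero_mem _) ?_ ?_ <;>
      rw [mul_zero, sub_zero]
    · exact Pn_mono (by omega) (dehom_mem_Pn hP)
    · exact zero_mem _
  refine ⟨_, add_mem (Submodule.mem_comap.1 h2) (Submodule.mem_comap.1 h3), ?_⟩
  have := h1.add (rel_dehom (by omega) P)
  rwa [add_zero, zero_add] at this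

/-- The field kills x, z_1, `lu` and y_0, hence also z_0, and a symmetry is the prolongation of its
symbol. -/
theorem Rel.eq_zero_of_zero {V : VField k 3} (hV : V ∈ symmetryAlgebra k 3 (1 : ℕ))
    (h : Rel V 0 0) : V = 0 := by
  obtain ⟨h1, h2⟩ := h
  simp only [matDer_zero, Derivation.zero_apply, map_zero, mul_zero, zero_mul, sub_self,
    smul_zero] at h1 h2
  have hx : der V cx = 0 := h1 (Sum.inl 1)
  have hz1 : der V (cz 1) = 0 := by
    have h3 : der V (-cz 1) = 0 := h1 (Sum.inr 1)
    rwa [map_neg, neg_eq_zero] at h3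
  have hz : der V (cz 0) = 0 := by
    have h3 : der V lu = 0 := h1 (Sum.inr 0)
    rw [lu_three, map_sub, Derivation.leibniz, Derivation.leibniz, hx, hz1, derivation_two,
      smul_zero, smul_zero, smul_zero, add_zero, add_zero, zero_sub, neg_eq_zero, smul_eq_mul] at h3
    refine eq_zero_of_ofNat_mul 2 (by norm_num) ?_
    rw [map_ofNat, h3]
  rw [eq_prolongV hV, hx, h2, hz]
  exact map_zero prolongV

/-- The image of a symmetry in `csp(4, ℝ) ⋉ S^{k-1}(ℝ^4)`. -/
theorem exists_rel_cspSym (hk : 2 ≤ k) (V : symmetryAlgebra k 3 1) :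
    ∃ T : CspSym (k - 1), Rel V.1 T.right.1 (SymPow.toPoly T.left) := by
  obtain ⟨A, hA, P, hP, h⟩ := exists_rel hk V.2
  exact ⟨⟨⟨P, hP⟩, ⟨A, hA⟩⟩, h⟩

theorem Rel.unique (hk : 2 ≤ k) {V : VField k 3} {S T : CspSym (k - 1)}
    (hS : Rel V S.right.1 (SymPow.toPoly S.left)) (hT : Rel V T.right.1 (SymPow.toPoly T.left)) :
    S = T := by
  have h := hS.sub hT
  rw [sub_self] at h
  obtain ⟨h1, h2⟩ := h.eq_zero hk (sub_mem S.left.2 T.left.2)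
  exact LieAlgebra.SemiDirectSum.ext (SymPow.toPoly_injective (sub_eq_zero.1 h2))
    (Subtype.ext (sub_eq_zero.1 h1))

/-- `Rel` is total and single-valued, so any choice of images is automatically linear and compatible
with brackets. `Rel.eq_zero_of_zero` gives injectivity and `rel_surjective` surjectivity. -/
theorem nonempty_equiv_cspSym (hk : 2 ≤ k) :
    Nonempty (symmetryAlgebra k 3 1 ≃ₗ⁅ℝ⁆ CspSym (k - 1)) := by
  choose f hf using exists_rel_cspSym hk
  let F : symmetryAlgebra k 3 1 →ₗ⁅ℝ⁆ CspSym (k - 1) :=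
    { toFun := f
      map_add' := fun V W => Rel.unique hk (hf _) ((hf V).add (hf W))
      map_smul' := fun t V => Rel.unique hk (hf _) ((hf V).smul t)
      map_lie' := fun {V W} => Rel.unique hk (hf _) <| by
        have := (hf V).lie (by omega) (hf W) (f V).left.2 (f W).left.2
        rw [LieAlgebra.SemiDirectSum.lie_eq_mk, SymPow.lie_eq_zero, zero_add]
        exact this }
  refine ⟨LieEquiv.ofBijective F ⟨?_, fun T => ?_⟩⟩
  · refine (injective_iff_map_eq_zero F).2 fun V hV => Subtype.ext ?_
    have h := hf V
    rw [show f V = 0 from hV] at h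
    exact h.eq_zero_of_zero V.2
  · obtain ⟨V, hV, h⟩ := rel_surjective hk T.right.2 T.left.2
    exact ⟨⟨V, hV⟩, Rel.unique hk (hf _) h⟩

end EqMan

end

/-! ### Assembly of the cases. -/

theorem mainTheorem6 (k l : ℕ) (hk : 2 ≤ k) (hkl : k ≤ l) :
    (∀ δ : ℤ, 0 < δ → δ < (l : ℤ) - k →
      EqMan.symmetrySpace k l δ = EqMan.prolongSpan (EqMan.innerGens k l)) ∧
    (k = 2 → 2 < l →
      EqMan.symmetrySpace 2 l 0 = EqMan.prolongSpan (EqMan.firstKindTwoGens l)) ∧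
    (2 < k → k < l →
      EqMan.symmetrySpace k l 0 = EqMan.prolongSpan (EqMan.firstKindGens k l)) ∧
    (k < l → ¬ (k = 2 ∧ l = 3) →
      EqMan.symmetrySpace k l ((l : ℤ) - k) = EqMan.prolongSpan (EqMan.secondKindGens k l)) ∧
    (k = 3 →
      EqMan.symmetrySpace 3 l (-1) = EqMan.prolongSpan (EqMan.contactYGens l) ∧
      Nonempty (EqMan.symmetryAlgebra 3 l (-1) ≃ₗ⁅ℝ⁆ CspSym (l - 1))) ∧
    (l = 3 →
      EqMan.symmetrySpace k 3 1 = EqMan.prolongSpan (EqMan.contactZGens k) ∧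
      Nonempty (EqMan.symmetryAlgebra k 3 1 ≃ₗ⁅ℝ⁆ CspSym (k - 1))) ∧
    (∀ d : ℕ, 3 ≤ k → ¬ (k = 3 ∧ l = 3) → l - k < d → d ≤ l - 2 →
      EqMan.symmetrySpace k l d = EqMan.prolongSpan (EqMan.outerZGens k l d)) ∧
    (∀ d : ℕ, 4 ≤ k → 0 < d → d ≤ k - 2 →
      EqMan.symmetrySpace k l (-(d : ℤ)) = EqMan.prolongSpan (EqMan.outerYGens k l d)) := by
  refine ⟨fun δ h₀ h₁ => ?_, fun _ h₁ => ?_, fun h₀ h₁ => ?_, fun h₀ h₁ => ?_, fun _ => ⟨?_, ?_⟩,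
    fun _ => ⟨?_, ?_⟩, fun d h₀ h₁ h₂ h₃ => ?_, fun d h₀ h₁ h₂ => ?_⟩
  · obtain ⟨d, rfl⟩ := Int.eq_ofNat_of_zero_le h₀.le
    refine EqMan.symmetrySpace_eq_prolongSpan EqMan.innerGens_eq ?_
    rw [← EqMan.outerT_eq_innerT (d := d) (by omega) (by omega)]
    -- From 0 < δ < l - k and k ≥ 2 it follows that l ≥ 4.
    exact EqMan.symTrip_eq_span_outerT hk (by omega) (Or.inl ⟨by omega, by omega⟩)
  -- Shift 0 is its own negative. The exchange puts the equation of smaller order in the place of z,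
  -- as the unshifted classifications require.
  · exact EqMan.symmetrySpace_neg_eq (δ := (0 : ℕ))
      (EqMan.symmetrySpace_eq_prolongSpan rfl (EqMan.symTrip_eq_span_pointT h₁))
      EqMan.firstKindTwoGens_eq_swap
  · refine EqMan.symmetrySpace_neg_eq (δ := (0 : ℕ))
      (EqMan.symmetrySpace_eq_prolongSpan rfl ?_) EqMan.firstKindGens_eq_swap
    rw [← EqMan.span_outerT_zero (by omega)]
    exact EqMan.symTrip_eq_span_outerT (by omega) (by omega) (Or.inr ⟨rfl, by omega, h₁⟩)
  · rw [← Nat.cast_sub hkl]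
    refine EqMan.symmetrySpace_eq_prolongSpan EqMan.secondKindGens_eq ?_
    rw [← EqMan.outerT_eq_secondT hk hkl]
    -- Here l = 3 would force k = 2, the excluded pair, so l ≥ 4.
    exact EqMan.symTrip_eq_span_outerT hk (by omega) (Or.inl ⟨by omega, by omega⟩)
  · exact EqMan.symmetrySpace_neg_eq (δ := (1 : ℕ))
      (EqMan.symmetrySpace_eq_prolongSpan (EqMan.contactZGens_eq l)
        (EqMan.symTrip_eq_span_contactT (by omega))) EqMan.contactYGens_eq_swap
  · obtain ⟨e⟩ := EqMan.nonempty_equiv_cspSym (k := l) (by omega)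
    exact ⟨(EqMan.swapEquiv l 3 1).symm.trans e⟩
  · exact EqMan.symmetrySpace_eq_prolongSpan (d := 1) (EqMan.contactZGens_eq k)
      (EqMan.symTrip_eq_span_contactT hk)
  · exact EqMan.nonempty_equiv_cspSym hk
  -- Again l ≥ 4, since 3 ≤ k ≤ l and the pair (3, 3) is excluded.
  · exact EqMan.symmetrySpace_eq_prolongSpan (EqMan.outerZGens_eq d)
      (EqMan.symTrip_eq_span_outerT hk (by omega) (Or.inl ⟨by omega, by omega⟩))
  · exact EqMan.symmetrySpace_neg_eq (δ := d)
      (EqMan.symmetrySpace_eq_prolongSpan (EqMan.outerZGens_eq d)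
        (EqMan.symTrip_eq_span_outerT (by omega) (by omega) (Or.inl ⟨by omega, h₀⟩)))
      (EqMan.outerYGens_eq_swap d)
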